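/- \textbf{Setting.} Let $S\subset\mathbb{R}^2$ be a set of $n$ points and $D$ a probability measure on $\mathbb{R}^2$. For $q=(q_x,q_y)$ let $R(q)=[q_x,\infty)\times[q_y,\infty)$. All regions and strips are rectangles $(a,b]\times(c,d]$ with sides in $[-\infty,\infty]$. A \emph{biased range tree} for $(S,D)$ consists of the following parts. \emph{Backup tree}: a balanced range tree on $S$, i.e. a median-split binary search tree on the $x$-coordinate each of whose internal nodes also stores the points below it sorted by $y$. \emph{Primary tree}: a binary tree in which each node $v$ has a region $r(v)$, the root having region $\mathbb{R}^2$. A node $v$ is split iff its depth is less than $\lceil\log_2 n\rceil$ and $r(v)\cap S\neq\emptyset$. At even depth ($v$ is vertical) cut $r(v)$ by the vertical lines through the points of $S\cap r(v)$; at odd depth ($v$ is horizontal) use horizontal lines. The strip $s(v)$ is the non-empty resulting strip such that the strips to its left (below it) have total probability at most $\Pr(r(v))/2$ and the strips to its right (above it) have total probability less than $\Pr(r(v))/2$; if $\Pr(r(v))=0$, any non-empty strip may be used. The left and right child have as regions the (possibly empty) parts of $r(v)$ before and after $s(v)$. If $v$ is a leaf, $s(v)=r(v)$; it is a \emph{bad}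 leaf if $r(v)\cap S\ne\emptyset$. Every $q$ lies in $s(v)$ for exactly one node $v$, whose depth is denoted $d(q)$. \emph{Catalogues}: every node $v$ has two catalogues $C_x(v),C_y(v)\subseteq S$, sorted by $x$ and by $y$ respectively. They are empty for the root and for right children. For the left child $u$ of a vertical node $v$ with right child $w$, $C_x(u)=\emptyset$ and $C_y(u)=(s(v)\cup r(w))\cap S$; for a horizontal node $v$ the roles of $C_x(u)$ and $C_y(u)$ are exchanged. By fractional cascading, every fourth entry of each enlarged catalogue of a node is copied into the corresponding catalogue of both children. \emph{Index trees}: the enlarged $x$- and $y$-catalogues of $v$ are indexed by binary search trees $T_x(v)$, $T_y(v)$ on their distinct keys. These are \emph{biased}: with respect to $D$ conditioned on $s(\mathrm{parent}(v))$ if $v$ is a left child, and on $s(v)$ otherwise, the expected search depth is at most $\sum_i p_i\log_2(1/p_i)+c$, where the $p_i$ are the probabilities of all intervals $(a,b]$ between consecutive keys (with $\pm\infty$ added) and $c$ is an absolute constant. (If the conditioning event has probability $0$, nothing is required of the expected depth.) \emph{Model.} Algorithms are fixed programs, independent of $n$, $S$ and $D$, on a pointer machine with immutable two-field cells (a finite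 table of recursive functions, unit cost per instruction). Coordinates can only be compared, real numbers have unit-cost arithmetic and comparison, and the construction (but not the query algorithm) has a unit-cost oracle for $\Pr(r)$ of rectangles $r$. Space is the number of allocated cells. \textbf{Theorem.} There are absolute constants $c$ and $C$, a construction program and a query program such that the following holds for all $S$ and $D$ as above. (1) In every biased range tree for $(S,D)$, each point of $S$ lies in at most $2$ of the catalogues $C_x(v),C_y(v)$ at each level of the primary tree. If $n\ge2$, the primary tree has height at most $C\log_2 n$, and the total size of the biased range tree (backup tree, primary tree, enlarged catalogues and index trees) is at most $Cn\log_2 n$. (2) Given the points of $S$ as a list in any order and oracle access to $D$, the construction program outputs a biased range tree for $(S,D)$, stored in memory with suitable auxiliary pointers and counts. If $n\ge2$, it uses at most $Cn\log_2 n$ time and at most $Cn\log_2 n$ space. (3) Given this output and any $q\in\mathbb{R}^2$, the query program returns $|R(q)\cap S|$. If $n\ge 2$, it takes at most $C\log_2 n$ time. Moreover, let $v$ be the node with $q\in s(v)$. If $v$ is not a bad leaf, the query takes at most $C\,(1+d(q)+\delta_x+\delta_y)$ time, where $\delta_x$ and $\delta_y$ are the search depths of $q_x$ in $T_x(u)$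 and of $q_y$ in $T_y(u)$, and $u$ is the left child of $v$, or $u=v$ if $v$ is a leaf. -/

import Mathlib

open MeasureTheory

noncomputable section

namespace BRT

/-! ## Points and half-open rectangles -/

/-- Points of the plane (data points and query points). -/
abbrev Pt := ℝ × ℝ

/-- The rectangle `(x0, x1] × (y0, y1]`, open on its left and bottom sides, closed on its right and
top sides, possibly unbounded or empty. -/
structure Box where
  x0 : EReal
  x1 : EReal
  y0 : EReal
  y1 : EReal

namespace Box

def toSet (r : Box) : Set Pt :=
  {p | r.x0 < (p.1 : EReal) ∧ (p.1 : EReal) ≤ r.x1 ∧ r.y0 < (p.2 : EReal) ∧ (p.2 : EReal) ≤ r.y1}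

/-- The whole plane. -/
def plane : Box := ⟨⊥, ⊤, ⊥, ⊤⟩

/-- Left side (even depth, vertical node) or bottom side (odd depth, horizontal node). -/
def lo (r : Box) (d : ℕ) : EReal := if Even d then r.x0 else r.y0

/-- Right side (even depth) or top side (odd depth). -/
def hi (r : Box) (d : ℕ) : EReal := if Even d then r.x1 else r.y1

/-- The part of `r` whose coordinate along the axis cut at depth `d` lies in `(a, b]`, for
`r.lo d ≤ a` and `b ≤ r.hi d`. -/
def slab (r : Box) (d : ℕ) (a b : EReal) : Box :=
  if Even d then { r with x0 := a, x1 := b } else { r with y0 := a, y1 := b }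

end Box

/-- The coordinate along which a node at depth `d` is split: `x` at vertical nodes (even depth),
`y` at horizontal nodes (odd depth). -/
def coordAt (d : ℕ) (p : Pt) : ℝ := if Even d then p.1 else p.2

open Classical in
/-- `S ∩ A`. -/
def inter (S : Finset Pt) (A : Set Pt) : Finset Pt := S.filter (fun p => p ∈ A)

/-! ## Biased search trees -/

/-- Binary search trees with real keys at the internal nodes; a search for `x` goes left at a key
`k` when `x ≤ k` and right otherwise. The leaves correspond to the intervals `(a, b]` between
consecutive keys. -/
inductive STree
  | leaf : STree
  | node (key : ℝ) (left right : STree) : STree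

namespace STree

/-- The keys in symmetric order. -/
def keys : STree → List ℝ
  | leaf => []
  | node k l r => l.keys ++ k :: r.keys

/-- The number of comparisons made by the search for `x`. -/
def searchDepth (x : ℝ) : STree → ℕ
  | leaf => 0
  | node k l r => 1 + if x ≤ k then l.searchDepth x else r.searchDepth x

/-- The leaves of a subtree that starts at depth `d` and is responsible for the interval `(a, b]`,
each with its interval and its depth. -/
def leaves : STree → EReal → EReal → ℕ → List (EReal × EReal × ℕ)
  | leaf, a, b, d => [(a, b, d)]
  | node k l r, a, b, d => l.leaves a k (d + 1) ++ r.leaves k b (d + 1)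

/-- The expected search time `∑ Pr(ℓ) * d(ℓ)` over the leaves `ℓ`, where `w a b` is the probability
of the interval `(a, b]`. -/
def expectedDepth (w : EReal → EReal → ℝ) (t : STree) : ℝ :=
  ((t.leaves ⊥ ⊤ 0).map fun e => w e.1 e.2.1 * (e.2.2 : ℝ)).sum

/-- The binary entropy `∑ p * log₂ (1 / p)` of the distribution of the search over the leaf
intervals. -/
def entropy (w : EReal → EReal → ℝ) (t : STree) : ℝ :=
  ((t.leaves ⊥ ⊤ 0).map fun e => Real.negMulLog (w e.1 e.2.1) / Real.log 2).sum

/-- `t` is a biased search tree, with additive slack `c`, for the set `X` of keys and the interval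
probabilities `w`. -/
def IsBiased (c : ℝ) (X : Set ℝ) (w : EReal → EReal → ℝ) (t : STree) : Prop :=
  t.keys.Pairwise (· < ·) ∧ (∀ x, x ∈ t.keys ↔ x ∈ X) ∧ t.expectedDepth w ≤ t.entropy w + c

end STree

/-! ## The backup range tree -/

/-- Two-level range trees: a binary search tree on `x` with the points at the leaves; each internal
node stores its key and the list of all points below it in `y`-order. -/
inductive RangeTree
  | empty : RangeTree
  | leaf (p : Pt) : RangeTree
  | node (key : ℝ) (ys : List Pt) (left right : RangeTree) : RangeTree

namespace RangeTree

/-- The points at the leaves. -/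
def points : RangeTree → List Pt
  | empty => []
  | leaf p => [p]
  | node _ _ l r => l.points ++ r.points

/-- Search order on `x`, associated lists in `y`-order, and median splits (so that the tree is
balanced). -/
def WellFormed : RangeTree → Prop
  | empty => True
  | leaf _ => True
  | node k ys l r =>
      l.points ≠ [] ∧ r.points ≠ [] ∧
      l.points.length ≤ r.points.length + 1 ∧ r.points.length ≤ l.points.length + 1 ∧
      (∀ p ∈ l.points, p.1 ≤ k) ∧ (∀ p ∈ r.points, k ≤ p.1) ∧
      ys.Perm (l.points ++ r.points) ∧ ys.Pairwise (fun p q => p.2 ≤ q.2) ∧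
      l.WellFormed ∧ r.WellFormed

/-- `t` is a range tree storing the point set `S`. -/
def IsRangeTree (S : Finset Pt) (t : RangeTree) : Prop :=
  t.points.Perm S.toList ∧ t.WellFormed

/-- Number of nodes plus total length of the associated lists. -/
def size : RangeTree → ℕ
  | empty => 1
  | leaf _ => 1
  | node _ ys l r => 1 + ys.length + l.size + r.size

end RangeTree

/-! ## The primary tree with its catalogues -/

/-- An entry of a catalogue after fractional cascading; the flag is `true` for the points that
belong to the catalogue itself and `false` for the copies cascaded from the parent. -/
abbrev Entry := Pt × Bool

/-- The sample cascaded from a catalogue into the catalogues of the children: every fourth entry. -/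
def everyFourth : List Entry → List Entry
  | _ :: _ :: _ :: e :: l => e :: everyFourth l
  | _ => []

/-- `L` is, in order of the coordinate `f`, the catalogue with own point set `C` together with the
sample of the catalogue `parent`. -/
def IsCatalogue (f : Pt → ℝ) (C : Finset Pt) (parent L : List Entry) : Prop :=
  L.Pairwise (fun e e' => f e.1 ≤ f e'.1) ∧
    L.Perm (C.toList.map (fun p => (p, true)) ++
      (everyFourth parent).map (fun e => (e.1, false)))

/-- The data stored with a node `v`: region `r(v)`, strip `s(v)`, the two catalogues after
fractional cascading, and the search trees `T_x(v)`, `T_y(v)` that index them. -/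
structure Node where
  region : Box
  strip : Box
  catX : List Entry
  catY : List Entry
  idxX : STree
  idxY : STree

namespace Node

/-- The catalogue `C_x(v)`: the points of `catX` that are not cascaded copies. -/
def cX (v : Node) : List Pt := (v.catX.filter (fun e => e.2)).map (fun e => e.1)

/-- The catalogue `C_y(v)`. -/
def cY (v : Node) : List Pt := (v.catY.filter (fun e => e.2)).map (fun e => e.1)

/-- Size of the node with its cascaded catalogues and their index trees. -/
def size (v : Node) : ℕ :=
  1 + v.catX.length + v.catY.length + v.idxX.keys.length + v.idxY.keys.length

/-- Correctness of the data of a node with region `r` and strip `s`, own catalogues `Cx` and `Cy`,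
parent catalogues `pX` and `pY`; the index trees are biased, with slack `c`, for the
distribution `D` conditioned on the rectangle `w`. -/
def WellFormed (c : ℝ) (D : Measure Pt) (r s w : Box) (Cx Cy : Finset Pt) (pX pY : List Entry)
    (v : Node) : Prop :=
  v.region = r ∧ v.strip = s ∧
  IsCatalogue Prod.fst Cx pX v.catX ∧ IsCatalogue Prod.snd Cy pY v.catY ∧
  v.idxX.IsBiased c {x | ∃ e ∈ v.catX, e.1.1 = x}
    (fun a b => (ProbabilityTheory.cond D w.toSet).real
      {q | a < (q.1 : EReal) ∧ (q.1 : EReal) ≤ b}) ∧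
  v.idxY.IsBiased c {y | ∃ e ∈ v.catY, e.1.2 = y}
    (fun a b => (ProbabilityTheory.cond D w.toSet).real
      {q | a < (q.2 : EReal) ∧ (q.2 : EReal) ≤ b})

end Node

/-- `(a, b]` bounds the strip removed from the region `r` of a split node at depth `d`: it is one
of the nonempty strips into which `r` is cut by the lines through the points of `S ∩ r`, the strips
before it have total probability at most `Pr(r) / 2`, and the strips after it have total
probability less than `Pr(r) / 2`. If `Pr(r) = 0` the last condition cannot hold and is dropped, so
that any of the strips may be used. -/
def IsStrip (S : Finset Pt) (D : Measure Pt) (d : ℕ) (r : Box) (a b : EReal) : Prop :=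
  a < b ∧
  (a = r.lo d ∨ ∃ p ∈ inter S r.toSet, (coordAt d p : EReal) = a) ∧
  (b = r.hi d ∨ ∃ p ∈ inter S r.toSet, (coordAt d p : EReal) = b) ∧
  (∀ p ∈ inter S r.toSet, (coordAt d p : EReal) ≤ a ∨ b ≤ (coordAt d p : EReal)) ∧
  D.real (r.slab d (r.lo d) a).toSet ≤ D.real r.toSet / 2 ∧
  (D.real (r.slab d b (r.hi d)).toSet < D.real r.toSet / 2 ∨ D.real r.toSet = 0)

inductive PrimaryTree
  | leaf (v : Node) : PrimaryTree
  | split (v : Node) (left right : PrimaryTree) : PrimaryTree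

namespace PrimaryTree

def root : PrimaryTree → Node
  | leaf v => v
  | split v _ _ => v

/-- The subtree of the primary tree for `(S, D)` that hangs at depth `d` and has region `r`. A node
is split exactly when its region contains a point of `S` and its depth is less than `⌈log₂ |S|⌉`.
`w` is `some s` if the root of the subtree is the left child of a node with strip `s`, and `none`
if it is a right child or the root of the whole tree; `Cx`, `Cy` are its catalogues and
`pX`, `pY` the cascaded catalogues of its parent. -/
def WellFormed (c : ℝ) (S : Finset Pt) (D : Measure Pt) :
    PrimaryTree → ℕ → Box → Option Box → Finset Pt → Finset Pt →
      List Entry → List Entry → Prop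
  | leaf v, d, r, w, Cx, Cy, pX, pY =>
      ¬ ((inter S r.toSet).Nonempty ∧ d < Nat.clog 2 S.card) ∧
      v.WellFormed c D r r (w.getD r) Cx Cy pX pY
  | split v left right, d, r, w, Cx, Cy, pX, pY =>
      ((inter S r.toSet).Nonempty ∧ d < Nat.clog 2 S.card) ∧
      ∃ a b : EReal, IsStrip S D d r a b ∧
        v.WellFormed c D r (r.slab d a b) (w.getD (r.slab d a b)) Cx Cy pX pY ∧
        left.WellFormed c S D (d + 1) (r.slab d (r.lo d) a) (some (r.slab d a b))
          (if Even d then ∅ else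
            inter S ((r.slab d a b).toSet ∪ (r.slab d b (r.hi d)).toSet))
          (if Even d then inter S ((r.slab d a b).toSet ∪ (r.slab d b (r.hi d)).toSet)
            else ∅)
          v.catX v.catY ∧
        right.WellFormed c S D (d + 1) (r.slab d b (r.hi d)) none ∅ ∅ v.catX v.catY

def height : PrimaryTree → ℕ
  | leaf _ => 0
  | split _ l r => 1 + max l.height r.height

/-- The nodes at level `k`. -/
def level : PrimaryTree → ℕ → List Node
  | leaf v, 0 => [v]
  | leaf _, _ + 1 => []
  | split v _ _, 0 => [v]
  | split _ l r, k + 1 => l.level k ++ r.level k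

/-- Total size of the nodes, of their cascaded catalogues and of the index trees. -/
def size : PrimaryTree → ℕ
  | leaf v => v.size
  | split v l r => v.size + l.size + r.size

open Classical in
/-- The subtree rooted at the node `v` with `q ∈ s(v)`, reached by descending from the root. -/
def locate (q : Pt) : PrimaryTree → PrimaryTree
  | leaf v => leaf v
  | split v l r =>
      if q ∈ v.strip.toSet then split v l r
      else if q ∈ l.root.region.toSet then l.locate q
      else r.locate q

open Classical in
/-- The depth of the node `v` with `q ∈ s(v)`. -/
def depth (q : Pt) : PrimaryTree → ℕ
  | leaf _ => 0
  | split v l r =>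
      if q ∈ v.strip.toSet then 0
      else if q ∈ l.root.region.toSet then 1 + l.depth q
      else 1 + r.depth q

/-- The root is a bad leaf (for a leaf of the primary tree, a point of `S` in its region). -/
def IsBad (S : Finset Pt) : PrimaryTree → Prop
  | leaf v => (inter S v.region.toSet).Nonempty
  | split _ _ _ => False

/-- The left child of the root, or the root itself if it is a leaf. -/
def start : PrimaryTree → Node
  | leaf v => v
  | split _ l _ => l.root

/-- The number of comparisons made when `q` is located in the two catalogues of the node `u` at
which the catalogue walk starts. -/
def indexCost (q : Pt) (T : PrimaryTree) : ℕ :=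
  (T.locate q).start.idxX.searchDepth q.1 + (T.locate q).start.idxY.searchDepth q.2

end PrimaryTree

/-- A biased range tree consists of a backup range tree and a primary tree with catalogues. -/
structure BiasedRangeTree where
  backup : RangeTree
  primary : PrimaryTree

namespace BiasedRangeTree

/-- `T` is a biased range tree for `(S, D)`, the index trees being biased with slack `c`. -/
def IsFor (c : ℝ) (S : Finset Pt) (D : Measure Pt) (T : BiasedRangeTree) : Prop :=
  T.backup.IsRangeTree S ∧ T.primary.WellFormed c S D 0 Box.plane none ∅ ∅ [] []

def size (T : BiasedRangeTree) : ℕ := T.backup.size + T.primary.size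

end BiasedRangeTree

/-! ## The model of computation

A program is a finite table of first-order recursive functions over immutable memory cells with two
fields. Every instruction takes unit time. Coordinates can only be compared; numbers are
reals with unit-cost arithmetic and comparison; the probability of a rectangle is provided by an
oracle in unit time. There are no arrays and no destructive updates, so every such program can be
run on a pointer machine or a RAM with constant overhead. -/

/-- Contents of a memory field. `pair` stands for a pointer to a cell with two fields; since cells
are immutable, copying a value means copying a pointer. -/
inductive Val
  | nil : Val
  | coord (x : EReal) : Val
  | num (r : ℝ) : Val
  | pair (a b : Val) : Val

inductive ArithOp
  | add | sub | mul | div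

def ArithOp.apply : ArithOp → ℝ → ℝ → ℝ
  | add, a, b => a + b
  | sub, a, b => a - b
  | mul, a, b => a * b
  | div, a, b => a / b

/-- Expressions; variables are de Bruijn indices. -/
inductive Expr
  | var (i : ℕ) : Expr
  | nil : Expr
  | num (k : ℤ) : Expr
  | negInf : Expr
  | posInf : Expr
  | pair (e₁ e₂ : Expr) : Expr
  | fst (e : Expr) : Expr
  | snd (e : Expr) : Expr
  | letIn (e body : Expr) : Expr
  | arith (op : ArithOp) (e₁ e₂ : Expr) : Expr
  | ifPair (e t f : Expr) : Expr
  | ifNumLe (e₁ e₂ t f : Expr) : Expr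
  | ifCoordLe (e₁ e₂ t f : Expr) : Expr
  | prob (x0 x1 y0 y1 : Expr) : Expr
  | call (f : ℕ) (arg : Expr) : Expr

/-- The table of function bodies; function `0` is the main one. In a function body variable `0` is
the argument. -/
abbrev Program := List Expr

/-- `Eval O P env e v t s`: in the environment `env`, the expression `e` of the program `P`
evaluates to `v` in `t` steps, allocating `s` memory cells, where `O` is the oracle for
probabilities of rectangles. -/
inductive Eval (O : Box → ℝ) (P : Program) : List Val → Expr → Val → ℕ → ℕ → Prop
  | var {env i v} (h : env[i]? = some v) : Eval O P env (.var i) v 1 0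
  | nil {env} : Eval O P env .nil .nil 1 0
  | num {env} (k : ℤ) : Eval O P env (.num k) (.num (k : ℝ)) 1 0
  | negInf {env} : Eval O P env .negInf (.coord ⊥) 1 0
  | posInf {env} : Eval O P env .posInf (.coord ⊤) 1 0
  | pair {env e₁ e₂ v₁ v₂ t₁ t₂ s₁ s₂} (h₁ : Eval O P env e₁ v₁ t₁ s₁)
      (h₂ : Eval O P env e₂ v₂ t₂ s₂) :
      Eval O P env (.pair e₁ e₂) (.pair v₁ v₂) (t₁ + t₂ + 1) (s₁ + s₂ + 1)
  | fst {env e a b t s} (h : Eval O P env e (.pair a b) t s) :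
      Eval O P env (.fst e) a (t + 1) s
  | snd {env e a b t s} (h : Eval O P env e (.pair a b) t s) :
      Eval O P env (.snd e) b (t + 1) s
  | letIn {env e body v w t₁ t₂ s₁ s₂} (h₁ : Eval O P env e v t₁ s₁)
      (h₂ : Eval O P (v :: env) body w t₂ s₂) :
      Eval O P env (.letIn e body) w (t₁ + t₂ + 1) (s₁ + s₂)
  | arith {env op e₁ e₂ a b t₁ t₂ s₁ s₂} (h₁ : Eval O P env e₁ (.num a) t₁ s₁)
      (h₂ : Eval O P env e₂ (.num b) t₂ s₂) :
      Eval O P env (.arith op e₁ e₂) (.num (op.apply a b)) (t₁ + t₂ + 1) (s₁ + s₂)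
  | ifPair_true {env e t f a b v t₁ t₂ s₁ s₂} (h₁ : Eval O P env e (.pair a b) t₁ s₁)
      (h₂ : Eval O P env t v t₂ s₂) :
      Eval O P env (.ifPair e t f) v (t₁ + t₂ + 1) (s₁ + s₂)
  | ifPair_false {env e t f u v t₁ t₂ s₁ s₂} (h₁ : Eval O P env e u t₁ s₁)
      (hu : ∀ a b, u ≠ .pair a b) (h₂ : Eval O P env f v t₂ s₂) :
      Eval O P env (.ifPair e t f) v (t₁ + t₂ + 1) (s₁ + s₂)
  | ifNumLe_true {env e₁ e₂ t f a b v t₁ t₂ t₃ s₁ s₂ s₃}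
      (h₁ : Eval O P env e₁ (.num a) t₁ s₁) (h₂ : Eval O P env e₂ (.num b) t₂ s₂)
      (hab : a ≤ b) (h₃ : Eval O P env t v t₃ s₃) :
      Eval O P env (.ifNumLe e₁ e₂ t f) v (t₁ + t₂ + t₃ + 1) (s₁ + s₂ + s₃)
  | ifNumLe_false {env e₁ e₂ t f a b v t₁ t₂ t₃ s₁ s₂ s₃}
      (h₁ : Eval O P env e₁ (.num a) t₁ s₁) (h₂ : Eval O P env e₂ (.num b) t₂ s₂)
      (hab : ¬ a ≤ b) (h₃ : Eval O P env f v t₃ s₃) :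
      Eval O P env (.ifNumLe e₁ e₂ t f) v (t₁ + t₂ + t₃ + 1) (s₁ + s₂ + s₃)
  | ifCoordLe_true {env e₁ e₂ t f a b v t₁ t₂ t₃ s₁ s₂ s₃}
      (h₁ : Eval O P env e₁ (.coord a) t₁ s₁) (h₂ : Eval O P env e₂ (.coord b) t₂ s₂)
      (hab : a ≤ b) (h₃ : Eval O P env t v t₃ s₃) :
      Eval O P env (.ifCoordLe e₁ e₂ t f) v (t₁ + t₂ + t₃ + 1) (s₁ + s₂ + s₃)
  | ifCoordLe_false {env e₁ e₂ t f a b v t₁ t₂ t₃ s₁ s₂ s₃}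
      (h₁ : Eval O P env e₁ (.coord a) t₁ s₁) (h₂ : Eval O P env e₂ (.coord b) t₂ s₂)
      (hab : ¬ a ≤ b) (h₃ : Eval O P env f v t₃ s₃) :
      Eval O P env (.ifCoordLe e₁ e₂ t f) v (t₁ + t₂ + t₃ + 1) (s₁ + s₂ + s₃)
  | prob {env e₁ e₂ e₃ e₄ a b c d t₁ t₂ t₃ t₄ s₁ s₂ s₃ s₄}
      (h₁ : Eval O P env e₁ (.coord a) t₁ s₁) (h₂ : Eval O P env e₂ (.coord b) t₂ s₂)
      (h₃ : Eval O P env e₃ (.coord c) t₃ s₃) (h₄ : Eval O P env e₄ (.coord d) t₄ s₄) :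
      Eval O P env (.prob e₁ e₂ e₃ e₄) (.num (O ⟨a, b, c, d⟩)) (t₁ + t₂ + t₃ + t₄ + 1)
        (s₁ + s₂ + s₃ + s₄)
  | call {env f arg body v w t₁ t₂ s₁ s₂} (h₁ : Eval O P env arg v t₁ s₁)
      (hf : P[f]? = some body) (h₂ : Eval O P [v] body w t₂ s₂) :
      Eval O P env (.call f arg) w (t₁ + t₂ + 1) (s₁ + s₂)

/-- The program `P`, started on `input`, outputs `out` after `t` steps, having allocated `s`
memory cells in total. -/
def Runs (O : Box → ℝ) (P : Program) (input out : Val) (t s : ℕ) : Prop :=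
  Eval O P [input] (.call 0 (.var 0)) out t s

/-- Access to the distribution `D`. -/
def oracle (D : Measure Pt) : Box → ℝ := fun r => D.real r.toSet

/-- The oracle without information, for computations without access to the distribution. -/
def noOracle : Box → ℝ := fun _ => 0

/-! ## Representation in memory

Records and list entries may carry additional fields `aux` (such as subtree sizes and the pointers
of fractional cascading). -/

def encodePt (p : Pt) : Val := .pair (.coord (p.1 : EReal)) (.coord (p.2 : EReal))

/-- An input list of points. -/
def encodePts : List Pt → Val
  | [] => .nil
  | p :: l => .pair (encodePt p) (encodePts l)

def encodeBox (r : Box) : Val :=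
  .pair (.pair (.coord r.x0) (.coord r.x1)) (.pair (.coord r.y0) (.coord r.y1))

def encodeEntry (e : Entry) : Val :=
  .pair (encodePt e.1) (.num (if e.2 then 1 else 0))

/-- `v` is a linked list with the items of `l`. -/
def RepList {α : Type} (enc : α → Val) : List α → Val → Prop
  | [], v => v = .nil
  | a :: l, v => ∃ aux tail, v = .pair (.pair (enc a) aux) tail ∧ RepList enc l tail

def STree.Rep : STree → Val → Prop
  | .leaf, v => ∃ aux, v = .pair .nil aux
  | .node k l r, v => ∃ aux vl vr,
      v = .pair (.pair (.coord (k : EReal)) aux) (.pair vl vr) ∧ l.Rep vl ∧ r.Rep vr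

def RangeTree.Rep : RangeTree → Val → Prop
  | .empty, v => v = .nil
  | .leaf p, v => ∃ aux, v = .pair .nil (.pair (encodePt p) aux)
  | .node k ys l r, v => ∃ aux vys vl vr,
      v = .pair (.pair vl vr) (.pair (.coord (k : EReal)) (.pair vys aux)) ∧
      RepList encodePt ys vys ∧ l.Rep vl ∧ r.Rep vr

def Node.Rep (x : Node) (v : Val) : Prop :=
  ∃ aux vcx vcy vtx vty,
    v = .pair (.pair (encodeBox x.region) (encodeBox x.strip))
      (.pair (.pair (.pair vcx vtx) (.pair vcy vty)) aux) ∧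
    RepList encodeEntry x.catX vcx ∧ RepList encodeEntry x.catY vcy ∧
    x.idxX.Rep vtx ∧ x.idxY.Rep vty

def PrimaryTree.Rep : PrimaryTree → Val → Prop
  | .leaf x, v => ∃ vx, v = .pair .nil vx ∧ x.Rep vx
  | .split x l r, v => ∃ vx vl vr,
      v = .pair (.pair vl vr) vx ∧ x.Rep vx ∧ l.Rep vl ∧ r.Rep vr

def BiasedRangeTree.Rep (T : BiasedRangeTree) (v : Val) : Prop :=
  ∃ aux vb vp, v = .pair vb (.pair vp aux) ∧ T.backup.Rep vb ∧ T.primary.Rep vp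

/-! ## Range counting -/

open Classical in
/-- `|R(q) ∩ S|` for the query range `R(q) = [q_x, ∞) × [q_y, ∞)`. -/
def rangeCount (S : Finset Pt) (q : Pt) : ℕ :=
  (S.filter (fun p => q.1 ≤ p.1 ∧ q.2 ≤ p.2)).card

end BRT

end

open MeasureTheory

noncomputable section

namespace BRT

/-! ## A predicate transformer for programs -/

/-! Correctness of the query. Along the descent towards the node `v` with `q ∈ s(v)`, a step to a
right child discards only points whose coordinate is below that of `q`. A step to a left child
discards `s ∪ r(w)`. No point of `S` lies strictly inside a strip, so every point of `s ∪ r(w)` is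
on or beyond the far line of the strip and satisfies one of the two inequalities defining `R(q)`
automatically. Its share of the answer is therefore a one-dimensional rank in a single catalogue
(`IsStrip.above_left`). At `v` itself the catalogues of its left child do the same. The points
counted by the catalogues of the chain plus the points of `R(q)` left in the current region form an
invariant of the descent (`locate_spec`). In a leaf without points of `S` nothing is left over; in a
bad leaf the backup tree answers the query (`backup_spec`).

Speed of the query. Only the two catalogues at the starting node are searched. The cascading
pointers lead from a child to its parent: every fourth entry of the parent is copied, so a position
in the child determines the position in the parent up to three steps (`cascade_spec`, `walk_spec`).

Index trees. The probability of each gap between consecutive keys is increased by `1 / (m + 1)`,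
where `m` is the length of the list, so the weights add up to at most 2. The gaps are placed at the
midpoints of consecutive intervals of these lengths, and the cell `[0, 2)` is bisected recursively.
A gap of weight `q` that is not alone in its cell weighs at most twice the cell, so its depth `n`
satisfies `q * 2 ^ n ≤ 8` (`trie_step`). This gives expected depth at most entropy plus 3
(`leaf_cost_le`). The extra weight makes every depth logarithmic and the bisection linear in time
(`index_spec`).

Size and construction time. The enlarged catalogues of the two children contain at most half as many
copies as the parent has entries, plus at most one own entry per point of the region. Sibling
regions are disjoint and there are `⌈log₂ n⌉` levels, so a potential combining catalogue length,
points times remaining levels, and a power of two for the nodes closes the induction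
(`primary_spec`, `PrimaryTree.WellFormed.size_le`).

Programs are verified with a weakest-precondition calculus that carries the running time. Each
allocation takes a step, so space is bounded by time. -/

theorem Eval.space_le_time {O : Box → ℝ} {P : Program} {env : List Val} {e : Expr} {v : Val}
    {t s : ℕ} (h : Eval O P env e v t s) : s ≤ t := by
  induction h <;> omega

/-- Function `f` of `P` on input `v` returns some `w` after `t` steps with `Q w t`. -/
def Spec (O : Box → ℝ) (P : Program) (f : ℕ) (v : Val) (Q : Val → ℕ → Prop) : Prop :=
  ∃ body w t s, P[f]? = some body ∧ Eval O P [v] body w t s ∧ Q w t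

theorem Spec.mono {O : Box → ℝ} {P : Program} {f : ℕ} {v : Val} {Q Q' : Val → ℕ → Prop}
    (h : Spec O P f v Q) (hQ : ∀ w t, Q w t → Q' w t) : Spec O P f v Q' := by
  obtain ⟨b, w, t, s, h1, h2, h3⟩ := h
  exact ⟨b, w, t, s, h1, h2, hQ w t h3⟩

/-- These eliminators take a continuation and are false on values of the wrong shape, so a proved
precondition also excludes runtime type errors. -/
def Val.asPair (v : Val) (K : Val → Val → Prop) : Prop :=
  match v with
  | .pair a b => K a b
  | _ => False

def Val.asNum (v : Val) (K : ℝ → Prop) : Prop :=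
  match v with
  | .num a => K a
  | _ => False

def Val.asCoord (v : Val) (K : EReal → Prop) : Prop :=
  match v with
  | .coord a => K a
  | _ => False

def Val.casePair (v : Val) (K K' : Prop) : Prop :=
  match v with
  | .pair _ _ => K
  | _ => K'

def lookup : List Val → ℕ → (Val → Prop) → Prop
  | [], _, _ => False
  | v :: _, 0, K => K v
  | _ :: l, i + 1, K => lookup l i K

theorem Val.asPair_pair (a b : Val) (K : Val → Val → Prop) : (Val.pair a b).asPair K = K a b := rfl
theorem Val.asNum_num (a : ℝ) (K : ℝ → Prop) : (Val.num a).asNum K = K a := rfl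
theorem Val.asCoord_coord (a : EReal) (K : EReal → Prop) : (Val.coord a).asCoord K = K a := rfl
theorem Val.casePair_pair (a b : Val) (K K' : Prop) : (Val.pair a b).casePair K K' = K := rfl
theorem Val.casePair_nil (K K' : Prop) : Val.nil.casePair K K' = K' := rfl
theorem Val.casePair_coord (x : EReal) (K K' : Prop) : (Val.coord x).casePair K K' = K' := rfl

open Classical in
/-- The weakest precondition of an expression, with calls described by `Spec`. -/
def wp (O : Box → ℝ) (P : Program) : Expr → List Val → (Val → ℕ → Prop) → Prop
  | .var i, env, Q => lookup env i fun v => Q v 1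
  | .nil, _, Q => Q .nil 1
  | .num k, _, Q => Q (.num k) 1
  | .negInf, _, Q => Q (.coord ⊥) 1
  | .posInf, _, Q => Q (.coord ⊤) 1
  | .pair e₁ e₂, env, Q =>
      wp O P e₁ env fun v t => wp O P e₂ env fun w t' => Q (.pair v w) (t + t' + 1)
  | .fst e, env, Q => wp O P e env fun v t => v.asPair fun a _ => Q a (t + 1)
  | .snd e, env, Q => wp O P e env fun v t => v.asPair fun _ b => Q b (t + 1)
  | .letIn e body, env, Q =>
      wp O P e env fun v t => wp O P body (v :: env) fun w t' => Q w (t + t' + 1)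
  | .arith op e₁ e₂, env, Q => wp O P e₁ env fun v t => wp O P e₂ env fun w t' =>
      v.asNum fun a => w.asNum fun b => Q (.num (op.apply a b)) (t + t' + 1)
  | .ifPair e e₁ e₂, env, Q => wp O P e env fun v t => v.casePair
      (wp O P e₁ env fun w t' => Q w (t + t' + 1)) (wp O P e₂ env fun w t' => Q w (t + t' + 1))
  | .ifNumLe e₁ e₂ e₃ e₄, env, Q => wp O P e₁ env fun v t => wp O P e₂ env fun w t' =>
      v.asNum fun a => w.asNum fun b =>
        if a ≤ b then wp O P e₃ env fun u t'' => Q u (t + t' + t'' + 1)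
        else wp O P e₄ env fun u t'' => Q u (t + t' + t'' + 1)
  | .ifCoordLe e₁ e₂ e₃ e₄, env, Q => wp O P e₁ env fun v t => wp O P e₂ env fun w t' =>
      v.asCoord fun a => w.asCoord fun b =>
        if a ≤ b then wp O P e₃ env fun u t'' => Q u (t + t' + t'' + 1)
        else wp O P e₄ env fun u t'' => Q u (t + t' + t'' + 1)
  | .prob e₁ e₂ e₃ e₄, env, Q =>
      wp O P e₁ env fun v t => wp O P e₂ env fun v' t' => wp O P e₃ env fun w u =>
      wp O P e₄ env fun w' u' =>
        v.asCoord fun a => v'.asCoord fun b => w.asCoord fun c => w'.asCoord fun d =>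
          Q (.num (O ⟨a, b, c, d⟩)) (t + t' + u + u' + 1)
  | .call f arg, env, Q => wp O P arg env fun v t => Spec O P f v fun w t' => Q w (t + t' + 1)

theorem lookup_iff {l : List Val} {i : ℕ} {K : Val → Prop} (h : lookup l i K) :
    ∃ v, l[i]? = some v ∧ K v := by
  induction l generalizing i with
  | nil => exact h.elim
  | cons v l ih =>
    cases i with
    | zero => exact ⟨v, rfl, h⟩
    | succ i => simpa using ih h

theorem Val.asPair_iff {v : Val} {K : Val → Val → Prop} (h : v.asPair K) :
    ∃ a b, v = .pair a b ∧ K a b := by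
  cases v <;> first | exact h.elim | exact ⟨_, _, rfl, h⟩

theorem Val.asNum_iff {v : Val} {K : ℝ → Prop} (h : v.asNum K) : ∃ a, v = .num a ∧ K a := by
  cases v <;> first | exact h.elim | exact ⟨_, rfl, h⟩

theorem Val.asCoord_iff {v : Val} {K : EReal → Prop} (h : v.asCoord K) :
    ∃ a, v = .coord a ∧ K a := by
  cases v <;> first | exact h.elim | exact ⟨_, rfl, h⟩

theorem Val.casePair_iff {v : Val} {K K' : Prop} (h : v.casePair K K') :
    (∃ a b, v = .pair a b ∧ K) ∨ ((∀ a b, v ≠ .pair a b) ∧ K') := by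
  cases v
  case pair a b => exact .inl ⟨a, b, rfl, h⟩
  all_goals exact .inr ⟨by simp, h⟩

/-- Induction on the expression suffices although programs are recursive: a call is described by
`Spec`, which already contains a finite evaluation of the callee. Recursive functions are then
handled by induction on their data, which gives termination at the same time. -/
theorem wp_sound {O : Box → ℝ} {P : Program} (e : Expr) : ∀ {env : List Val}
    {Q : Val → ℕ → Prop}, wp O P e env Q → ∃ v t s, Eval O P env e v t s ∧ Q v t := by
  induction e with
  | var i =>
    intro env Q h
    obtain ⟨v, h1, h2⟩ := lookup_iff h
    exact ⟨v, _, _, .var h1, h2⟩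
  | nil => intro env Q h; exact ⟨_, _, _, .nil, h⟩
  | num k => intro env Q h; exact ⟨_, _, _, .num k, h⟩
  | negInf => intro env Q h; exact ⟨_, _, _, .negInf, h⟩
  | posInf => intro env Q h; exact ⟨_, _, _, .posInf, h⟩
  | pair e₁ e₂ ih₁ ih₂ =>
    intro env Q h
    obtain ⟨v, t, s, h1, h⟩ := ih₁ h
    obtain ⟨w, t', s', h2, h⟩ := ih₂ h
    exact ⟨_, _, _, .pair h1 h2, h⟩
  | fst e ih =>
    intro env Q h
    obtain ⟨v, t, s, h1, h⟩ := ih h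
    obtain ⟨a, b, rfl, h⟩ := Val.asPair_iff h
    exact ⟨_, _, _, .fst h1, h⟩
  | snd e ih =>
    intro env Q h
    obtain ⟨v, t, s, h1, h⟩ := ih h
    obtain ⟨a, b, rfl, h⟩ := Val.asPair_iff h
    exact ⟨_, _, _, .snd h1, h⟩
  | letIn e₁ e₂ ih₁ ih₂ =>
    intro env Q h
    obtain ⟨v, t, s, h1, h⟩ := ih₁ h
    obtain ⟨w, t', s', h2, h⟩ := ih₂ h
    exact ⟨_, _, _, .letIn h1 h2, h⟩
  | arith op e₁ e₂ ih₁ ih₂ =>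
    intro env Q h
    obtain ⟨v, t, s, h1, h⟩ := ih₁ h
    obtain ⟨w, t', s', h2, h⟩ := ih₂ h
    obtain ⟨a, rfl, h⟩ := Val.asNum_iff h
    obtain ⟨b, rfl, h⟩ := Val.asNum_iff (v := w) h
    exact ⟨_, _, _, .arith h1 h2, h⟩
  | ifPair e e₁ e₂ ih ih₁ ih₂ =>
    intro env Q h
    obtain ⟨v, t, s, h1, h⟩ := ih h
    rcases Val.casePair_iff h with ⟨a, b, rfl, h⟩ | ⟨hv, h⟩
    · obtain ⟨w, t', s', h2, h⟩ := ih₁ h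
      exact ⟨_, _, _, .ifPair_true h1 h2, h⟩
    · obtain ⟨w, t', s', h2, h⟩ := ih₂ h
      exact ⟨_, _, _, .ifPair_false h1 hv h2, h⟩
  | ifNumLe e₁ e₂ e₃ e₄ ih₁ ih₂ ih₃ ih₄ =>
    intro env Q h
    obtain ⟨v, t, s, h1, h⟩ := ih₁ h
    obtain ⟨w, t', s', h2, h⟩ := ih₂ h
    obtain ⟨a, rfl, h⟩ := Val.asNum_iff h
    obtain ⟨b, rfl, h⟩ := Val.asNum_iff (v := w) h
    change (if a ≤ b then _ else _) at h
    split_ifs at h with hab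
    · obtain ⟨_, _, _, h3, h⟩ := ih₃ h
      exact ⟨_, _, _, .ifNumLe_true h1 h2 hab h3, h⟩
    · obtain ⟨_, _, _, h3, h⟩ := ih₄ h
      exact ⟨_, _, _, .ifNumLe_false h1 h2 hab h3, h⟩
  | ifCoordLe e₁ e₂ e₃ e₄ ih₁ ih₂ ih₃ ih₄ =>
    intro env Q h
    obtain ⟨v, t, s, h1, h⟩ := ih₁ h
    obtain ⟨w, t', s', h2, h⟩ := ih₂ h
    obtain ⟨a, rfl, h⟩ := Val.asCoord_iff h
    obtain ⟨b, rfl, h⟩ := Val.asCoord_iff (v := w) h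
    change (if a ≤ b then _ else _) at h
    split_ifs at h with hab
    · obtain ⟨_, _, _, h3, h⟩ := ih₃ h
      exact ⟨_, _, _, .ifCoordLe_true h1 h2 hab h3, h⟩
    · obtain ⟨_, _, _, h3, h⟩ := ih₄ h
      exact ⟨_, _, _, .ifCoordLe_false h1 h2 hab h3, h⟩
  | prob e₁ e₂ e₃ e₄ ih₁ ih₂ ih₃ ih₄ =>
    intro env Q h
    obtain ⟨v₁, _, _, h1, h⟩ := ih₁ h
    obtain ⟨v₂, _, _, h2, h⟩ := ih₂ h
    obtain ⟨v₃, _, _, h3, h⟩ := ih₃ h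
    obtain ⟨v₄, _, _, h4, h⟩ := ih₄ h
    obtain ⟨_, rfl, h⟩ := Val.asCoord_iff (v := v₁) h
    obtain ⟨_, rfl, h⟩ := Val.asCoord_iff (v := v₂) h
    obtain ⟨_, rfl, h⟩ := Val.asCoord_iff (v := v₃) h
    obtain ⟨_, rfl, h⟩ := Val.asCoord_iff (v := v₄) h
    exact ⟨_, _, _, .prob h1 h2 h3 h4, h⟩
  | call f arg ih =>
    intro env Q h
    obtain ⟨_, _, _, h1, h⟩ := ih h
    obtain ⟨body, w, t, s, hb, h2, h⟩ := h
    exact ⟨_, _, _, .call h1 hb h2, h⟩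

theorem Spec.intro {O : Box → ℝ} {P : Program} {f : ℕ} {v : Val} {Q : Val → ℕ → Prop}
    {body : Expr} (hf : P[f]? = some body) (h : wp O P body [v] Q) : Spec O P f v Q := by
  obtain ⟨w, t, s, h1, h2⟩ := wp_sound body h
  exact ⟨body, w, t, s, hf, h1, h2⟩

/-- The two additional steps are the outer call and the evaluation of its argument variable. -/
theorem Spec.runs {O : Box → ℝ} {P : Program} {v : Val} {Q : Val → ℕ → Prop}
    (h : Spec O P 0 v Q) : ∃ w t s, Runs O P v w (t + 2) s ∧ s ≤ t + 2 ∧ Q w t := by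
  obtain ⟨b, w, t, s, h1, h2, h3⟩ := h
  have h4 : Eval O P [v] (.call 0 (.var 0)) w (1 + t + 1) (0 + s) := .call (.var rfl) h1 h2
  have h5 : 1 + t + 1 = t + 2 := by omega
  rw [h5] at h4
  exact ⟨w, t, _, h4, h4.space_le_time, h3⟩

/-! ## Tuples of arguments -/

/-- Component `i` of the tuple in variable `j`. -/
def Expr.proj (e : Expr) : ℕ → Expr
  | 0 => e
  | i + 1 => .snd (e.proj i)

def Expr.arg (j i : ℕ) : Expr := .fst ((Expr.var j).proj i)

def Expr.tuple : List Expr → Expr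
  | [] => .nil
  | e :: l => .pair e (Expr.tuple l)

def Val.tuple : List Val → Val
  | [] => .nil
  | e :: l => .pair e (Val.tuple l)

/-- The flag that tells the axis of depth `d`. -/
def flag (d : ℕ) : Val := if Even d then .nil else .pair .nil .nil

/-- In variable `0` a pair of a point or an entry and a flag: the coordinate along the axis. -/
def selBody : Expr :=
  .ifPair (.fst (.fst (.var 0)))
    (.ifPair (.snd (.var 0)) (.snd (.fst (.fst (.var 0)))) (.fst (.fst (.fst (.var 0)))))
    (.ifPair (.snd (.var 0)) (.snd (.fst (.var 0))) (.fst (.fst (.var 0))))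

/-- The coordinate of a point, or of the point of an entry, along the axis given by a flag. -/
def Expr.sel (fl e : Expr) : Expr := .letIn (.pair e fl) selBody

attribute [simp] wp lookup Val.asPair_pair Val.asNum_num Val.asCoord_coord Val.casePair_pair
  Val.casePair_nil Val.casePair_coord Expr.proj Expr.arg Expr.tuple Val.tuple
  Expr.sel ArithOp.apply

theorem flag_even {d : ℕ} (h : Even d) : flag d = .nil := if_pos h

theorem flag_odd {d : ℕ} (h : ¬ Even d) : flag d = .pair .nil .nil := if_neg h

-- Points and entries are told apart by their shape: the first field of a point is a coordinate,
-- that of an entry is a pair. The exact costs, 10 and 11, do not depend on the axis, so the two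
-- cases of the flag never have to be separated in later proofs.
@[simp] theorem wp_selBody_pt {O : Box → ℝ} {P : Program} (p : Pt) (d : ℕ) (env : List Val)
    (Q : Val → ℕ → Prop) :
    wp O P selBody (.pair (encodePt p) (flag d) :: env) Q = Q (.coord (coordAt d p)) 10 := by
  by_cases h : Even d
  · rw [flag_even h, coordAt, if_pos h]; dsimp [selBody, encodePt, encodeEntry]
  · rw [flag_odd h, coordAt, if_neg h]; dsimp [selBody, encodePt, encodeEntry]

@[simp] theorem wp_selBody_entry {O : Box → ℝ} {P : Program} (e : Entry) (d : ℕ) (env : List Val)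
    (Q : Val → ℕ → Prop) :
    wp O P selBody (.pair (encodeEntry e) (flag d) :: env) Q = Q (.coord (coordAt d e.1)) 11 := by
  by_cases h : Even d
  · rw [flag_even h, coordAt, if_pos h]; dsimp [selBody, encodePt, encodeEntry]
  · rw [flag_odd h, coordAt, if_neg h]; dsimp [selBody, encodePt, encodeEntry]

theorem coordAt_zero : coordAt 0 = Prod.fst := rfl

theorem coordAt_one : coordAt 1 = Prod.snd := by
  funext p; simp [coordAt]

/-! ## The construction program

A *handle* is a position in a sorted list: the remaining list, the number of its own items and
pointers into other lists. Every cell of the list carries the handle of the next position. -/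

namespace Expr

def items (h : Expr) : Expr := .fst h
def count (h : Expr) : Expr := .fst (.snd h)
def ptr (h : Expr) : Expr := .snd (.snd h)
def head (h : Expr) : Expr := .fst (.fst (.fst h))
def next (h : Expr) : Expr := .snd (.fst (.fst h))

/-- The handle whose list starts with `p` and continues with the list of `h`. -/
def consHandle (p h ptr : Expr) (inc : ℤ) : Expr :=
  .pair (.pair (.pair p h) (.fst h)) (.pair (.arith .add (.fst (.snd h)) (.num inc)) ptr)

def emptyHandle (ptr : Expr) : Expr := .pair .nil (.pair (.num 0) ptr)

def isOdd : Expr := .pair .nil .nil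

def maxCoord (a b : Expr) : Expr := .ifCoordLe a b b a

def minCoord (a b : Expr) : Expr := .ifCoordLe a b a b

end Expr

attribute [simp] Expr.items Expr.count Expr.ptr Expr.head Expr.next Expr.consHandle
  Expr.emptyHandle Expr.isOdd Expr.maxCoord Expr.minCoord

abbrev fHalve : ℕ := 1
abbrev fMerge : ℕ := 2
abbrev fSort : ℕ := 3
abbrev fStrip : ℕ := 4
abbrev fLen : ℕ := 5
abbrev fItems : ℕ := 6
abbrev fTrie : ℕ := 7
abbrev fIndex : ℕ := 8
abbrev fCascade : ℕ := 9
abbrev fFindStrip : ℕ := 10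
abbrev fFilterLe : ℕ := 11
abbrev fFilterGt : ℕ := 12
abbrev fNode : ℕ := 13
abbrev fPrimary : ℕ := 14
abbrev fMass : ℕ := 15
abbrev fFourth : ℕ := 16
abbrev fSlab : ℕ := 17
abbrev fSides : ℕ := 18
abbrev fFlip : ℕ := 19
abbrev fPick : ℕ := 20

open BRT.Expr

/-- Splits a list in the middle; a second copy of the list marks the middle. -/
def halveBody : Expr :=
  .ifPair (.arg 0 1)
    (.ifPair (.snd (.arg 0 1))
      (.letIn (.call fHalve (.tuple [.snd (.arg 0 0), .snd (.snd (.arg 0 1))]))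
        (.pair (.pair (.fst (.arg 1 0)) (.fst (.var 0))) (.snd (.var 0))))
      (.pair .nil (.arg 0 0)))
    (.pair .nil (.arg 0 0))

/-- Merges two handles; arguments: flag, left handle, right handle. -/
def mergeBody : Expr :=
  let left : Expr := .letIn (.call fMerge (.tuple [.arg 0 0, next (.arg 0 1), .arg 0 2]))
    (consHandle (head (.arg 1 1)) (.var 0) (.pair (.arg 1 1) (.arg 1 2)) 1)
  let right : Expr := .letIn (.call fMerge (.tuple [.arg 0 0, .arg 0 1, next (.arg 0 2)]))
    (consHandle (head (.arg 1 2)) (.var 0) (.pair (.arg 1 1) (.arg 1 2)) 1)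
  .ifPair (items (.arg 0 1))
    (.ifPair (items (.arg 0 2))
      (.ifCoordLe (.sel (.arg 0 0) (head (.arg 0 1))) (.sel (.arg 0 0) (head (.arg 0 2)))
        left right)
      left)
    (.ifPair (items (.arg 0 2)) right (emptyHandle (.pair (.arg 0 1) (.arg 0 2))))

/-- Builds a range tree, splitting the list in the middle, together with the handle of its sorted
list; arguments: flag, list. -/
def sortBody : Expr :=
  .ifPair (.arg 0 1)
    (.ifPair (.snd (.arg 0 1))
      (.letIn (.call fHalve (.tuple [.arg 0 1, .arg 0 1]))
      (.letIn (.call fSort (.tuple [.arg 1 0, .fst (.var 0)]))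
      (.letIn (.call fSort (.tuple [.arg 2 0, .snd (.var 1)]))
      (.letIn (.call fMerge (.tuple [.arg 3 0, .snd (.var 1), .snd (.var 0)]))
        (.pair
          (.pair (.pair (.fst (.var 2)) (.fst (.var 1)))
            (.pair (.fst (.fst (.snd (.var 3)))) (.pair (.fst (.var 0)) .nil)))
          (.var 0))))))
      (.pair (.pair .nil (.pair (.fst (.arg 0 1)) .nil))
        (consHandle (.fst (.arg 0 1)) (emptyHandle .nil) .nil 1)))
    (.pair .nil (emptyHandle .nil))

/-- Drops the auxiliary fields of a list. -/
def stripBody : Expr :=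
  .ifPair (.var 0)
    (.pair (.fst (.fst (.var 0))) (.call fStrip (.snd (.var 0))))
    .nil

def lenBody : Expr :=
  .ifPair (.var 0) (.arith .add (.call fLen (.snd (.var 0))) (.num 1)) (.num 0)

/-- The probability of the part of a box between two coordinates; arguments: flag, box, lower and
upper bound. -/
def massBody : Expr :=
  .letIn (.arg 0 1)
    (.ifPair (.arg 1 0)
      (.prob (.fst (.fst (.var 0))) (.snd (.fst (.var 0)))
        (maxCoord (.arg 1 2) (.fst (.snd (.var 0)))) (minCoord (.arg 1 3) (.snd (.snd (.var 0)))))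
      (.prob (maxCoord (.arg 1 2) (.fst (.fst (.var 0))))
        (minCoord (.arg 1 3) (.snd (.fst (.var 0))))
        (.fst (.snd (.var 0))) (.snd (.snd (.var 0)))))

/-- The gaps between the distinct keys of a list as items `(position, left end, handle)`;
arguments: flag, box, probability of the box, extra weight of a gap, handle, left end of the
current gap, weight of the earlier gaps. -/
def itemsBody : Expr :=
  .ifPair (items (.arg 0 4))
    (.letIn (.sel (.arg 0 0) (head (.arg 0 4)))
      (.ifCoordLe (.var 0) (.arg 1 5)
        (.call fItems (.tuple [.arg 1 0, .arg 1 1, .arg 1 2, .arg 1 3, next (.arg 1 4), .arg 1 5,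
          .arg 1 6]))
        (.letIn (.arith .add (.arith .div
            (.call fMass (.tuple [.arg 1 0, .arg 1 1, .arg 1 5, .var 0])) (.arg 1 2)) (.arg 1 3))
        (.pair (.tuple [.arith .add (.arg 2 6) (.arith .div (.var 0) (.num 2)), .arg 2 5,
            .arg 2 4])
          (.call fItems (.tuple [.arg 2 0, .arg 2 1, .arg 2 2, .arg 2 3, next (.arg 2 4), .var 1,
            .arith .add (.arg 2 6) (.var 0)]))))))
    (.letIn (.arith .add (.arith .div
        (.call fMass (.tuple [.arg 0 0, .arg 0 1, .arg 0 5, .posInf])) (.arg 0 2)) (.arg 0 3))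
    (.pair (.tuple [.arith .add (.arg 1 6) (.arith .div (.var 0) (.num 2)), .arg 1 5, .arg 1 4])
      .nil))

/-- Builds a search tree on the items in a cell by bisection; arguments: start and length of the
cell, items. Returns the tree, or `nil` if the cell is empty, and the items after the cell. -/
def trieBody : Expr :=
  .ifPair (.arg 0 2)
    (.ifNumLe (.arith .add (.arg 0 0) (.arg 0 1)) (.fst (.fst (.arg 0 2)))
      (.pair .nil (.arg 0 2))
      (.letIn (.pair (.pair .nil (.fst (.snd (.snd (.fst (.arg 0 2)))))) (.snd (.arg 0 2)))
        (.ifPair (.snd (.arg 1 2))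
          (.ifNumLe (.arith .add (.arg 1 0) (.arg 1 1)) (.fst (.fst (.snd (.arg 1 2))))
            (.var 0)
            (.letIn (.arith .div (.arg 1 1) (.num 2))
            (.letIn (.call fTrie (.tuple [.arg 2 0, .var 0, .arg 2 2]))
            (.letIn (.call fTrie (.tuple [.arith .add (.arg 3 0) (.var 1), .var 1,
                .snd (.var 0)]))
              (.ifPair (.fst (.var 1))
                (.ifPair (.fst (.var 0))
                  (.pair (.pair (.pair (.fst (.snd (.fst (.snd (.var 1))))) .nil)
                    (.pair (.fst (.var 1)) (.fst (.var 0)))) (.snd (.var 0)))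
                  (.pair (.fst (.var 1)) (.snd (.var 0))))
                (.var 0))))))
          (.var 0))))
    (.pair .nil .nil)

/-- The index tree of a list; arguments: flag, box, handle. -/
def indexBody : Expr :=
  .fst (.call fTrie (.tuple [.num 0, .num 2, .call fItems (.tuple [.arg 0 0, .arg 0 1,
    .prob (.fst (.fst (.arg 0 1))) (.snd (.fst (.arg 0 1))) (.fst (.snd (.arg 0 1)))
      (.snd (.snd (.arg 0 1))),
    .arith .div (.num 1) (.arith .add (.call fLen (items (.arg 0 2))) (.num 1)),
    .arg 0 2, .negInf, .num 0])]))

/-- The fourth entry after a handle and the handle after that entry. -/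
def fourthBody : Expr :=
  .ifPair (items (.var 0))
    (.letIn (next (.var 0)) (.ifPair (items (.var 0))
      (.letIn (next (.var 0)) (.ifPair (items (.var 0))
        (.letIn (next (.var 0)) (.ifPair (items (.var 0))
          (.pair (head (.var 0)) (next (.var 0))) .nil)) .nil)) .nil)) .nil

/-- Merges a sorted list of points with the sample of a catalogue; arguments: flag, list, handle of
the catalogue. -/
def cascadeBody : Expr :=
  let own : Expr :=
    .letIn (.call fCascade (.tuple [.arg 1 0, .snd (.arg 1 1), .arg 1 2]))
      (consHandle (.pair (.fst (.arg 2 1)) (.num 1)) (.var 0) (.arg 2 2) 1)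
  let copied : Expr :=
    .letIn (.call fCascade (.tuple [.arg 1 0, .arg 1 1, .snd (.var 0)]))
      (consHandle (.pair (.fst (.fst (.var 1))) (.num 0)) (.var 0) (.arg 2 2) 0)
  .letIn (.call fFourth (.arg 0 2))
    (.ifPair (.arg 1 1)
      (.ifPair (.var 0)
        (.ifCoordLe (.sel (.arg 1 0) (.fst (.arg 1 1))) (.sel (.arg 1 0) (.fst (.var 0)))
          own copied)
        own)
      (.ifPair (.var 0) copied (emptyHandle (.arg 1 2))))

/-- Searches the strip of a node; arguments: flag, region, its probability, the last line passed,
the end of the region, the remaining points. -/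
def findStripBody : Expr :=
  .ifPair (.arg 0 5)
    (.letIn (.sel (.arg 0 0) (.fst (.arg 0 5)))
      (.ifCoordLe (.var 0) (.arg 1 3)
        (.call fFindStrip (.tuple [.arg 1 0, .arg 1 1, .arg 1 2, .arg 1 3, .arg 1 4,
          .snd (.arg 1 5)]))
        (.letIn (.call fMass (.tuple [.arg 1 0, .arg 1 1, .var 0, .arg 1 4]))
          (.ifNumLe (.arg 2 2) (.arith .add (.var 0) (.var 0))
            (.ifNumLe (.arg 2 2) (.num 0)
              (.pair (.arg 2 3) (.var 1))
              (.call fFindStrip (.tuple [.arg 2 0, .arg 2 1, .arg 2 2, .var 1, .arg 2 4,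
                .snd (.arg 2 5)])))
            (.pair (.arg 2 3) (.var 1))))))
    (.pair (.arg 0 3) (.arg 0 4))

/-- The points with coordinate at most a bound; arguments: flag, bound, list. -/
def filterLeBody : Expr :=
  .ifPair (.arg 0 2)
    (.letIn (.call fFilterLe (.tuple [.arg 0 0, .arg 0 1, .snd (.arg 0 2)]))
      (.ifCoordLe (.sel (.arg 1 0) (.fst (.arg 1 2))) (.arg 1 1)
        (.pair (.fst (.arg 1 2)) (.var 0)) (.var 0)))
    .nil

/-- The points with coordinate greater than a bound; arguments: flag, bound, list. -/
def filterGtBody : Expr :=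
  .ifPair (.arg 0 2)
    (.letIn (.call fFilterGt (.tuple [.arg 0 0, .arg 0 1, .snd (.arg 0 2)]))
      (.ifCoordLe (.sel (.arg 1 0) (.fst (.arg 1 2))) (.arg 1 1)
        (.var 0) (.pair (.fst (.arg 1 2)) (.var 0))))
    .nil

/-- The record of a node; arguments: region, strip, conditioning box or `nil`, handles of the
catalogues, auxiliary field. -/
def nodeBody : Expr :=
  .letIn (.ifPair (.arg 0 2) (.arg 0 2) (.arg 0 1))
  (.letIn (.call fIndex (.tuple [.nil, .var 0, .arg 1 3]))
  (.letIn (.call fIndex (.tuple [isOdd, .var 1, .arg 2 4]))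
    (.pair (.pair (.arg 3 0) (.arg 3 1))
      (.pair (.pair (.pair (items (.arg 3 3)) (.var 1)) (.pair (items (.arg 3 4)) (.var 0)))
        (.arg 3 5)))))

/-- Replaces the sides of a box along an axis; arguments: flag, box, sides. -/
def slabBody : Expr :=
  .ifPair (.arg 0 0) (.pair (.fst (.arg 0 1)) (.arg 0 2)) (.pair (.arg 0 2) (.snd (.arg 0 1)))

/-- The sides of a box along an axis; arguments: flag, box. -/
def sidesBody : Expr :=
  .ifPair (.arg 0 0) (.snd (.arg 0 1)) (.fst (.arg 0 1))

/-- The flag of the other axis. -/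
def flipBody : Expr :=
  .ifPair (.var 0) .nil isOdd

/-- A list at odd depth and the empty list at even depth; arguments: flag, list. -/
def pickBody : Expr :=
  .ifPair (.arg 0 0) (.arg 0 1) .nil

/-- The primary tree; arguments: flag, region, its points sorted along the axis of the flag and
along the other axis, `2 ^ depth`, number of all points, conditioning box or `nil`, handles of
the two catalogues. -/
def primaryBody : Expr :=
  let leaf : Expr := .letIn (.call fNode
    (.tuple [.arg 0 1, .arg 0 1, .arg 0 6, .arg 0 7, .arg 0 8, .arg 0 2])) (.pair .nil (.var 0))
  -- `j` counts the values bound so far and is thus the index of the argument tuple. Components 3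
  -- and 2 are passed in exchanged order, because the child is cut along the other axis.
  let child (j : ℕ) (fl side : Expr) (filter : ℕ) (bound : Expr) (w ownX ownY : Expr) : Expr :=
    .call fPrimary (.tuple [fl, .call fSlab (.tuple [.arg j 0, .arg j 1, side]),
      .call filter (.tuple [.arg j 0, bound, .arg j 3]),
      .call filter (.tuple [.arg j 0, bound, .arg j 2]),
      .arith .add (.arg j 4) (.arg j 4), .arg j 5, w,
      .call fCascade (.tuple [.nil, ownX, .arg j 7]),
      .call fCascade (.tuple [isOdd, ownY, .arg j 8])])
  .ifPair (.arg 0 2)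
    (.ifNumLe (.arg 0 5) (.arg 0 4) leaf
      (.letIn (.call fSides (.tuple [.arg 0 0, .arg 0 1]))
      (.letIn (.call fFlip (.arg 1 0))
      (.letIn (.call fFindStrip (.tuple [.arg 2 0, .arg 2 1,
        .prob (.fst (.fst (.arg 2 1))) (.snd (.fst (.arg 2 1))) (.fst (.snd (.arg 2 1)))
          (.snd (.snd (.arg 2 1))), .fst (.var 1), .snd (.var 1), .arg 2 2]))
      (.letIn (.call fSlab (.tuple [.arg 3 0, .arg 3 1, .var 0]))
      (.letIn (.call fNode (.tuple [.arg 4 1, .var 0, .arg 4 6, .arg 4 7, .arg 4 8, .nil]))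
      (.letIn (.call fFilterGt (.tuple [.arg 5 0, .fst (.var 2), .arg 5 3]))
      (.letIn (child 6 (.var 4) (.pair (.fst (.var 5)) (.fst (.var 3))) fFilterLe
        (.fst (.var 3)) (.var 2) (.call fPick (.tuple [.arg 6 0, .var 0]))
        (.call fPick (.tuple [.var 4, .var 0])))
      (.letIn (child 7 (.var 5) (.pair (.snd (.var 4)) (.snd (.var 6))) fFilterGt
        (.snd (.var 4)) .nil .nil .nil)
        (.pair (.pair (.var 1) (.var 0)) (.var 3)))))))))))
    leaf

/-- The main function of the construction. The first sort only serves to sort by `x`. -/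
def buildBody : Expr :=
  .letIn (.call fStrip (.fst (.snd (.call fSort (.tuple [.nil, .var 0])))))
  (.letIn (.call fSort (.tuple [isOdd, .var 0]))
  (.letIn (.call fIndex (.tuple [isOdd,
    .pair (.pair .negInf .posInf) (.pair .negInf .posInf), .snd (.var 0)]))
  (.letIn (.call fPrimary (.tuple [.nil, .pair (.pair .negInf .posInf) (.pair .negInf .posInf),
    .var 2, .call fStrip (.fst (.snd (.var 1))), .num 1, .call fLen (.var 2), .nil,
    emptyHandle .nil, emptyHandle .nil]))
    (.pair (.fst (.var 2)) (.pair (.var 0) (.var 1))))))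

def buildProgram : Program :=
  [buildBody, halveBody, mergeBody, sortBody, stripBody, lenBody, itemsBody, trieBody, indexBody,
    cascadeBody, findStripBody, filterLeBody, filterGtBody, nodeBody, primaryBody, massBody,
    fourthBody, slabBody, sidesBody, flipBody, pickBody]

/-! ## Handles -/

section Handles

variable {α : Type}

/-- `HandleTo enc X pre suf h`: `h` is the handle of the list `suf`, preceded by `pre`, whose
positions have annotations specified by `X`. -/
def HandleTo (enc : α → Val) (X : List α → List α → Val → Prop) : List α → List α → Val → Prop
  | pre, [], h => ∃ x, h = .pair .nil x ∧ X pre [] x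
  | pre, e :: suf, h => ∃ x v x', h = .pair (.pair (.pair (enc e) (.pair v x')) v) x ∧
      X pre (e :: suf) x ∧ HandleTo enc X (pre ++ [e]) suf (.pair v x')

/-- The handle of the successor occupies the auxiliary field of each cell, so forgetting annotations
leaves a plain linked list. This links the cascading structure to the required memory format. -/
theorem HandleTo.pair {enc : α → Val} {X : List α → List α → Val → Prop} {pre suf : List α}
    {h : Val} (hh : HandleTo enc X pre suf h) :
    ∃ v x, h = .pair v x ∧ X pre suf x ∧ RepList enc suf v := by
  induction suf generalizing pre h with
  | nil =>
    obtain ⟨x, rfl, hx⟩ := hh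
    exact ⟨_, _, rfl, hx, rfl⟩
  | cons e suf ih =>
    obtain ⟨x, v, x', rfl, hx, ht⟩ := hh
    obtain ⟨v₁, x₁, heq, -, hrep⟩ := ih ht
    cases heq
    exact ⟨_, _, rfl, hx, _, _, rfl, hrep⟩

end Handles

/-! ## Auxiliary list functions -/

/-- The marker list advances two cells while the list itself advances one. The two arguments are
separate because they stop being equal after the first recursive call. -/
theorem halve_spec {O : Box → ℝ} : ∀ (F L : List Pt), F.length ≤ L.length →
    Spec O buildProgram fHalve (.tuple [encodePts L, encodePts F]) fun w t =>
      w = .pair (encodePts (L.take (F.length / 2))) (encodePts (L.drop (F.length / 2))) ∧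
        t ≤ 40 * F.length + 40 := by
  intro F
  induction F using List.twoStepInduction with
  | nil =>
    intro L _
    apply Spec.intro (body := halveBody) rfl
    dsimp [halveBody, encodePts]
    simp
  | singleton p =>
    intro L _
    apply Spec.intro (body := halveBody) rfl
    dsimp [halveBody, encodePts]
    simp
  | cons_cons p q F ih _ =>
    intro L hL
    obtain _ | ⟨x, L⟩ := L
    · simp at hL
    apply Spec.intro (body := halveBody) rfl
    dsimp [halveBody, encodePts]
    refine (ih L (by simp at hL; omega)).mono ?_
    rintro w t ⟨rfl, ht⟩
    dsimp
    have : (F.length + 1 + 1) / 2 = F.length / 2 + 1 := by omega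
    rw [this]
    exact ⟨rfl, by omega⟩

theorem strip_spec {O : Box → ℝ} (L : List Pt) : ∀ (v : Val), RepList encodePt L v →
    Spec O buildProgram fStrip v fun w t => w = encodePts L ∧ t ≤ 20 * L.length + 20 := by
  induction L with
  | nil =>
    rintro v rfl
    apply Spec.intro (body := stripBody) rfl
    dsimp [stripBody, encodePts]
    simp
  | cons p L ih =>
    rintro v ⟨aux, tail, rfl, hrep⟩
    apply Spec.intro (body := stripBody) rfl
    dsimp [stripBody, encodePts]
    refine (ih tail hrep).mono ?_
    rintro w t ⟨rfl, ht⟩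
    exact ⟨rfl, by omega⟩

/-- `v` is a list of `n` cells. -/
def IsListVal : ℕ → Val → Prop
  | 0, v => v = .nil
  | n + 1, v => ∃ a v', v = .pair a v' ∧ IsListVal n v'

theorem isListVal_encodePts (L : List Pt) : IsListVal L.length (encodePts L) := by
  induction L with
  | nil => rfl
  | cons p L ih => exact ⟨_, _, rfl, ih⟩

theorem RepList.isListVal {α : Type} {enc : α → Val} {L : List α} {v : Val}
    (h : RepList enc L v) : IsListVal L.length v := by
  induction L generalizing v with
  | nil => exact h
  | cons p L ih =>
    obtain ⟨aux, tail, rfl, h⟩ := h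
    exact ⟨_, _, rfl, ih h⟩

theorem len_spec {O : Box → ℝ} (n : ℕ) : ∀ (v : Val), IsListVal n v →
    Spec O buildProgram fLen v fun w t => w = .num n ∧ t ≤ 20 * n + 20 := by
  induction n with
  | zero =>
    rintro v rfl
    apply Spec.intro (body := lenBody) rfl
    dsimp [lenBody]
    simp
  | succ n ih =>
    rintro v ⟨a, v', rfl, h⟩
    apply Spec.intro (body := lenBody) rfl
    dsimp [lenBody]
    refine (ih v' h).mono ?_
    rintro w t ⟨rfl, ht⟩
    dsimp
    refine ⟨by push_cast; rfl, by omega⟩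

theorem filterLe_spec {O : Box → ℝ} (d : ℕ) (a : EReal) (L : List Pt) :
    Spec O buildProgram fFilterLe (.tuple [flag d, .coord a, encodePts L]) fun w t =>
      w = encodePts (L.filter fun p => (coordAt d p : EReal) ≤ a) ∧
        t ≤ 60 * L.length + 20 := by
  induction L with
  | nil =>
    apply Spec.intro (body := filterLeBody) rfl
    dsimp [filterLeBody, encodePts]
    simp
  | cons p L ih =>
    apply Spec.intro (body := filterLeBody) rfl
    dsimp [filterLeBody, encodePts]
    refine ih.mono ?_
    rintro w t ⟨rfl, ht⟩
    rw [wp_selBody_pt]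
    dsimp
    split_ifs with h
    · rw [List.filter_cons_of_pos (by simpa using h)]
      exact ⟨rfl, by omega⟩
    · rw [List.filter_cons_of_neg (by simpa using h)]
      exact ⟨rfl, by omega⟩

theorem filterGt_spec {O : Box → ℝ} (d : ℕ) (a : EReal) (L : List Pt) :
    Spec O buildProgram fFilterGt (.tuple [flag d, .coord a, encodePts L]) fun w t =>
      w = encodePts (L.filter fun p => a < (coordAt d p : EReal)) ∧
        t ≤ 60 * L.length + 20 := by
  induction L with
  | nil =>
    apply Spec.intro (body := filterGtBody) rfl
    dsimp [filterGtBody, encodePts]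
    simp
  | cons p L ih =>
    apply Spec.intro (body := filterGtBody) rfl
    dsimp [filterGtBody, encodePts]
    refine ih.mono ?_
    rintro w t ⟨rfl, ht⟩
    rw [wp_selBody_pt]
    dsimp
    split_ifs with h
    · rw [List.filter_cons_of_neg (by simpa using h)]
      exact ⟨rfl, by omega⟩
    · rw [List.filter_cons_of_pos (by simpa using h)]
      exact ⟨rfl, by omega⟩

/-! ## The backup tree -/

/-- The pointer `h` from a position of a sorted list, with `pre` before and `suf` after it, leads
to the corresponding position of the sublist `full`. -/
def PointsTo (d : ℕ) (full : List Pt) (X : List Pt → List Pt → Val → Prop) (pre suf : List Pt)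
    (h : Val) : Prop :=
  ∃ pre' suf', pre' ++ suf' = full ∧
    (∀ x, (∀ p ∈ pre, coordAt d p < x) → ∀ p ∈ pre', coordAt d p < x) ∧ suf' ⊆ suf ∧ X pre' suf' h

/-- This is the downward cascading of the backup tree: a position of the merged list knows how many
points follow it and the corresponding positions in the two lists it was merged from. -/
def MergeNote (d : ℕ) (l : List Pt) (X : List Pt → List Pt → Val → Prop) (r : List Pt)
    (Y : List Pt → List Pt → Val → Prop) (pre suf : List Pt) (x : Val) : Prop :=
  ∃ hl hr, x = .pair (.num suf.length) (.pair hl hr) ∧ PointsTo d l X pre suf hl ∧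
    PointsTo d r Y pre suf hr

def mergeAt (d : ℕ) (l r : List Pt) : List Pt :=
  l.merge r fun p q => decide (coordAt d p ≤ coordAt d q)

/-- The invariant says that everything already consumed from either list is below any strict bound
on the merged prefix. Conversely, what is left in a list reappears in the merged suffix. These are
the two halves of `PointsTo`, so the pair of current handles can be stored as the pointers. -/
theorem merge_spec {O : Box → ℝ} (d : ℕ) (l r : List Pt) (X Y : List Pt → List Pt → Val → Prop) :
    ∀ (m : ℕ) (lpre lsuf rpre rsuf pre : List Pt) (hl hr : Val),
    lsuf.length + rsuf.length ≤ m → lpre ++ lsuf = l → rpre ++ rsuf = r →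
    (∀ x, (∀ p ∈ pre, coordAt d p < x) →
      (∀ p ∈ lpre, coordAt d p < x) ∧ (∀ p ∈ rpre, coordAt d p < x)) →
    HandleTo encodePt X lpre lsuf hl → HandleTo encodePt Y rpre rsuf hr →
    Spec O buildProgram fMerge (.tuple [flag d, hl, hr]) fun w t =>
      HandleTo encodePt (MergeNote d l (HandleTo encodePt X) r (HandleTo encodePt Y)) pre
        (mergeAt d lsuf rsuf) w ∧
      t ≤ 120 * (lsuf.length + rsuf.length) + 60 := by
  intro m
  induction m with
  | zero =>
    intro lpre lsuf rpre rsuf pre hl hr hm hlf hrf hpre hL hR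
    obtain rfl : lsuf = [] := List.length_eq_zero_iff.1 (by omega)
    obtain rfl : rsuf = [] := List.length_eq_zero_iff.1 (by omega)
    have hL' := hL
    have hR' := hR
    obtain ⟨xl, rfl, -⟩ := hL'
    obtain ⟨xr, rfl, -⟩ := hR'
    apply Spec.intro (body := mergeBody) rfl
    dsimp [mergeBody]
    rw [show mergeAt d [] [] = [] by simp [mergeAt]]
    refine ⟨⟨_, rfl, _, _, ?_, ⟨_, _, hlf, fun x hx => (hpre x hx).1, by simp, hL⟩,
      ⟨_, _, hrf, fun x hx => (hpre x hx).2, by simp, hR⟩⟩, by omega⟩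
    simp
  | succ m ih =>
    intro lpre lsuf rpre rsuf pre hl hr hm hlf hrf hpre hL hR
    have hL' := hL
    have hR' := hR
    have sub : ∀ suf : List Pt, suf = mergeAt d lsuf rsuf → lsuf ⊆ suf ∧ rsuf ⊆ suf := by
      rintro suf rfl
      have hp := List.merge_perm_append (xs := lsuf) (ys := rsuf)
        (le := fun p q => decide (coordAt d p ≤ coordAt d q))
      exact ⟨fun p hp' => hp.mem_iff.2 (List.mem_append_left _ hp'),
        fun p hp' => hp.mem_iff.2 (List.mem_append_right _ hp')⟩
    have takeLeft : ∀ (p : Pt) (ls : List Pt), lsuf = p :: ls →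
        mergeAt d lsuf rsuf = p :: mergeAt d ls rsuf →
        ∃ vl x' xl, hl = .pair (.pair (.pair (encodePt p) (.pair vl x')) vl) xl ∧
        Spec O buildProgram fMerge (.tuple [flag d, .pair vl x', hr]) fun w t =>
          (∃ v c q, w = .pair v (.pair (.num c) q) ∧
            HandleTo encodePt (MergeNote d l (HandleTo encodePt X) r (HandleTo encodePt Y)) pre
              (mergeAt d lsuf rsuf) (.pair (.pair (.pair (encodePt p) w) v)
                (.pair (.num (c + 1)) (.pair hl hr)))) ∧
          t ≤ 120 * (ls.length + rsuf.length) + 60 := by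
      rintro p ls rfl hmer
      obtain ⟨xl, vl, x', rfl, -, hl2⟩ := hL'
      refine ⟨vl, x', xl, rfl, (ih (lpre ++ [p]) ls rpre rsuf (pre ++ [p]) (.pair vl x') hr
        (by simp at hm; omega) (by simpa using hlf) hrf ?_ hl2 hR).mono ?_⟩
      · intro x hx
        have h1 := hpre x fun q hq => hx q (by simp [hq])
        refine ⟨fun q hq => ?_, h1.2⟩
        rcases List.mem_append.1 hq with hq | hq
        · exact h1.1 q hq
        · exact hx q (List.mem_append_right _ hq)
      · rintro w t ⟨hw, ht⟩
        refine ⟨?_, ht⟩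
        obtain ⟨v, y, rfl, ⟨hl', hr', rfl, -⟩, -⟩ := hw.pair
        refine ⟨v, _, _, rfl, ?_⟩
        obtain ⟨s1, s2⟩ := sub _ rfl
        rw [hmer] at s1 s2 ⊢
        refine ⟨_, v, _, rfl, ⟨_, _, ?_, ⟨_, _, hlf, fun x hx => (hpre x hx).1, s1, hL⟩,
          ⟨_, _, hrf, fun x hx => (hpre x hx).2, s2, hR⟩⟩, hw⟩
        simp
    have takeRight : ∀ (p : Pt) (rs : List Pt), rsuf = p :: rs →
        mergeAt d lsuf rsuf = p :: mergeAt d lsuf rs →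
        ∃ vr x' xr, hr = .pair (.pair (.pair (encodePt p) (.pair vr x')) vr) xr ∧
        Spec O buildProgram fMerge (.tuple [flag d, hl, .pair vr x']) fun w t =>
          (∃ v c q, w = .pair v (.pair (.num c) q) ∧
            HandleTo encodePt (MergeNote d l (HandleTo encodePt X) r (HandleTo encodePt Y)) pre
              (mergeAt d lsuf rsuf) (.pair (.pair (.pair (encodePt p) w) v)
                (.pair (.num (c + 1)) (.pair hl hr)))) ∧
          t ≤ 120 * (lsuf.length + rs.length) + 60 := by
      rintro p rs rfl hmer
      obtain ⟨xr, vr, x', rfl, -, hr2⟩ := hR'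
      refine ⟨vr, x', xr, rfl, (ih lpre lsuf (rpre ++ [p]) rs (pre ++ [p]) hl (.pair vr x')
        (by simp at hm; omega) hlf (by simpa using hrf) ?_ hL hr2).mono ?_⟩
      · intro x hx
        have h1 := hpre x fun q hq => hx q (by simp [hq])
        refine ⟨h1.1, fun q hq => ?_⟩
        rcases List.mem_append.1 hq with hq | hq
        · exact h1.2 q hq
        · exact hx q (List.mem_append_right _ hq)
      · rintro w t ⟨hw, ht⟩
        refine ⟨?_, ht⟩
        obtain ⟨v, y, rfl, ⟨hl', hr', rfl, -⟩, -⟩ := hw.pair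
        refine ⟨v, _, _, rfl, ?_⟩
        obtain ⟨s1, s2⟩ := sub _ rfl
        rw [hmer] at s1 s2 ⊢
        refine ⟨_, v, _, rfl, ⟨_, _, ?_, ⟨_, _, hlf, fun x hx => (hpre x hx).1, s1, hL⟩,
          ⟨_, _, hrf, fun x hx => (hpre x hx).2, s2, hR⟩⟩, hw⟩
        simp
    rcases lsuf with _ | ⟨p, ls⟩
    · rcases rsuf with _ | ⟨q, rs⟩
      · exact (ih lpre [] rpre [] pre hl hr (by simp) hlf hrf hpre hL hR).mono fun _ _ h => h
      · obtain ⟨vr, x', xr, rfl, hs⟩ := takeRight q rs rfl (by simp [mergeAt])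
        obtain ⟨xl, rfl, -⟩ := hL'
        apply Spec.intro (body := mergeBody) rfl
        dsimp [mergeBody]
        refine hs.mono ?_
        rintro w t ⟨⟨v, c, q', rfl, hw⟩, ht⟩
        dsimp
        refine ⟨by simpa using hw, ?_⟩
        simp at ht
        omega
    · rcases rsuf with _ | ⟨q, rs⟩
      · obtain ⟨vl, x', xl, rfl, hs⟩ := takeLeft p ls rfl (by simp [mergeAt])
        obtain ⟨xr, rfl, -⟩ := hR'
        apply Spec.intro (body := mergeBody) rfl
        dsimp [mergeBody]
        refine hs.mono ?_
        rintro w t ⟨⟨v, c, q', rfl, hw⟩, ht⟩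
        dsimp
        refine ⟨by simpa using hw, ?_⟩
        simp at ht
        omega
      · by_cases hpq : coordAt d p ≤ coordAt d q
        · obtain ⟨vl, x', xl, rfl, hs⟩ := takeLeft p ls rfl (by simp [mergeAt, List.cons_merge_cons_pos, hpq])
          obtain ⟨xr, vr, x'', rfl, -⟩ := hR'
          apply Spec.intro (body := mergeBody) rfl
          dsimp [mergeBody]
          rw [wp_selBody_pt]
          dsimp
          rw [wp_selBody_pt]
          dsimp
          rw [if_pos (by exact_mod_cast hpq)]
          refine hs.mono ?_
          rintro w t ⟨⟨v, c, q', rfl, hw⟩, ht⟩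
          dsimp
          refine ⟨by simpa using hw, ?_⟩
          simp at ht
          omega
        · obtain ⟨vr, x', xr, rfl, hs⟩ := takeRight q rs rfl (by simp [mergeAt, List.cons_merge_cons_neg, hpq])
          obtain ⟨xl, vl, x'', rfl, -⟩ := hL'
          apply Spec.intro (body := mergeBody) rfl
          dsimp [mergeBody]
          rw [wp_selBody_pt]
          dsimp
          rw [wp_selBody_pt]
          dsimp
          rw [if_neg (by exact_mod_cast hpq)]
          refine hs.mono ?_
          rintro w t ⟨⟨v, c, q', rfl, hw⟩, ht⟩
          dsimp
          refine ⟨by simpa using hw, ?_⟩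
          simp at ht
          omega

/-- The list of the points of a range tree that is stored at its root. -/
def RangeTree.list : RangeTree → List Pt
  | .empty => []
  | .leaf p => [p]
  | .node _ ys _ _ => ys

/-- The annotations of the list of a range tree: counts and the pointers of fractional
cascading. -/
def RangeTree.Note (d : ℕ) : RangeTree → List Pt → List Pt → Val → Prop
  | .empty => fun _ suf x => ∃ z, x = .pair (.num suf.length) z
  | .leaf _ => fun _ suf x => ∃ z, x = .pair (.num suf.length) z
  | .node _ _ l r => MergeNote d l.list (HandleTo encodePt (l.Note d)) r.list
      (HandleTo encodePt (r.Note d))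

/-- The output `w` of the construction of a range tree with points `L`. -/
def IsSorted (d : ℕ) (L : List Pt) (w : Val) : Prop :=
  ∃ (T : RangeTree) (vT h : Val), w = .pair vT h ∧ T.points = L ∧ T.Rep vT ∧
    HandleTo encodePt (T.Note d) [] T.list h ∧ T.list.Perm L ∧
    T.list.Pairwise (fun p q => coordAt d p ≤ coordAt d q) ∧
    (d = 1 → L.Pairwise (fun p q => p.1 ≤ q.1) → T.WellFormed)

theorem mergeAt_perm (d : ℕ) (l r : List Pt) : (mergeAt d l r).Perm (l ++ r) :=
  List.merge_perm_append _

theorem mergeAt_pairwise {d : ℕ} {l r : List Pt}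
    (hl : l.Pairwise fun p q => coordAt d p ≤ coordAt d q)
    (hr : r.Pairwise fun p q => coordAt d p ≤ coordAt d q) :
    (mergeAt d l r).Pairwise fun p q => coordAt d p ≤ coordAt d q := by
  have h := List.pairwise_merge (le := fun p q : Pt => decide (coordAt d p ≤ coordAt d q))
    (by intro a b c h1 h2; simp only [decide_eq_true_eq] at *; exact h1.trans h2)
    (by intro a b; simpa using le_total _ _)
    l r (by simpa using hl) (by simpa using hr)
  simpa [mergeAt] using h

/-- The tree records the recursion of merge sort on halves of the input. Hence sorting by `y` a list
that is already ordered by `x` yields the backup tree, with its associated `y`-lists and their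
cascading pointers. -/
theorem sort_spec {O : Box → ℝ} (d : ℕ) : ∀ (j : ℕ) (L : List Pt), L.length ≤ 2 ^ j →
    Spec O buildProgram fSort (.tuple [flag d, encodePts L]) fun w t =>
      IsSorted d L w ∧ t ≤ 400 * (L.length * (j + 1)) + 60 := by
  have small : ∀ (j : ℕ) (L : List Pt), L.length ≤ 1 →
      Spec O buildProgram fSort (.tuple [flag d, encodePts L]) fun w t =>
      IsSorted d L w ∧ t ≤ 400 * (L.length * (j + 1)) + 60 := by
    intro j L hL
    rcases L with _ | ⟨p, _ | ⟨q, L⟩⟩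
    · apply Spec.intro (body := sortBody) rfl
      dsimp [sortBody, encodePts]
      refine ⟨⟨.empty, _, _, rfl, rfl, rfl, ⟨_, rfl, .nil, ?_⟩, .nil, .nil,
        fun _ _ => trivial⟩, by omega⟩
      simp
    · apply Spec.intro (body := sortBody) rfl
      dsimp [sortBody, encodePts]
      refine ⟨⟨.leaf p, _, _, rfl, rfl, ⟨_, rfl⟩, ⟨_, _, _, rfl, ⟨.nil, ?_⟩, ⟨_, rfl, ⟨.nil, ?_⟩⟩⟩,
        .refl _, List.pairwise_singleton _ _, fun _ _ => trivial⟩, by omega⟩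
      · simp
      · simp
    · simp at hL
  intro j
  induction j with
  | zero => exact fun L hL => small 0 L (by simpa using hL)
  | succ j ih =>
    intro L hL
    by_cases hL1 : L.length ≤ 1
    · exact small _ L hL1
    obtain ⟨p, q, L', rfl⟩ : ∃ p q L', L = p :: q :: L' := by
      rcases L with _ | ⟨p, _ | ⟨q, L⟩⟩
      · simp at hL1
      · simp at hL1
      · exact ⟨_, _, _, rfl⟩
    apply Spec.intro (body := sortBody) rfl
    dsimp [sortBody, encodePts]
    change Spec O buildProgram fHalve (.tuple [encodePts (p :: q :: L'), encodePts (p :: q :: L')]) _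
    refine (halve_spec (p :: q :: L') (p :: q :: L') le_rfl).mono ?_
    generalize hLL : p :: q :: L' = L at *
    have hn : 2 ≤ L.length := by rw [← hLL]; simp
    rintro w t₀ ⟨rfl, ht₀⟩
    dsimp
    have hsum : (L.take (L.length / 2)).length + (L.drop (L.length / 2)).length = L.length := by
      rw [← List.length_append, List.take_append_drop]
    have h1 : (L.take (L.length / 2)).length = L.length / 2 := by
      rw [List.length_take]; omega
    have happ : L.take (L.length / 2) ++ L.drop (L.length / 2) = L := List.take_append_drop _ _
    generalize L.take (L.length / 2) = L₁ at *
    generalize L.drop (L.length / 2) = L₂ at *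
    have hpow : 2 ^ (j + 1) = 2 * 2 ^ j := by ring
    refine (ih L₁ (by omega)).mono ?_
    rintro w t₁ ⟨⟨T₁, vT₁, h₁, rfl, hp₁, hrep₁, hh₁, hperm₁, hs₁, hw₁⟩, ht₁⟩
    dsimp
    refine (ih L₂ (by omega)).mono ?_
    rintro w t₂ ⟨⟨T₂, vT₂, h₂, rfl, hp₂, hrep₂, hh₂, hperm₂, hs₂, hw₂⟩, ht₂⟩
    dsimp
    refine (merge_spec d T₁.list T₂.list (T₁.Note d) (T₂.Note d) _ [] T₁.list [] T₂.list [] h₁ h₂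
      le_rfl rfl rfl (by simp) hh₁ hh₂).mono ?_
    rintro w t₃ ⟨hw, ht₃⟩
    obtain ⟨v, x, rfl, -, hrep⟩ := hw.pair
    -- The abscissa of the first point of the second half is the splitting key.
    obtain ⟨z, L₂', rfl⟩ : ∃ z L₂', L₂ = z :: L₂' := by
      rcases L₂ with _ | ⟨z, L₂'⟩
      · simp at hsum; omega
      · exact ⟨_, _, rfl⟩
    dsimp [encodePts, encodePt]
    refine ⟨⟨.node z.1 (mergeAt d T₁.list T₂.list) T₁ T₂, _, _, rfl, ?_,
      ⟨_, _, _, _, rfl, hrep, hrep₁, hrep₂⟩, hw, ?_, mergeAt_pairwise hs₁ hs₂, ?_⟩, ?_⟩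
    · rw [RangeTree.points, hp₁, hp₂, happ]
    · rw [← happ]
      exact (mergeAt_perm _ _ _).trans (hperm₁.append hperm₂)
    · rintro rfl hx
      rw [← happ, List.pairwise_append] at hx
      obtain ⟨hx1, hx2, hx3⟩ := hx
      refine ⟨?_, by rw [hp₂]; simp, ?_, ?_, ?_, ?_, ?_, ?_, hw₁ rfl hx1, hw₂ rfl hx2⟩
      · rw [hp₁]; rintro rfl; simp at h1; omega
      · rw [hp₁, hp₂]; omega
      · rw [hp₁, hp₂]; omega
      · rw [hp₁]; exact fun a ha => hx3 a ha z (by simp)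
      · rw [hp₂]
        intro a ha
        rcases List.mem_cons.1 ha with rfl | ha
        · exact le_rfl
        · exact List.rel_of_pairwise_cons hx2 ha
      · rw [hp₁, hp₂]
        exact (mergeAt_perm _ _ _).trans (hperm₁.append hperm₂)
      · have := mergeAt_pairwise hs₁ hs₂
        rwa [coordAt_one] at this
    · have hl₁ := hperm₁.length_eq
      have hl₂ := hperm₂.length_eq
      have hc : L'.length + 1 + 1 = L.length := by rw [← hLL]; simp
      rw [hc]
      have e : 400 * (L.length * (j + 1 + 1)) = 400 * (L₁.length * (j + 1)) +
          400 * ((z :: L₂').length * (j + 1)) + 400 * L.length := by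
        rw [← hsum]; ring
      omega

/-! ## Index trees -/

/-- The part of the box `w` between the coordinates `a` and `b` along the axis of depth `d`. -/
def massBox (d : ℕ) (w : Box) (a b : EReal) : Box :=
  if Even d then ⟨max a w.x0, min b w.x1, w.y0, w.y1⟩ else ⟨w.x0, w.x1, max a w.y0, min b w.y1⟩

theorem mass_spec {O : Box → ℝ} (d : ℕ) (w : Box) (a b : EReal) :
    Spec O buildProgram fMass (.tuple [flag d, encodeBox w, .coord a, .coord b]) fun v t =>
      v = .num (O (massBox d w a b)) ∧ t ≤ 80 := by
  apply Spec.intro (body := massBody) rfl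
  by_cases h : Even d
  · rw [flag_even h, massBox, if_pos h]
    dsimp [massBody, encodeBox]
    split_ifs with h1 h2 h2 <;> simp [*, le_of_lt, not_le.1] <;> simp_all [le_of_lt]
  · rw [flag_odd h, massBox, if_neg h]
    dsimp [massBody, encodeBox]
    split_ifs with h1 h2 h2 <;> simp [*, le_of_lt, not_le.1] <;> simp_all [le_of_lt]

/-- A gap `(a, b]` between consecutive keys with weight `q`, position `s` and handle `h`. -/
structure Gap where
  s : ℝ
  q : ℝ
  a : EReal
  b : EReal
  h : Val

def encodeGaps : List Gap → Val
  | [] => .nil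
  | i :: I => .pair (.tuple [.num i.s, .coord i.a, i.h]) (encodeGaps I)

/-- The gaps of `I` partition `(a, ⊤]`; their weights are given by `g`, their positions are the
midpoints of consecutive intervals of these lengths that start at `acc`, and `H` relates the
handles to the gaps. -/
def GapChain (g : EReal → EReal → ℝ) (H : EReal → EReal → Val → Prop) :
    EReal → ℝ → List Gap → Prop
  | a, _, [] => a = ⊤
  | a, acc, i :: I => i.a = a ∧ i.q = g a i.b ∧ i.s = acc + i.q / 2 ∧ a < i.b ∧ H a i.b i.h ∧
      (I ≠ [] → ∃ k : ℝ, i.b = k) ∧ GapChain g H i.b (acc + i.q) I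

/-- The handle `h` is the position of the gap `(a, b]` in the list `L`. -/
def GapHandle {α : Type} (enc : α → Val) (X : List α → List α → Val → Prop) (key : α → ℝ)
    (L : List α) (a b : EReal) (h : Val) : Prop :=
  ∃ pre suf, pre ++ suf = L ∧ (∀ e ∈ pre, (key e : EReal) ≤ a) ∧ (∀ e ∈ suf, b ≤ (key e : EReal)) ∧
    HandleTo enc X pre suf h

/-- A gap is emitted only when a key exceeds the current left end, so repeated keys create no gap.
The stored handle is the one at that first larger key: all entries before it are at most the left
end, all entries from it on are at least the right end. The last gap is closed at `⊤`, so the result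
is never empty. -/
theorem items_spec {O : Box → ℝ} {α : Type} {enc : α → Val} {X : List α → List α → Val → Prop}
    {key : α → ℝ} {d n : ℕ} (hn : n ≤ 11)
    (hsel : ∀ e env Q, wp O buildProgram selBody (.pair (enc e) (flag d) :: env) Q =
      Q (.coord (key e)) n)
    (w : Box) (W δ : ℝ) {L : List α} (hL : L.Pairwise fun e e' => key e ≤ key e') :
    ∀ (suf pre : List α) (h : Val) (a : EReal) (acc : ℝ), pre ++ suf = L →
      (∀ e ∈ pre, (key e : EReal) ≤ a) → (∀ e ∈ suf, a ≤ key e) → a ≠ ⊤ →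
      HandleTo enc X pre suf h →
      Spec O buildProgram fItems (.tuple [flag d, encodeBox w, .num W, .num δ, h, .coord a, .num acc])
        fun v t => ∃ I : List Gap, v = encodeGaps I ∧
          GapChain (fun a b => O (massBox d w a b) / W + δ) (GapHandle enc X key L) a acc I ∧
          (∀ x : ℝ, (∃ i ∈ I, i.b = x) ↔ ∃ e ∈ suf, key e = x ∧ a < x) ∧
          I ≠ [] ∧ I.length ≤ suf.length + 1 ∧ t ≤ 400 * suf.length + 400 := by
  intro suf
  induction suf with
  | nil =>
    intro pre h a acc hpre ha _ hat hh
    have hh' := hh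
    obtain ⟨x, rfl, -⟩ := hh'
    apply Spec.intro (body := itemsBody) rfl
    dsimp [itemsBody]
    refine (mass_spec d w a ⊤).mono ?_
    rintro v t ⟨rfl, ht⟩
    dsimp
    refine ⟨[⟨acc + (O (massBox d w a ⊤) / W + δ) / 2, O (massBox d w a ⊤) / W + δ, a, ⊤, _⟩],
      by simp [encodeGaps], ⟨rfl, rfl, rfl, lt_top_iff_ne_top.2 hat, ⟨_, _, hpre, ha, by simp, hh⟩,
        by simp, rfl⟩, by simp, by simp, by simp, by omega⟩
  | cons e suf ih =>
    intro pre h a acc hpre ha hs hat hh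
    have hh' := hh
    obtain ⟨x, v, x', rfl, -, hnext⟩ := hh'
    have hpre' : (pre ++ [e]) ++ suf = L := by simpa using hpre
    have hsorted : ∀ e' ∈ suf, key e ≤ key e' := by
      rw [← hpre, List.pairwise_append] at hL
      exact fun e' he' => List.rel_of_pairwise_cons hL.2.1 he'
    apply Spec.intro (body := itemsBody) rfl
    dsimp [itemsBody]
    rw [hsel]
    dsimp
    split_ifs with hk
    · have hka : (key e : EReal) = a := le_antisymm hk (hs e (by simp))
      refine (ih (pre ++ [e]) _ a acc hpre' ?_ (fun e' he' => hs e' (by simp [he'])) hat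
        hnext).mono ?_
      · intro e' he'
        rcases List.mem_append.1 he' with he' | he'
        · exact ha e' he'
        · rw [List.mem_singleton.1 he']; exact hk
      · rintro u t ⟨I, rfl, h1, h2, h3, h4, ht⟩
        refine ⟨I, rfl, h1, fun x => (h2 x).trans ?_, h3, by omega, by omega⟩
        constructor
        · rintro ⟨e', he', h5, h6⟩
          exact ⟨e', by simp [he'], h5, h6⟩
        · rintro ⟨e', he', h5, h6⟩
          rcases List.mem_cons.1 he' with rfl | he'
          · rw [← h5, hka] at h6; exact absurd h6 (lt_irrefl _)
          · exact ⟨e', he', h5, h6⟩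
    · refine (mass_spec d w a (key e)).mono ?_
      rintro v t₁ ⟨rfl, ht₁⟩
      dsimp
      refine (ih (pre ++ [e]) _ (key e) _ hpre' ?_ (fun e' he' => by exact_mod_cast hsorted e' he')
        (EReal.coe_ne_top _) hnext).mono ?_
      · intro e' he'
        rcases List.mem_append.1 he' with he' | he'
        · exact (ha e' he').trans (not_le.1 hk).le
        · rw [List.mem_singleton.1 he']
      · rintro u t ⟨I, rfl, h1, h2, h3, h4, ht⟩
        refine ⟨⟨acc + (O (massBox d w a (key e)) / W + δ) / 2, O (massBox d w a (key e)) / W + δ,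
          a, key e, _⟩ :: I, by simp [encodeGaps], ⟨rfl, rfl, rfl, not_le.1 hk,
            ⟨_, _, hpre, ha, ?_, hh⟩, fun _ => ⟨_, rfl⟩, h1⟩, ?_, by simp, by simp; omega, by omega⟩
        · intro e' he'
          rcases List.mem_cons.1 he' with rfl | he'
          · exact le_rfl
          · exact EReal.coe_le_coe_iff.2 (hsorted e' he')
        · intro x
          have := h2 x
          constructor
          · rintro ⟨i, hi, hx⟩
            rcases List.mem_cons.1 hi with rfl | hi
            · exact ⟨e, by simp, EReal.coe_eq_coe_iff.1 hx, by rw [← hx]; exact not_le.1 hk⟩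
            · obtain ⟨e', he', h5, h6⟩ := this.1 ⟨i, hi, hx⟩
              exact ⟨e', by simp [he'], h5, (not_le.1 hk).trans h6⟩
          · rintro ⟨e', he', h5, h6⟩
            rcases List.mem_cons.1 he' with rfl | he'
            · exact ⟨_, List.mem_cons_self, by simp [h5]⟩
            · rcases (hsorted e' he').eq_or_lt with h7 | h7
              · exact ⟨_, List.mem_cons_self, by simp [h7, h5]⟩
              · obtain ⟨i, hi, hx⟩ := this.2 ⟨e', he', h5, by rw [← h5]; exact_mod_cast h7⟩
                exact ⟨i, by simp [hi], hx⟩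

/-! ### Search trees by bisection of the weight interval -/

/-- The depths of the leaves from left to right. -/
def STree.depths : STree → List ℕ
  | .leaf => [0]
  | .node _ l r => (l.depths ++ r.depths).map (· + 1)

/-- `v` represents the search tree `t` whose leaves are the gaps `I`. -/
def STree.Indexes : STree → List Gap → Val → Prop
  | .leaf, I, v => ∃ i, I = [i] ∧ v = .pair .nil i.h
  | .node k l r, I, v => ∃ I₁ I₂ i vl vr, I = I₁ ++ i :: I₂ ∧ i.a = (k : EReal) ∧
      v = .pair (.pair (.coord k) .nil) (.pair vl vr) ∧ l.Indexes I₁ vl ∧ r.Indexes (i :: I₂) vr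

/-- The leaves of `t` have the depths of a search tree obtained by bisection of a cell of
length `c`. -/
def STree.DepthsLe (t : STree) (I : List Gap) (c : ℝ) : Prop :=
  List.Forall₂ (fun (i : Gap) n => n = 0 ∨ i.q * 2 ^ n ≤ 4 * c) I t.depths

/-- The result of the bisection of the cell `[lo, lo + c)`. -/
def TrieResult (lo c : ℝ) (I : List Gap) (w : Val) : Prop :=
  ∃ I₁ I₂ v, I = I₁ ++ I₂ ∧ (∀ i ∈ I₁, i.s < lo + c) ∧ (∀ i ∈ I₂, lo + c ≤ i.s) ∧
    w = .pair v (encodeGaps I₂) ∧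
    ((I₁ = [] ∧ v = .nil) ∨ ∃ t : STree, t.Indexes I₁ v ∧ t.DepthsLe I₁ c)

/-- The conditions on the gaps that are processed by bisection. -/
def Spaced (δ : ℝ) (I : List Gap) : Prop :=
  I.Pairwise (fun i j => i.s + (i.q + j.q) / 2 ≤ j.s ∧ ∃ k : ℝ, j.a = (k : EReal)) ∧ ∀ i ∈ I, δ ≤ i.q

theorem STree.Indexes.pair {t : STree} {I : List Gap} {v : Val} (h : t.Indexes I v) :
    I ≠ [] ∧ ∃ a b, v = .pair a b := by
  cases t with
  | leaf => obtain ⟨i, rfl, rfl⟩ := h; exact ⟨by simp, _, _, rfl⟩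
  | node k l r =>
    obtain ⟨I₁, I₂, i, vl, vr, rfl, -, rfl, -⟩ := h
    exact ⟨by simp, _, _, rfl⟩

/-- An empty cell yields nothing and a cell with one midpoint yields a leaf. Otherwise both halves
are processed, and an internal node is created only if both contain a midpoint. If one half is empty
the other tree is passed on unchanged, so no depth is wasted and no comparison is redundant. The
returned rest of the list lets the second half start where the first stopped. -/
theorem trie_step {O : Box → ℝ} {δ : ℝ} (hδ : 0 < δ) {lo c : ℝ} {I : List Gap} {m : ℕ}
    (hI : Spaced δ I) (hlo : ∀ i ∈ I, lo ≤ i.s)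
    (rec : δ < c → ∀ lo' I', Spaced δ I' → (∀ i ∈ I', lo' ≤ i.s) →
      Spec O buildProgram fTrie (.tuple [.num lo', .num (c / 2), encodeGaps I']) fun w t =>
        TrieResult lo' (c / 2) I' w ∧ t ≤ m) :
    Spec O buildProgram fTrie (.tuple [.num lo, .num c, encodeGaps I]) fun w t =>
      TrieResult lo c I w ∧ t ≤ 2 * m + 200 := by
  apply Spec.intro (body := trieBody) rfl
  rcases I with _ | ⟨i, I⟩
  · dsimp [trieBody, encodeGaps]
    exact ⟨⟨[], [], .nil, rfl, by simp, by simp, rfl, .inl ⟨rfl, rfl⟩⟩, by omega⟩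
  have hord : ∀ j ∈ I, i.s ≤ j.s := by
    intro j hj
    have h1 := (List.rel_of_pairwise_cons hI.1 hj).1
    have h2 := hI.2 i (by simp)
    have h3 := hI.2 j (by simp [hj])
    linarith
  dsimp [trieBody, encodeGaps]
  split_ifs with hi
  · refine ⟨⟨[], i :: I, .nil, rfl, by simp, ?_, rfl, .inl ⟨rfl, rfl⟩⟩, by omega⟩
    intro j hj
    rcases List.mem_cons.1 hj with rfl | hj
    · exact hi
    · exact hi.trans (hord j hj)
  push Not at hi
  have single : (∀ j ∈ I, lo + c ≤ j.s) →
      TrieResult lo c (i :: I) (.pair (.pair .nil i.h) (encodeGaps I)) := fun h =>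
    ⟨[i], I, _, rfl, by simpa using hi, h, rfl, .inr ⟨.leaf, ⟨i, rfl, rfl⟩,
      .cons (.inl rfl) .nil⟩⟩
  rcases I with _ | ⟨j, I⟩
  · dsimp [encodeGaps]
    exact ⟨single (by simp), by omega⟩
  dsimp [encodeGaps]
  split_ifs with hj
  · refine ⟨single ?_, by omega⟩
    intro j' hj'
    rcases List.mem_cons.1 hj' with rfl | hj'
    · exact hj
    · have h1 := (List.rel_of_pairwise_cons (List.pairwise_cons.1 hI.1).2 hj').1
      have h2 := hI.2 j (by simp)
      have h3 := hI.2 j' (by simp [hj'])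
      linarith
  push Not at hj
  -- Two midpoints in the cell are at least `δ` apart. Consequently the recursion stops once cells
  -- are no longer than `δ`.
  have hc : δ < c := by
    have h1 := (List.rel_of_pairwise_cons hI.1 (List.mem_cons_self (a := j) (l := I))).1
    have h2 := hI.2 i (by simp)
    have h3 := hI.2 j (by simp)
    have h4 := hlo i (by simp)
    linarith
  have rec' := rec hc
  have he : Val.pair (.pair (.num i.s) (.pair (.coord i.a) (.pair i.h .nil)))
      (.pair (.pair (.num j.s) (.pair (.coord j.a) (.pair j.h .nil))) (encodeGaps I)) =
      encodeGaps (i :: j :: I) := rfl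
  rw [he]
  -- every gap of the cell is light compared with the cell
  have light : ∀ x ∈ i :: j :: I, x.s < lo + c → x.q ≤ 2 * c := by
    intro x hx hxc
    have h2 := hI.2 i (by simp)
    have h4 := hlo i (by simp)
    rcases List.mem_cons.1 hx with rfl | hx
    · have h1 := (List.rel_of_pairwise_cons hI.1 (List.mem_cons_self (a := j) (l := I))).1
      have h3 := hI.2 j (by simp)
      linarith
    · have h1 := (List.rel_of_pairwise_cons hI.1 hx).1
      linarith
  have hne : i :: j :: I ≠ [] := by simp
  generalize i :: j :: I = K at hI hlo light hne ⊢
  clear rec single hord he hi hj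
  refine (rec' lo K hI hlo).mono ?_
  rintro w t₁ ⟨⟨I₁, J, v₁, rfl, h1, h2, rfl, h3⟩, ht₁⟩
  dsimp
  have hJ : Spaced δ J := ⟨(List.pairwise_append.1 hI.1).2.1, fun i hi => hI.2 i (by simp [hi])⟩
  refine (rec' (lo + c / 2) J hJ h2).mono ?_
  rintro w t₂ ⟨⟨I₂, I₃, v₂, rfl, h4, h5, rfl, h6⟩, ht₂⟩
  dsimp
  rw [show lo + c / 2 + c / 2 = lo + c by ring] at h4 h5
  have h7 : ∀ i ∈ I₁ ++ I₂, i.s < lo + c := by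
    intro x hx
    rcases List.mem_append.1 hx with hx | hx
    · have := h1 x hx; linarith
    · exact h4 x hx
  have hδc : 0 < c := hδ.trans hc
  -- Used when only one half is occupied: the depth does not grow while the cell doubles.
  have weaken : ∀ {t : STree} {I}, t.DepthsLe I (c / 2) → t.DepthsLe I c := by
    intro t I ht
    refine ht.imp fun i n h => ?_
    rcases h with h | h
    · exact .inl h
    · right; linarith
  rcases h3 with ⟨rfl, rfl⟩ | ⟨tl, hl1, hl2⟩
  · dsimp
    refine ⟨⟨I₂, I₃, v₂, by simp, by simpa using h4, h5, rfl, ?_⟩, by omega⟩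
    rcases h6 with h6 | ⟨t, h6, h8⟩
    · exact .inl h6
    · exact .inr ⟨t, h6, weaken h8⟩
  obtain ⟨hI₁, a₁, b₁, rfl⟩ := hl1.pair
  rcases h6 with ⟨rfl, rfl⟩ | ⟨tr, hr1, hr2⟩
  · dsimp
    exact ⟨⟨I₁, I₃, _, by simp, by simpa using h7, h5, rfl, .inr ⟨tl, hl1, weaken hl2⟩⟩, by omega⟩
  obtain ⟨hI₂, a₂, b₂, rfl⟩ := hr1.pair
  rcases I₂ with _ | ⟨i, I₂⟩
  · exact absurd rfl hI₂
  rcases I₁ with _ | ⟨i₁, I₁⟩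
  · exact absurd rfl hI₁
  obtain ⟨k, hk⟩ := ((List.pairwise_append.1 hI.1).2.2 i₁ (by simp) i (by simp)).2
  dsimp [encodeGaps]
  rw [hk]
  refine ⟨⟨(i₁ :: I₁) ++ i :: I₂, I₃, _, by simp, h7, h5, rfl, .inr ⟨.node k tl tr,
    ⟨_, _, _, _, _, rfl, hk, rfl, hl1, hr1⟩, ?_⟩⟩, by omega⟩
  -- A new internal node raises all depths by one and doubles the cell, which preserves `q * 2 ^ n ≤
  -- 4 * c`. A leaf of depth 0 has no previous bound; it uses `q ≤ 2 * c`, valid because half of its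
  -- weight lies between two midpoints of the cell.
  have deepen : ∀ {t : STree} {I' : List Gap}, (∀ x ∈ I', x.q ≤ 2 * c) → t.DepthsLe I' (c / 2) →
      List.Forall₂ (fun (i : Gap) n => n = 0 ∨ i.q * 2 ^ n ≤ 4 * c) I' (t.depths.map (· + 1)) := by
    intro t I' hq ht
    rw [List.forall₂_map_right_iff]
    rw [STree.DepthsLe, List.forall₂_iff_zip] at ht
    rw [List.forall₂_iff_zip]
    refine ⟨ht.1, fun {x n} hxn => .inr ?_⟩
    rcases ht.2 hxn with rfl | h
    · have := hq x (List.of_mem_zip hxn).1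
      simp; linarith
    · rw [pow_succ]; linarith
  have hq : ∀ x ∈ (i₁ :: I₁) ++ i :: I₂, x.q ≤ 2 * c := fun x hx =>
    light x (by rw [← List.append_assoc]; exact List.mem_append_left _ hx) (h7 x hx)
  rw [STree.DepthsLe, STree.depths, List.map_append]
  exact List.rel_append (deepen (fun x hx => hq x (List.mem_append_left _ hx)) hl2)
    (deepen (fun x hx => hq x (List.mem_append_right _ hx)) hr2)

/-- After `j` halvings the cell has length at most `δ` and needs no recursion. The time is that of a
full binary recursion of height `j`; moving 200 to the left side makes the bound double exactly from
level to level. -/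
theorem trie_spec {O : Box → ℝ} {δ : ℝ} (hδ : 0 < δ) : ∀ (j : ℕ) (lo c : ℝ) (I : List Gap),
    c ≤ δ * 2 ^ j → Spaced δ I → (∀ i ∈ I, lo ≤ i.s) →
    Spec O buildProgram fTrie (.tuple [.num lo, .num c, encodeGaps I]) fun w t =>
      TrieResult lo c I w ∧ t + 200 ≤ 200 * 2 ^ (j + 1) := by
  intro j
  induction j with
  | zero =>
    intro lo c I hc hI hlo
    exact (trie_step (m := 0) hδ hI hlo fun h => absurd h (by simpa using hc)).mono
      fun w t h => ⟨h.1, by have := h.2; omega⟩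
  | succ j ih =>
    intro lo c I hc hI hlo
    have hpos : 0 < 2 ^ j := by positivity
    refine (trie_step (m := 200 * 2 ^ (j + 1) - 200) hδ hI hlo fun _ lo' I' hI' hlo' =>
      (ih lo' _ I' ?_ hI' hlo').mono fun w t h => ⟨h.1, by have := h.2; omega⟩).mono
      fun w t h => ⟨h.1, ?_⟩
    · rw [pow_succ] at hc; linarith
    · have := h.2
      rw [pow_succ 2 (j + 1), pow_succ]
      rw [pow_succ] at this
      omega

/-! ### From partitions into gaps to the leaves of a search tree -/

/-- The gaps of `I` partition `(a, b]`. -/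
def Linked : EReal → List Gap → EReal → Prop
  | a, [], b => a = b
  | a, i :: I, b => i.a = a ∧ i.a < i.b ∧ Linked i.b I b

theorem Linked.append {I₁ I₂ : List Gap} : ∀ {a b : EReal}, Linked a (I₁ ++ I₂) b →
    ∃ c, Linked a I₁ c ∧ Linked c I₂ b := by
  induction I₁ with
  | nil => exact fun h => ⟨_, rfl, h⟩
  | cons i I₁ ih =>
    rintro a b ⟨h1, h2, h3⟩
    obtain ⟨c, h4, h5⟩ := ih h3
    exact ⟨c, ⟨h1, h2, h4⟩, h5⟩

theorem Linked.pairwise {I : List Gap} : ∀ {a b : EReal}, Linked a I b →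
    (I.map (·.a)).Pairwise (· < ·) ∧ ∀ i ∈ I, a ≤ i.a := by
  induction I with
  | nil => simp
  | cons i I ih =>
    rintro a b ⟨h1, h2, h3⟩
    obtain ⟨h4, h5⟩ := ih h3
    refine ⟨List.pairwise_cons.2 ⟨?_, h4⟩, ?_⟩
    · intro x hx
      obtain ⟨j, hj, rfl⟩ := List.mem_map.1 hx
      exact h2.trans_le (h5 j hj)
    · intro j hj
      rcases List.mem_cons.1 hj with rfl | hj
      · exact h1.ge
      · rw [← h1]; exact h2.le.trans (h5 j hj)

/-- The keys of the tree are the left ends of all gaps but the first, whereas the enumeration of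
gaps describes their right ends. Consecutive gaps share an end, so the two agree away from the final
right end. -/
theorem Linked.mem_ends {I : List Gap} : ∀ {a b : EReal}, Linked a I b → ∀ x, x ≠ b →
    ((∃ i ∈ I.tail, i.a = x) ↔ ∃ i ∈ I, i.b = x) := by
  induction I with
  | nil => simp
  | cons i I ih =>
    rintro a b ⟨h1, h2, h3⟩ x hx
    have := ih h3 x hx
    rcases I with _ | ⟨j, I⟩
    · have h4 : i.b = b := h3
      simp [h4, hx.symm]
    · have h4 : j.a = i.b := h3.1
      simp only [List.tail_cons, List.mem_cons, exists_eq_or_imp] at this ⊢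
      rw [← this, h4]

theorem GapChain.linked {g : EReal → EReal → ℝ} {H : EReal → EReal → Val → Prop}
    {I : List Gap} : ∀ {a : EReal} {acc : ℝ}, GapChain g H a acc I →
    Linked a I ⊤ ∧ ∀ i ∈ I, H i.a i.b i.h ∧ i.q = g i.a i.b := by
  induction I with
  | nil => exact fun h => ⟨h, by simp⟩
  | cons i I ih =>
    rintro a acc ⟨rfl, h2, h3, h4, h5, h6, h7⟩
    obtain ⟨h8, h9⟩ := ih h7
    refine ⟨⟨rfl, h4, h8⟩, ?_⟩
    intro j hj
    rcases List.mem_cons.1 hj with rfl | hj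
    · exact ⟨h5, h2⟩
    · exact h9 j hj

/-- Midpoints of consecutive intervals differ by at least half the sum of the two lengths, and half
of an interval still fits between its midpoint and either end of the total interval. Left ends after
the first are real, so they can serve as keys. -/
theorem GapChain.spaced {g : EReal → EReal → ℝ} {H : EReal → EReal → Val → Prop} {δ : ℝ}
    (hδ : 0 ≤ δ) (hg : ∀ a b, δ ≤ g a b)
    {I : List Gap} : ∀ {a : EReal} {acc : ℝ}, GapChain g H a acc I →
    Spaced δ I ∧ (∀ i ∈ I, acc + i.q / 2 ≤ i.s ∧ i.s + i.q / 2 ≤ acc + (I.map (·.q)).sum) ∧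
      ∀ i ∈ I.tail, ∃ k : ℝ, i.a = (k : EReal) := by
  induction I with
  | nil => exact fun h => ⟨⟨.nil, by simp⟩, by simp, by simp⟩
  | cons i I ih =>
    rintro a acc ⟨h1, h2, h3, h4, h5, h6, h7⟩
    obtain ⟨⟨h8, h9⟩, h10, h11⟩ := ih h7
    have hq : δ ≤ i.q := h2 ▸ hg _ _
    have hsum : 0 ≤ (I.map (·.q)).sum :=
      List.sum_nonneg fun x hx => by
        obtain ⟨j, hj, rfl⟩ := List.mem_map.1 hx
        exact hδ.trans (h9 j hj)
    have hreal : ∀ j ∈ I, ∃ k : ℝ, j.a = (k : EReal) := by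
      intro j hj
      rcases I with _ | ⟨j', I⟩
      · simp at hj
      · rcases List.mem_cons.1 hj with rfl | hj
        · obtain ⟨k, hk⟩ := h6 (by simp)
          exact ⟨k, h7.1.trans hk⟩
        · exact h11 j hj
    refine ⟨⟨List.pairwise_cons.2 ⟨fun j hj => ⟨?_, hreal j hj⟩, h8⟩, ?_⟩, ?_, hreal⟩
    · have := (h10 j hj).1
      linarith
    · intro j hj
      rcases List.mem_cons.1 hj with rfl | hj
      · exact hq
      · exact h9 j hj
    · intro j hj
      simp only [List.map_cons, List.sum_cons]
      rcases List.mem_cons.1 hj with rfl | hj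
      · constructor <;> linarith
      · have := h10 j hj
        constructor <;> linarith

theorem STree.Indexes.length {t : STree} : ∀ {I : List Gap} {v : Val}, t.Indexes I v →
    I.length = t.depths.length := by
  induction t with
  | leaf => rintro I v ⟨i, rfl, rfl⟩; rfl
  | node k l r ihl ihr =>
    rintro I v ⟨I₁, I₂, i, vl, vr, rfl, h1, rfl, h2, h3⟩
    rw [depths, List.length_map, List.length_append, List.length_append, ihl h2, ihr h3]

theorem STree.Indexes.leaves_eq {t : STree} : ∀ {I : List Gap} {v : Val} {a b : EReal} (d : ℕ),
    t.Indexes I v → Linked a I b →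
    t.leaves a b d = (I.zip t.depths).map fun p => (p.1.a, p.1.b, d + p.2) := by
  induction t with
  | leaf =>
    rintro I v a b d ⟨i, rfl, rfl⟩ ⟨h1, h2, h3⟩
    have h4 : i.b = b := h3
    simp [leaves, depths, h1, h4]
  | node k l r ihl ihr =>
    rintro I v a b d ⟨I₁, I₂, i, vl, vr, rfl, h1, rfl, h2, h3⟩ hI
    obtain ⟨c, h4, h5⟩ := hI.append
    obtain rfl : c = k := h5.1.symm.trans h1
    rw [leaves, ihl (d + 1) h2 h4, ihr (d + 1) h3 h5, depths, List.zip_map_right,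
      List.zip_append h2.length, List.map_map, List.map_append]
    congr 1 <;>
    · refine List.map_congr_left fun p _ => ?_
      simp [add_assoc, add_comm 1]

theorem STree.Indexes.keys_eq {t : STree} : ∀ {I : List Gap} {v : Val}, t.Indexes I v →
    t.keys.map (fun x : ℝ => (x : EReal)) = I.tail.map (·.a) := by
  induction t with
  | leaf => rintro I v ⟨i, rfl, rfl⟩; rfl
  | node k l r ihl ihr =>
    rintro I v ⟨I₁, I₂, i, vl, vr, rfl, h1, rfl, h2, h3⟩
    obtain ⟨i₁, I₁', rfl⟩ := List.exists_cons_of_ne_nil h2.pair.1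
    simp [keys, ihl h2, ihr h3, h1]

/-- `v` represents the search tree `t`, responsible for `(a, b]`, and the leaf with interval
`(a', b']` contains a value `h` with `H a' b' h`. -/
def STree.Finds (H : EReal → EReal → Val → Prop) : STree → EReal → EReal → Val → Prop
  | .leaf, a, b, v => ∃ h, v = .pair .nil h ∧ H a b h
  | .node k l r, a, b, v => ∃ vl vr, v = .pair (.pair (.coord k) .nil) (.pair vl vr) ∧
      l.Finds H a k vl ∧ r.Finds H k b vr

theorem STree.Finds.rep {H : EReal → EReal → Val → Prop} {t : STree} :
    ∀ {a b : EReal} {v : Val}, t.Finds H a b v → t.Rep v := by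
  induction t with
  | leaf => rintro a b v ⟨h, rfl, -⟩; exact ⟨_, rfl⟩
  | node k l r ihl ihr =>
    rintro a b v ⟨vl, vr, rfl, h1, h2⟩
    exact ⟨_, _, _, rfl, ihl h1, ihr h2⟩

theorem STree.Indexes.finds {H : EReal → EReal → Val → Prop} {t : STree} :
    ∀ {I : List Gap} {v : Val} {a b : EReal}, t.Indexes I v → Linked a I b →
    (∀ i ∈ I, H i.a i.b i.h) → t.Finds H a b v := by
  induction t with
  | leaf =>
    rintro I v a b ⟨i, rfl, rfl⟩ ⟨h1, h2, h3⟩ hH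
    have h4 : i.b = b := h3
    have := hH i (by simp)
    rw [h1, h4] at this
    exact ⟨_, rfl, this⟩
  | node k l r ihl ihr =>
    rintro I v a b ⟨I₁, I₂, i, vl, vr, rfl, h1, rfl, h2, h3⟩ hI hH
    obtain ⟨c, h4, h5⟩ := hI.append
    obtain rfl : c = k := h5.1.symm.trans h1
    exact ⟨_, _, rfl, ihl h2 h4 fun i hi => hH i (List.mem_append_left _ hi),
      ihr h3 h5 fun i hi => hH i (List.mem_append_right _ hi)⟩

theorem STree.searchDepth_mem (x : ℝ) (t : STree) : t.searchDepth x ∈ t.depths := by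
  induction t with
  | leaf => simp [searchDepth, depths]
  | node k l r ihl ihr =>
    rw [searchDepth, depths, List.mem_map]
    split_ifs
    · exact ⟨_, List.mem_append_left _ ihl, add_comm _ _⟩
    · exact ⟨_, List.mem_append_right _ ihr, add_comm _ _⟩

/-- From `w * 2 ^ n ≤ 2 ^ 3` follows `n ≤ log₂ (1 / w) + 3`; multiplication by `w` gives the bound.
A leaf at depth 0 and a gap of probability 0 are covered separately. This is the origin of the
additive slack 3. -/
theorem leaf_cost_le {w q : ℝ} {n : ℕ} (h0 : 0 ≤ w) (h1 : w ≤ 1) (hq : w ≤ q)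
    (h : n = 0 ∨ q * 2 ^ n ≤ 8) : w * n ≤ Real.negMulLog w / Real.log 2 + 3 * w := by
  have hlog : 0 < Real.log 2 := Real.log_pos one_lt_two
  rcases h with rfl | h
  · have := div_nonneg (Real.negMulLog_nonneg h0 h1) hlog.le
    simp; linarith
  rcases h0.eq_or_lt with rfl | h0
  · simp
  have h2 : w * 2 ^ n ≤ 2 ^ 3 := by
    have : w * 2 ^ n ≤ q * 2 ^ n := by gcongr
    linarith
  have h3 := Real.log_le_log (by positivity) h2
  rw [Real.log_mul h0.ne' (by positivity), Real.log_pow, Real.log_pow] at h3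
  rw [Real.negMulLog, ← sub_le_iff_le_add, le_div_iff₀ hlog]
  push_cast at h3
  nlinarith

/-! ### Gap probabilities and the entropy bound -/

theorem sum_measure_le {μ : Measure Pt} [IsFiniteMeasure μ] {f : Pt → ℝ} (hf : Measurable f)
    {I : List Gap} : ∀ {a : EReal}, Linked a I ⊤ →
    (I.map fun i => μ.real {q | i.a < (f q : EReal) ∧ (f q : EReal) ≤ i.b}).sum ≤
      μ.real {q | a < (f q : EReal)} := by
  have hm : Measurable fun q => (f q : EReal) := measurable_coe_real_ereal.comp hf
  induction I with
  | nil => intro a _; simp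
  | cons i I ih =>
    rintro a ⟨rfl, h1, h2⟩
    rw [List.map_cons, List.sum_cons]
    refine (add_le_add_right (ih h2) _).trans ?_
    rw [← measureReal_union]
    · refine measureReal_mono ?_
      rintro q (h | h)
      · exact h.1
      · exact h1.trans h
    · rw [Set.disjoint_left]
      exact fun q h h' => absurd h.2 (not_le.2 h')
    · exact measurableSet_lt measurable_const hm

theorem measurable_coordAt (d : ℕ) : Measurable (coordAt d) := by
  by_cases h : Even d
  · have : coordAt d = Prod.fst := by funext p; simp [coordAt, h]
    rw [this]; exact measurable_fst
  · have : coordAt d = Prod.snd := by funext p; simp [coordAt, h]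
    rw [this]; exact measurable_snd

theorem Box.measurableSet_toSet (r : Box) : MeasurableSet r.toSet := by
  have h1 : Measurable fun q : Pt => (q.1 : EReal) := measurable_coe_real_ereal.comp measurable_fst
  have h2 : Measurable fun q : Pt => (q.2 : EReal) := measurable_coe_real_ereal.comp measurable_snd
  exact (measurableSet_lt measurable_const h1).inter ((measurableSet_le h1 measurable_const).inter
    ((measurableSet_lt measurable_const h2).inter (measurableSet_le h2 measurable_const)))

theorem massBox_toSet (d : ℕ) (w : Box) (a b : EReal) : (massBox d w a b).toSet =
    w.toSet ∩ {q | a < (coordAt d q : EReal) ∧ (coordAt d q : EReal) ≤ b} := by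
  ext q
  by_cases h : Even d <;> simp [massBox, Box.toSet, coordAt, h] <;> tauto

/-- This also holds when the box has probability 0: both sides are then 0, by the conventions for
conditioning and for division. The program may therefore divide without a test. -/
theorem cond_real_eq (D : Measure Pt) (d : ℕ) (w : Box) (a b : EReal) :
    (ProbabilityTheory.cond D w.toSet).real
      {q | a < (coordAt d q : EReal) ∧ (coordAt d q : EReal) ≤ b} =
    oracle D (massBox d w a b) / oracle D w := by
  rw [oracle, oracle, massBox_toSet, Measure.real,
    ProbabilityTheory.cond_apply w.measurableSet_toSet, ENNReal.toReal_mul, ENNReal.toReal_inv,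
    div_eq_inv_mul, Measure.real, Measure.real]

theorem oracle_massBox_div_le (D : Measure Pt) [IsFiniteMeasure D] (d : ℕ) (w : Box)
    (a b : EReal) : 0 ≤ oracle D (massBox d w a b) / oracle D w ∧
      oracle D (massBox d w a b) / oracle D w ≤ 1 := by
  have h : oracle D (massBox d w a b) ≤ oracle D w := by
    rw [oracle, oracle, massBox_toSet]
    exact measureReal_mono Set.inter_subset_left
  have h0 : 0 ≤ oracle D w := measureReal_nonneg
  exact ⟨div_nonneg measureReal_nonneg h0, div_le_one_of_le₀ h h0⟩

theorem sum_cond_le (D : Measure Pt) [IsFiniteMeasure D] (d : ℕ) (w : Box) {I : List Gap}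
    {a : EReal} (h : Linked a I ⊤) :
    (I.map fun i => oracle D (massBox d w i.a i.b) / oracle D w).sum ≤ 1 := by
  simp only [← cond_real_eq]
  exact (sum_measure_le (measurable_coordAt d) h).trans measureReal_le_one

/-- The bound of each leaf is summed over the gaps. The terms `3 * w` contribute at most 3 because
the gap probabilities sum to at most 1. -/
theorem isBiased_of_depthsLe {D : Measure Pt} [IsFiniteMeasure D] {d : ℕ} {w : Box} {δ : ℝ}
    (hδ : 0 ≤ δ) {I : List Gap} {t : STree} {v : Val} {X : Set ℝ} (hI : Linked ⊥ I ⊤)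
    (hq : ∀ i ∈ I, i.q = oracle D (massBox d w i.a i.b) / oracle D w + δ)
    (ht : t.Indexes I v) (hd : t.DepthsLe I 2) (hX : ∀ x : ℝ, (∃ i ∈ I, i.b = x) ↔ x ∈ X) :
    t.IsBiased 3 X (fun a b => (ProbabilityTheory.cond D w.toSet).real
      {q | a < (coordAt d q : EReal) ∧ (coordAt d q : EReal) ≤ b}) := by
  have hk := ht.keys_eq
  refine ⟨?_, ?_, ?_⟩
  · have h1 := hI.pairwise.1.sublist ((List.tail_sublist I).map (·.a))
    rw [← hk, List.pairwise_map] at h1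
    exact h1.imp fun h => EReal.coe_lt_coe_iff.1 h
  · intro x
    rw [← hX, ← hI.mem_ends _ (EReal.coe_ne_top x)]
    have h2 : x ∈ t.keys ↔ (x : EReal) ∈ t.keys.map (fun x : ℝ => (x : EReal)) := by
      simp
    rw [h2, hk, List.mem_map]
  · rw [STree.expectedDepth, STree.entropy, ht.leaves_eq 0 hI, List.map_map, List.map_map]
    have h3 : ((I.zip t.depths).map fun p => oracle D (massBox d w p.1.a p.1.b) / oracle D w).sum
        ≤ 1 := by
      have := sum_cond_le D d w hI
      rwa [← List.map_fst_zip (l₁ := I) (l₂ := t.depths) ht.length.le, List.map_map] at this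
    have h4 : ((I.zip t.depths).map fun p =>
          oracle D (massBox d w p.1.a p.1.b) / oracle D w * p.2).sum ≤
        ((I.zip t.depths).map fun p =>
          Real.negMulLog (oracle D (massBox d w p.1.a p.1.b) / oracle D w) / Real.log 2 +
          3 * (oracle D (massBox d w p.1.a p.1.b) / oracle D w)).sum := by
      refine List.sum_le_sum fun p hp => ?_
      obtain ⟨h5, h6⟩ := oracle_massBox_div_le D d w p.1.a p.1.b
      have h7 := hq p.1 (List.of_mem_zip hp).1
      refine leaf_cost_le (q := p.1.q) h5 h6 (by linarith) ?_
      obtain ⟨-, h8⟩ := List.forall₂_iff_zip.1 hd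
      exact (h8 hp).imp_right fun h => by linarith
    rw [List.sum_map_add, List.sum_map_mul_left] at h4
    simp only [Function.comp_def, cond_real_eq, zero_add]
    linarith

/-- Besides bias, the weight `δ` of every gap forces `δ * 2 ^ depth ≤ 8`, a worst-case bound
independent of `D`. It also limits the number of bisections, so construction is linear. The handles
at the leaves turn a search into a position in the list. -/
theorem index_spec {D : Measure Pt} [IsProbabilityMeasure D] {α : Type} {enc : α → Val}
    {X : List α → List α → Val → Prop} {key : α → ℝ} {d n : ℕ} (hn : n ≤ 11)
    (hsel : ∀ e env Q, wp (oracle D) buildProgram selBody (.pair (enc e) (flag d) :: env) Q =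
      Q (.coord (key e)) n)
    (w : Box) {L : List α} (hL : L.Pairwise fun e e' => key e ≤ key e') {h : Val}
    (hh : HandleTo enc X [] L h) :
    Spec (oracle D) buildProgram fIndex (.tuple [flag d, encodeBox w, h]) fun v t =>
      ∃ T : STree, T.IsBiased 3 {x | ∃ e ∈ L, key e = x}
          (fun a b => (ProbabilityTheory.cond D w.toSet).real
            {q | a < (coordAt d q : EReal) ∧ (coordAt d q : EReal) ≤ b}) ∧
        T.Finds (GapHandle enc X key L) ⊥ ⊤ v ∧
        (∀ x, 2 ^ T.searchDepth x ≤ 8 * (L.length + 1)) ∧ t ≤ 3000 * L.length + 3000 := by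
  obtain ⟨vL, x, rfl, -, hrep⟩ := hh.pair
  set W := oracle D w with hW
  -- There are at most `L.length + 1` gaps, so the additional weights sum to at most 1 and the total
  -- weight to at most 2, the length of the initial cell.
  set δ : ℝ := 1 / (L.length + 1) with hδ
  have hδ0 : 0 < δ := by positivity
  apply Spec.intro (body := indexBody) rfl
  dsimp [indexBody, encodeBox]
  refine (len_spec L.length vL hrep.isListVal).mono ?_
  rintro v t₁ ⟨rfl, ht₁⟩
  dsimp
  simp only [Int.cast_one, Int.cast_zero]
  refine (items_spec (O := oracle D) (X := X) hn hsel w W δ hL L [] _ ⊥ 0 rfl (by simp) (by simp)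
    (by simp) hh).mono ?_
  rintro v t₂ ⟨I, rfl, hI, hX, hne, hlen, ht₂⟩
  simp only [Int.cast_ofNat]
  have hg : ∀ a b, δ ≤ oracle D (massBox d w a b) / W + δ := fun a b => by
    linarith [(oracle_massBox_div_le D d w a b).1]
  obtain ⟨hspaced, hpos, -⟩ := hI.spaced hδ0.le hg
  obtain ⟨hlink, hH⟩ := hI.linked
  have hM : (1 : ℝ) ≤ L.length + 1 := by linarith [(Nat.cast_nonneg L.length : (0 : ℝ) ≤ _)]
  have hδM : δ * (L.length + 1) = 1 := by rw [hδ]; field_simp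
  have hj : 2 * (L.length + 1) ≤ 2 ^ Nat.clog 2 (2 * (L.length + 1)) :=
    Nat.le_pow_clog one_lt_two _
  have hj' : 2 ^ Nat.clog 2 (2 * (L.length + 1)) ≤ 4 * (L.length + 1) := by
    have h1 := Nat.pow_pred_clog_lt_self (b := 2) one_lt_two (x := 2 * (L.length + 1)) (by omega)
    have h2 : 0 < Nat.clog 2 (2 * (L.length + 1)) := Nat.clog_pos one_lt_two (by omega)
    obtain ⟨m, hm⟩ : ∃ m, Nat.clog 2 (2 * (L.length + 1)) = m + 1 := ⟨_, (Nat.succ_pred h2.ne').symm⟩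
    rw [hm, Nat.pred_succ] at h1
    rw [hm, pow_succ]
    omega
  refine (trie_spec hδ0 (Nat.clog 2 (2 * (L.length + 1))) 0 2 I ?_ hspaced ?_).mono ?_
  · have : (2 * (L.length + 1) : ℝ) ≤ 2 ^ Nat.clog 2 (2 * (L.length + 1)) := by exact_mod_cast hj
    calc (2 : ℝ) = δ * (2 * (L.length + 1)) := by linarith
      _ ≤ _ := by gcongr
  · intro i hi
    linarith [(hpos i hi).1, hspaced.2 i hi]
  rintro v t₃ ⟨⟨I₁, I₂, v, rfl, h1, h2, rfl, h3⟩, ht₃⟩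
  dsimp
  have htot : ((I₁ ++ I₂).map (·.q)).sum ≤ 2 := by
    have e1 : (I₁ ++ I₂).map (·.q) =
        (I₁ ++ I₂).map fun i => oracle D (massBox d w i.a i.b) / W + δ :=
      List.map_congr_left fun i hi => (hH i hi).2
    rw [e1, List.sum_map_add]
    have e2 := sum_cond_le D d w hlink
    have e3 : ((I₁ ++ I₂).map fun _ => δ).sum ≤ 1 := by
      rw [List.map_const', List.sum_replicate, nsmul_eq_mul, ← hδM, mul_comm]
      gcongr
      exact_mod_cast hlen
    linarith
  -- A gap left over would have its midpoint at 2 or later, and the positive second half of its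
  -- weight would exceed the total.
  have hI₂ : I₂ = [] := by
    rcases I₂ with _ | ⟨i, I₂⟩
    · rfl
    have e1 := h2 i (by simp)
    have e2 := (hpos i (by simp)).2
    have e3 := hspaced.2 i (by simp)
    linarith
  subst hI₂
  rw [List.append_nil] at *
  obtain ⟨T, hT, hdepth⟩ := h3.resolve_left fun h => hne h.1
  refine ⟨T, isBiased_of_depthsLe hδ0.le hlink (fun i hi => (hH i hi).2) hT hdepth ?_,
    hT.finds hlink fun i hi => (hH i hi).1, ?_, ?_⟩
  · intro x
    rw [hX]
    simp
  · intro x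
    obtain ⟨i, hi⟩ : ∃ i, (i, T.searchDepth x) ∈ I₁.zip T.depths := by
      obtain ⟨m, hm, hm'⟩ := List.getElem_of_mem (T.searchDepth_mem x)
      have hm2 : m < I₁.length := hT.length ▸ hm
      refine ⟨I₁[m], ?_⟩
      rw [← hm', List.mem_iff_getElem]
      exact ⟨m, by simp [hm2, hm], by simp⟩
    have h4 := (List.forall₂_iff_zip.1 hdepth).2 hi
    rcases h4 with h4 | h4
    · rw [h4]; omega
    · have h5 : δ ≤ i.q := hspaced.2 i (List.of_mem_zip hi).1
      have h6 : (2 : ℝ) ^ T.searchDepth x ≤ 8 * (L.length + 1) := by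
        have h7 : δ * 2 ^ T.searchDepth x ≤ 8 := by
          have : δ * 2 ^ T.searchDepth x ≤ i.q * 2 ^ T.searchDepth x := by gcongr
          linarith
        calc (2 : ℝ) ^ T.searchDepth x = (δ * 2 ^ T.searchDepth x) * (L.length + 1) := by
              rw [mul_right_comm, hδM, one_mul]
          _ ≤ _ := by gcongr
      exact_mod_cast h6
  · rw [pow_succ] at ht₃
    omega

/-! ## Fractional cascading -/

/-- The annotations of a catalogue whose ancestors have the catalogues `chain`, nearest first: the
number of own entries from here on and the corresponding position in the catalogue of the
parent. -/
def CatalogueNote (d : ℕ) : List (List Entry) → List Entry → List Entry → Val → Prop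
  | [], _, suf, x => x = .pair (.num (suf.countP (·.2))) .nil
  | c :: chain, pre, suf, x => ∃ ph, x = .pair (.num (suf.countP (·.2))) ph ∧
      ∃ pre' suf', pre' ++ suf' = c ∧
        (∀ z, (∀ e ∈ pre, coordAt d e.1 < z) → ∀ e ∈ pre', coordAt d e.1 < z) ∧
        (∀ z, (∀ e ∈ suf, z ≤ coordAt d e.1) → ∀ e ∈ suf'.drop 3, z ≤ coordAt d e.1) ∧
        HandleTo encodeEntry (CatalogueNote d chain) pre' suf' ph

theorem CatalogueNote.count {d : ℕ} {chain : List (List Entry)} {pre suf : List Entry} {x : Val}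
    (h : CatalogueNote d chain pre suf x) : ∃ y, x = .pair (.num (suf.countP (·.2))) y := by
  cases chain with
  | nil => exact ⟨_, h⟩
  | cons c chain => obtain ⟨ph, rfl, -⟩ := h; exact ⟨_, rfl⟩

theorem fourth_spec_none {O : Box → ℝ} {X : List Entry → List Entry → Val → Prop}
    {pre suf : List Entry} {h : Val} (hh : HandleTo encodeEntry X pre suf h) (hs : suf.length < 4) :
    Spec O buildProgram fFourth h fun v t => v = .nil ∧ t ≤ 80 := by
  apply Spec.intro (body := fourthBody) rfl
  rcases suf with _ | ⟨e₀, _ | ⟨e₁, _ | ⟨e₂, _ | ⟨e₃, suf⟩⟩⟩⟩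
  · obtain ⟨x, rfl, -⟩ := hh
    exact ⟨rfl, by dsimp; omega⟩
  · obtain ⟨x, v, x', rfl, -, ⟨y, hy, -⟩⟩ := hh
    cases hy
    exact ⟨rfl, by dsimp; omega⟩
  · obtain ⟨x, v, x', rfl, -, ⟨x₁, v₁, x₁', h₁, -, ⟨y, hy, -⟩⟩⟩ := hh
    cases h₁
    cases hy
    exact ⟨rfl, by dsimp; omega⟩
  · obtain ⟨x, v, x', rfl, -, ⟨x₁, v₁, x₁', h₁, -, ⟨x₂, v₂, x₂', h₂, -, ⟨y, hy, -⟩⟩⟩⟩ := hh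
    cases h₁
    cases h₂
    cases hy
    exact ⟨rfl, by dsimp; omega⟩
  · simp only [List.length_cons] at hs; omega

theorem fourth_spec_some {O : Box → ℝ} {X : List Entry → List Entry → Val → Prop}
    {pre suf : List Entry} {e₀ e₁ e₂ e₃ : Entry} {h : Val}
    (hh : HandleTo encodeEntry X pre (e₀ :: e₁ :: e₂ :: e₃ :: suf) h) :
    Spec O buildProgram fFourth h fun v t => ∃ h', v = .pair (encodeEntry e₃) h' ∧
      HandleTo encodeEntry X (pre ++ [e₀, e₁, e₂, e₃]) suf h' ∧ t ≤ 80 := by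
  apply Spec.intro (body := fourthBody) rfl
  obtain ⟨x, v, x', rfl, -, ⟨x₁, v₁, x₁', h₁, -, ⟨x₂, v₂, x₂', h₂, -, ⟨x₃, v₃, x₃', h₃, -, hh⟩⟩⟩⟩ := hh
  cases h₁
  cases h₂
  cases h₃
  exact ⟨_, rfl, by simpa using hh, by dsimp; omega⟩

/-- The sorted list `own` of own points merged with the sample of a catalogue. -/
def cascadeAt (d : ℕ) (own : List Pt) (parent : List Entry) : List Entry :=
  (own.map fun p => (p, true)).merge ((everyFourth parent).map fun e => (e.1, false))
    fun e e' => decide (coordAt d e.1 ≤ coordAt d e'.1)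

theorem cascadeAt_perm (d : ℕ) (own : List Pt) (parent : List Entry) :
    (cascadeAt d own parent).Perm
      (own.map (fun p => (p, true)) ++ (everyFourth parent).map fun e => (e.1, false)) :=
  List.merge_perm_append _

theorem everyFourth_of_length_lt : ∀ {l : List Entry}, l.length < 4 → everyFourth l = []
  | [], _ => rfl
  | [_], _ => rfl
  | [_, _], _ => rfl
  | [_, _, _], _ => rfl
  | _ :: _ :: _ :: _ :: _, h => by simp only [List.length_cons] at h; omega

theorem exists_four_cons {l : List Entry} (h : ¬ l.length < 4) :
    ∃ e₀ e₁ e₂ e s, l = e₀ :: e₁ :: e₂ :: e :: s := by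
  rcases l with _ | ⟨e₀, _ | ⟨e₁, _ | ⟨e₂, _ | ⟨e₃, s⟩⟩⟩⟩
  · simp at h
  · simp at h
  · simp at h
  · simp at h
  · exact ⟨_, _, _, _, _, rfl⟩

theorem everyFourth_sublist : ∀ l : List Entry, (everyFourth l).Sublist l
  | [] => .slnil
  | [_] => by simp [everyFourth]
  | [_, _] => by simp [everyFourth]
  | [_, _, _] => by simp [everyFourth]
  | _ :: _ :: _ :: e :: l => by
    rw [everyFourth]
    exact .cons _ (.cons _ (.cons _ (.cons_cons e (everyFourth_sublist l))))

theorem everyFourth_length : ∀ l : List Entry, 4 * (everyFourth l).length ≤ l.length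
  | [] => by simp [everyFourth]
  | [_] => by simp [everyFourth]
  | [_, _] => by simp [everyFourth]
  | [_, _, _] => by simp [everyFourth]
  | _ :: _ :: _ :: e :: l => by
    have := everyFourth_length l
    simp [everyFourth]; omega

theorem cascadeAt_pairwise {d : ℕ} {own : List Pt} {parent : List Entry}
    (ho : own.Pairwise fun p q => coordAt d p ≤ coordAt d q)
    (hp : parent.Pairwise fun e e' => coordAt d e.1 ≤ coordAt d e'.1) :
    (cascadeAt d own parent).Pairwise fun e e' => coordAt d e.1 ≤ coordAt d e'.1 := by
  have h := List.pairwise_merge (le := fun e e' : Entry => decide (coordAt d e.1 ≤ coordAt d e'.1))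
    (by intro a b c h1 h2; simp only [decide_eq_true_eq] at *; exact h1.trans h2)
    (by intro a b; simpa using le_total _ _)
    (own.map fun p => (p, true)) ((everyFourth parent).map fun e => (e.1, false))
    (by simpa [List.pairwise_map] using ho)
    (by simpa [List.pairwise_map] using hp.sublist (everyFourth_sublist parent))
  simpa [cascadeAt] using h

/-- The two conditions of `CatalogueNote` bracket the wanted position in the parent: it is not
before the pointer and at most three entries after it. The recursion consumes the parent in blocks
of four, whose last entry is the copied one, and keeps the pointer at the start of the current
block. -/
theorem cascade_spec {O : Box → ℝ} (d : ℕ) (chain : List (List Entry)) {c : List Entry}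
    (hc : c.Pairwise fun e e' => coordAt d e.1 ≤ coordAt d e'.1) :
    ∀ (m : ℕ) (own : List Pt) (pre pre' suf' : List Entry) (ph : Val),
    own.length + (everyFourth suf').length ≤ m → pre' ++ suf' = c →
    (∀ z, (∀ e ∈ pre, coordAt d e.1 < z) → ∀ e ∈ pre', coordAt d e.1 < z) →
    HandleTo encodeEntry (CatalogueNote d chain) pre' suf' ph →
    Spec O buildProgram fCascade (.tuple [flag d, encodePts own, ph]) fun w t =>
      HandleTo encodeEntry (CatalogueNote d (c :: chain)) pre (cascadeAt d own suf') w ∧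
      t ≤ 300 * (own.length + (everyFourth suf').length) + 300 := by
  intro m
  induction m with
  | zero =>
    intro own pre pre' suf' ph hm hpc hpre hh
    obtain rfl : own = [] := List.length_eq_zero_iff.1 (by omega)
    have h4 : suf'.length < 4 := by
      by_contra h
      obtain ⟨e₀, e₁, e₂, e, s, rfl⟩ := exists_four_cons h
      simp [everyFourth] at hm
    apply Spec.intro (body := cascadeBody) rfl
    dsimp [cascadeBody, encodePts]
    refine (fourth_spec_none hh h4).mono ?_
    rintro w t ⟨rfl, ht⟩
    dsimp
    have e1 : cascadeAt d [] suf' = [] := by simp [cascadeAt, everyFourth_of_length_lt h4]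
    rw [e1]
    refine ⟨⟨_, rfl, _, ?_, _, _, hpc, hpre, ?_, hh⟩, by omega⟩
    · simp
    · intro z _ e he
      rw [List.drop_eq_nil_of_le (by omega)] at he
      simp at he
  | succ m ih =>
    intro own pre pre' suf' ph hm hpc hpre hh
    have hsuf' : suf'.Pairwise fun e e' => coordAt d e.1 ≤ coordAt d e'.1 := by
      rw [← hpc] at hc
      exact (List.pairwise_append.1 hc).2.1
    -- The fourth entry of the remaining parent list is itself copied into the merged suffix, and
    -- the later ones are no smaller. With fewer than four entries nothing survives the drop.
    have hback : ∀ z, (∀ e ∈ cascadeAt d own suf', z ≤ coordAt d e.1) →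
        ∀ e ∈ suf'.drop 3, z ≤ coordAt d e.1 := by
      intro z hz e he
      rcases suf' with _ | ⟨e₀, _ | ⟨e₁, _ | ⟨e₂, _ | ⟨e₃, suf⟩⟩⟩⟩
      · simp at he
      · simp at he
      · simp at he
      · simp at he
      have h1 := hz (e₃.1, false) ((cascadeAt_perm _ _ _).mem_iff.2 (by simp [everyFourth]))
      rcases List.mem_cons.1 (show e ∈ e₃ :: suf from he) with rfl | he
      · exact h1
      · refine h1.trans ?_
        have h2 := hsuf'.sublist (List.drop_sublist 3 _)
        exact List.rel_of_pairwise_cons (show List.Pairwise _ (e₃ :: suf) from h2) he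
    have takeOwn : ∀ (p : Pt) (own' : List Pt), own = p :: own' →
        cascadeAt d own suf' = (p, true) :: cascadeAt d own' suf' →
        Spec O buildProgram fCascade (.tuple [flag d, encodePts own', ph]) fun w t =>
          (∃ v k q, w = .pair v (.pair (.num k) q) ∧
            HandleTo encodeEntry (CatalogueNote d (c :: chain)) pre (cascadeAt d own suf')
              (.pair (.pair (.pair (.pair (encodePt p) (.num 1)) w) v) (.pair (.num (k + 1)) ph))) ∧
          t ≤ 300 * (own'.length + (everyFourth suf').length) + 300 := by
      rintro p own' rfl hmer
      refine (ih own' (pre ++ [(p, true)]) pre' suf' ph (by simp at hm; omega) hpc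
        (fun z hz => hpre z fun e he => hz e (by simp [he])) hh).mono ?_
      rintro w t ⟨hw, ht⟩
      refine ⟨?_, ht⟩
      obtain ⟨v, y, rfl, hy, -⟩ := hw.pair
      obtain ⟨q, rfl⟩ := hy.count
      refine ⟨v, _, q, rfl, ?_⟩
      rw [hmer] at hback ⊢
      refine ⟨.pair (.num _) ph, v, _, by simp [encodeEntry]; rfl,
        ⟨_, ?_, _, _, hpc, hpre, hback, hh⟩, hw⟩
      simp
    have takeCopy : ∀ (e₀ e₁ e₂ e : Entry) (s : List Entry), suf' = e₀ :: e₁ :: e₂ :: e :: s →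
        cascadeAt d own suf' = (e.1, false) :: cascadeAt d own s →
        ∀ h', HandleTo encodeEntry (CatalogueNote d chain) (pre' ++ [e₀, e₁, e₂, e]) s h' →
        Spec O buildProgram fCascade (.tuple [flag d, encodePts own, h']) fun w t =>
          (∃ v k q, w = .pair v (.pair (.num k) q) ∧
            HandleTo encodeEntry (CatalogueNote d (c :: chain)) pre (cascadeAt d own suf')
              (.pair (.pair (.pair (.pair (encodePt e.1) (.num 0)) w) v)
                (.pair (.num (k + 0)) ph))) ∧
          t + 300 ≤ 300 * (own.length + (everyFourth suf').length) + 300 := by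
      rintro e₀ e₁ e₂ e s rfl hmer h' hh'
      refine (ih own (pre ++ [(e.1, false)]) _ s h' (by simp [everyFourth] at hm; omega)
        (by simpa using hpc) ?_ hh').mono ?_
      · intro z hz e' he'
        rcases List.mem_append.1 he' with he' | he'
        · exact hpre z (fun e he => hz e (by simp [he])) e' he'
        -- The copied entry is the largest of its block, so the three skipped entries are below `z`
        -- with it.
        · have h1 : coordAt d e.1 < z := hz (e.1, false) (by simp)
          refine lt_of_le_of_lt ?_ h1
          have h2 : List.Pairwise (fun e e' : Entry => coordAt d e.1 ≤ coordAt d e'.1)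
            [e₀, e₁, e₂, e] := hsuf'.sublist (List.take_sublist 4 (e₀ :: e₁ :: e₂ :: e :: s))
          simp at h2 he'
          rcases he' with rfl | rfl | rfl | rfl <;> tauto
      rintro w t ⟨hw, ht⟩
      refine ⟨?_, by simp [everyFourth]; omega⟩
      obtain ⟨v, y, rfl, hy, -⟩ := hw.pair
      obtain ⟨q, rfl⟩ := hy.count
      refine ⟨v, _, q, rfl, ?_⟩
      rw [hmer] at hback ⊢
      refine ⟨.pair (.num _) ph, v, _, by simp [encodeEntry]; rfl,
        ⟨_, ?_, _, _, hpc, hpre, hback, hh⟩, hw⟩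
      simp
    apply Spec.intro (body := cascadeBody) rfl
    by_cases h4 : suf'.length < 4
    · have e1 : everyFourth suf' = [] := everyFourth_of_length_lt h4
      rcases own with _ | ⟨p, own⟩
      · obtain ⟨b, w, t, s, h1, h2, h3, h4⟩ := ih [] pre pre' suf' ph (by simp [e1]) hpc hpre hh
        cases h1
        dsimp [cascadeBody, encodePts]
        refine (fourth_spec_none hh (by assumption)).mono ?_
        rintro w t ⟨rfl, ht⟩
        dsimp
        have e2 : cascadeAt d [] suf' = [] := by simp [cascadeAt, e1]
        rw [e2] at hback ⊢
        refine ⟨⟨_, rfl, _, ?_, _, _, hpc, hpre, hback, hh⟩, by omega⟩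
        simp
      · dsimp [cascadeBody, encodePts]
        refine (fourth_spec_none hh h4).mono ?_
        rintro w t ⟨rfl, ht⟩
        dsimp
        refine (takeOwn p own rfl (by simp [cascadeAt, e1])).mono ?_
        rintro w t' ⟨⟨v, k, q, rfl, hw⟩, ht'⟩
        dsimp
        exact ⟨by simpa using hw, by omega⟩
    · obtain ⟨e₀, e₁, e₂, e, s, rfl⟩ := exists_four_cons h4
      have hencode : ∀ e : Entry, encodeEntry e = .pair (encodePt e.1) (.num (if e.2 then 1 else 0)) :=
        fun _ => rfl
      rcases own with _ | ⟨p, own⟩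
      · dsimp [cascadeBody, encodePts]
        refine (fourth_spec_some hh).mono ?_
        rintro w t ⟨h', rfl, hh', ht⟩
        dsimp
        refine (takeCopy e₀ e₁ e₂ e s rfl (by simp [cascadeAt, everyFourth]) h' hh').mono ?_
        rintro w t' ⟨⟨v, k, q, rfl, hw⟩, ht'⟩
        dsimp [hencode]
        exact ⟨by simpa using hw, by simp at ht'; omega⟩
      · by_cases hpe : coordAt d p ≤ coordAt d e.1
        · dsimp [cascadeBody, encodePts]
          refine (fourth_spec_some hh).mono ?_
          rintro w t ⟨h', rfl, hh', ht⟩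
          dsimp
          rw [wp_selBody_pt]
          dsimp
          rw [wp_selBody_entry]
          dsimp
          rw [if_pos (by exact_mod_cast hpe)]
          refine (takeOwn p own rfl (by
            simp [cascadeAt, everyFourth, List.cons_merge_cons_pos, hpe])).mono ?_
          rintro w t' ⟨⟨v, k, q, rfl, hw⟩, ht'⟩
          dsimp
          exact ⟨by simpa using hw, by omega⟩
        · dsimp [cascadeBody, encodePts]
          refine (fourth_spec_some hh).mono ?_
          rintro w t ⟨h', rfl, hh', ht⟩
          dsimp
          rw [wp_selBody_pt]
          dsimp
          rw [wp_selBody_entry]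
          dsimp
          rw [if_neg (by exact_mod_cast hpe)]
          refine (takeCopy e₀ e₁ e₂ e s rfl (by
            simp [cascadeAt, everyFourth, List.cons_merge_cons_neg, hpe]) h' hh').mono ?_
          rintro w t' ⟨⟨v, k, q, rfl, hw⟩, ht'⟩
          dsimp [hencode]
          exact ⟨by simpa using hw, by simp at ht'; omega⟩

/-! ## Strips -/

/-- `Box.slab` overwrites sides instead of intersecting, which is why the bounds are needed;
`massBox` clips and needs none. -/
theorem Box.slab_toSet {r : Box} {d : ℕ} {a b : EReal} (ha : r.lo d ≤ a) (hb : b ≤ r.hi d) :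
    (r.slab d a b).toSet =
      r.toSet ∩ {q | a < (coordAt d q : EReal) ∧ (coordAt d q : EReal) ≤ b} := by
  ext q
  by_cases h : Even d
  · simp only [slab, toSet, coordAt, h, lo, hi, if_true, Set.mem_ofPred_eq, Set.mem_inter_iff]
      at ha hb ⊢
    constructor
    · rintro ⟨h1, h2, h3, h4⟩
      exact ⟨⟨ha.trans_lt h1, h2.trans hb, h3, h4⟩, h1, h2⟩
    · rintro ⟨⟨h1, h2, h3, h4⟩, h5, h6⟩
      exact ⟨h5, h6, h3, h4⟩
  · simp only [slab, toSet, coordAt, h, lo, hi, if_false, Set.mem_ofPred_eq, Set.mem_inter_iff]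
      at ha hb ⊢
    constructor
    · rintro ⟨h3, h4, h1, h2⟩
      exact ⟨⟨h3, h4, ha.trans_lt h1, h2.trans hb⟩, h1, h2⟩
    · rintro ⟨⟨h3, h4, h1, h2⟩, h5, h6⟩
      exact ⟨h3, h4, h5, h6⟩

theorem Box.mem_bounds {r : Box} {d : ℕ} {q : Pt} (h : q ∈ r.toSet) :
    r.lo d < (coordAt d q : EReal) ∧ (coordAt d q : EReal) ≤ r.hi d := by
  obtain ⟨h1, h2, h3, h4⟩ := h
  by_cases h : Even d
  · simp only [coordAt, h, lo, hi, if_true]; exact ⟨h1, h2⟩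
  · simp only [coordAt, h, lo, hi, if_false]; exact ⟨h3, h4⟩

theorem mem_inter {S : Finset Pt} {A : Set Pt} {p : Pt} : p ∈ inter S A ↔ p ∈ S ∧ p ∈ A := by
  classical
  simp [inter]

theorem IsStrip.bounds {S : Finset Pt} {D : Measure Pt} {d : ℕ} {r : Box} {a b : EReal}
    (h : IsStrip S D d r a b) :
    r.lo d ≤ a ∧ a < b ∧ b ≤ r.hi d := by
  obtain ⟨h1, h2, h3, -⟩ := h
  refine ⟨?_, h1, ?_⟩
  · rcases h2 with rfl | ⟨p, hp, rfl⟩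
    · exact le_rfl
    · exact (Box.mem_bounds (mem_inter.1 hp).2).1.le
  · rcases h3 with rfl | ⟨p, hp, rfl⟩
    · exact le_rfl
    · exact (Box.mem_bounds (mem_inter.1 hp).2).2

/-- The sorted points are scanned, `a` being the last line passed. If less than half of the mass
lies beyond the next line, the strip ends there. Otherwise at most half lies before that line, and
the invariant holds with the line as new `a`. The last two hypotheses make the result non-empty: at
probability 0 a further line exists and the scan stops at the first one, and at positive probability
`a` stays before the end of the region. -/
theorem findStrip_spec {S : Finset Pt} {D : Measure Pt} [IsProbabilityMeasure D] (d : ℕ)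
    (r : Box) : ∀ (A pre : List Pt) (a : EReal),
    (∀ p, p ∈ pre ++ A ↔ p ∈ inter S r.toSet) →
    (pre ++ A).Pairwise (fun p q => coordAt d p ≤ coordAt d q) →
    (a = r.lo d ∨ ∃ p ∈ inter S r.toSet, (coordAt d p : EReal) = a) →
    (∀ p ∈ pre, (coordAt d p : EReal) ≤ a) → (∀ p ∈ A, a ≤ (coordAt d p : EReal)) →
    D.real (r.slab d (r.lo d) a).toSet ≤ D.real r.toSet / 2 →
    (D.real r.toSet ≤ 0 → ∃ p ∈ A, a < (coordAt d p : EReal)) →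
    (0 < D.real r.toSet → a < r.hi d) →
    Spec (oracle D) buildProgram fFindStrip (.tuple [flag d, encodeBox r, .num (D.real r.toSet),
      .coord a, .coord (r.hi d), encodePts A]) fun w t =>
      ∃ a b, w = .pair (.coord a) (.coord b) ∧ IsStrip S D d r a b ∧ t ≤ 300 * A.length + 60 := by
  intro A
  induction A with
  | nil =>
    intro pre a hmem hsort ha hpre _ hlo h0 h1
    apply Spec.intro (body := findStripBody) rfl
    dsimp [findStripBody, encodePts]
    -- The list can run out only at positive probability; the final strip then reaches the end of
    -- the region and has nothing after it.
    have hP : 0 < D.real r.toSet := by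
      by_contra h
      simpa using h0 (not_lt.1 h)
    refine ⟨a, _, rfl, ⟨h1 hP, ha, .inl rfl, ?_, hlo, .inl ?_⟩, by omega⟩
    · intro p hp
      exact .inl (hpre p (by simpa using (hmem p).2 hp))
    · have hle : r.lo d ≤ r.hi d := by
        rcases ha with rfl | ⟨p, hp, rfl⟩
        · exact (h1 hP).le
        · have := Box.mem_bounds (d := d) (mem_inter.1 hp).2
          exact this.1.le.trans this.2
      have : (r.slab d (r.hi d) (r.hi d)).toSet = ∅ := by
        rw [Box.slab_toSet hle le_rfl]
        ext q
        simp only [Set.mem_inter_iff, Set.mem_ofPred_eq, Set.mem_empty_iff_false, iff_false]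
        rintro ⟨-, h2, h3⟩
        exact absurd h2 (not_lt.2 h3)
      rw [this]
      simpa using hP
  | cons p A ih =>
    intro pre a hmem hsort ha hpre hA hlo h0 h1
    have hp : p ∈ inter S r.toSet := (hmem p).1 (by simp)
    have hpb := Box.mem_bounds (d := d) (mem_inter.1 hp).2
    have hpA : ∀ q ∈ A, coordAt d p ≤ coordAt d q := fun q hq =>
      List.rel_of_pairwise_cons (List.pairwise_append.1 hsort).2.1 hq
    have hpre' : ∀ q ∈ pre, coordAt d q ≤ coordAt d p := fun q hq =>
      (List.pairwise_append.1 hsort).2.2 q hq p (by simp)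
    have hmem' : ∀ q, q ∈ (pre ++ [p]) ++ A ↔ q ∈ inter S r.toSet := by simpa using hmem
    have hsort' : ((pre ++ [p]) ++ A).Pairwise fun p q => coordAt d p ≤ coordAt d q := by
      simpa using hsort
    have halo : r.lo d ≤ a := by
      rcases ha with rfl | ⟨p, hp, rfl⟩
      · exact le_rfl
      · exact (Box.mem_bounds (mem_inter.1 hp).2).1.le
    apply Spec.intro (body := findStripBody) rfl
    dsimp [findStripBody, encodePts]
    rw [wp_selBody_pt]
    dsimp
    by_cases hk : (coordAt d p : EReal) ≤ a
    · rw [if_pos hk]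
      have hpa : (coordAt d p : EReal) = a := le_antisymm hk (hA p (by simp))
      refine (ih (pre ++ [p]) a hmem' hsort' ha ?_ (fun q hq => hA q (by simp [hq])) hlo ?_ h1).mono
        ?_
      · intro q hq
        rcases List.mem_append.1 hq with hq | hq
        · exact hpre q hq
        · rw [List.mem_singleton.1 hq]; exact hk
      · intro h
        obtain ⟨q, hq, hq'⟩ := h0 h
        rcases List.mem_cons.1 hq with rfl | hq
        · exact absurd hq' (not_lt.2 hk)
        · exact ⟨q, hq, hq'⟩
      · rintro w t ⟨a', b', rfl, h2, ht⟩
        exact ⟨a', b', rfl, h2, by omega⟩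
    · rw [if_neg hk]
      have hk' := not_le.1 hk
      refine (mass_spec d r (coordAt d p) (r.hi d)).mono ?_
      rintro w t ⟨rfl, ht⟩
      dsimp
      have hmass : oracle D (massBox d r (coordAt d p) (r.hi d)) =
          D.real (r.slab d (coordAt d p) (r.hi d)).toSet := by
        rw [oracle, massBox_toSet, Box.slab_toSet hpb.1.le le_rfl]
      have hsum : D.real (r.slab d (r.lo d) (coordAt d p)).toSet +
          D.real (r.slab d (coordAt d p) (r.hi d)).toSet = D.real r.toSet := by
        rw [← measureReal_union ?_ (Box.measurableSet_toSet _)]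
        · congr 1
          rw [Box.slab_toSet le_rfl hpb.2, Box.slab_toSet hpb.1.le le_rfl]
          ext q
          simp only [Set.mem_union, Set.mem_inter_iff, Set.mem_ofPred_eq]
          constructor
          · rintro (h | h) <;> exact h.1
          · intro h
            have h2 := Box.mem_bounds (d := d) h
            rcases le_or_gt (coordAt d q : EReal) (coordAt d p) with h3 | h3
            · exact .inl ⟨h, h2.1, h3⟩
            · exact .inr ⟨h, h3, h2.2⟩
        · rw [Box.slab_toSet le_rfl hpb.2, Box.slab_toSet hpb.1.le le_rfl, Set.disjoint_left]
          rintro q ⟨-, -, h2⟩ ⟨-, h3, -⟩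
          exact absurd h3 (not_lt.2 h2)
      have hstrip : (D.real (r.slab d (coordAt d p) (r.hi d)).toSet < D.real r.toSet / 2 ∨
          D.real r.toSet = 0) → IsStrip S D d r a (coordAt d p) := by
        intro h
        refine ⟨hk', ha, .inr ⟨p, hp, rfl⟩, ?_, hlo, h⟩
        intro q hq
        rcases List.mem_append.1 ((hmem q).2 hq) with hq | hq
        · exact .inl (hpre q hq)
        · right
          rcases List.mem_cons.1 hq with rfl | hq
          · exact le_rfl
          · exact EReal.coe_le_coe_iff.2 (hpA q hq)
      rw [hmass]
      by_cases h2 : D.real r.toSet ≤ D.real (r.slab d (coordAt d p) (r.hi d)).toSet +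
          D.real (r.slab d (coordAt d p) (r.hi d)).toSet
      on_goal 1 => rw [if_pos h2]
      on_goal 1 => by_cases h3 : D.real r.toSet ≤ ((0 : ℤ) : ℝ)
      · rw [if_pos h3]
        exact ⟨_, _, rfl, hstrip (.inr (le_antisymm (by simpa using h3) measureReal_nonneg)),
          by omega⟩
      · rw [if_neg h3]
        simp only [Int.cast_zero, not_le] at h3
        refine (ih (pre ++ [p]) (coordAt d p) hmem' hsort' (.inr ⟨p, hp, rfl⟩) ?_
          (fun q hq => EReal.coe_le_coe_iff.2 (hpA q hq)) ?_ (fun h => absurd h (not_le.2 h3))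
          fun _ => ?_).mono ?_
        · intro q hq
          rcases List.mem_append.1 hq with hq | hq
          · exact EReal.coe_le_coe_iff.2 (hpre' q hq)
          · rw [List.mem_singleton.1 hq]
        · linarith
        · by_contra h4
          have h5 : (coordAt d p : EReal) = r.hi d := le_antisymm hpb.2 (not_lt.1 h4)
          have h6 : (r.slab d (coordAt d p) (r.hi d)).toSet = ∅ := by
            rw [Box.slab_toSet hpb.1.le le_rfl]
            ext q
            simp only [Set.mem_inter_iff, Set.mem_ofPred_eq, Set.mem_empty_iff_false, iff_false]
            rintro ⟨-, h7, h8⟩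
            rw [h5] at h7
            exact absurd h7 (not_lt.2 h8)
          rw [h6, measureReal_empty] at h2
          linarith
        · rintro w t ⟨a', b', rfl, h2, ht⟩
          exact ⟨a', b', rfl, h2, by omega⟩
      · rw [if_neg h2]
        exact ⟨_, _, rfl, hstrip (.inl (by linarith)), by omega⟩

theorem slab_spec {O : Box → ℝ} (d : ℕ) (r : Box) (a b : EReal) :
    Spec O buildProgram fSlab (.tuple [flag d, encodeBox r, .pair (.coord a) (.coord b)])
      fun v t => v = encodeBox (r.slab d a b) ∧ t ≤ 40 := by
  apply Spec.intro (body := slabBody) rfl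
  by_cases h : Even d
  · rw [flag_even h, Box.slab, if_pos h]
    dsimp [slabBody, encodeBox]
    exact ⟨rfl, by omega⟩
  · rw [flag_odd h, Box.slab, if_neg h]
    dsimp [slabBody, encodeBox]
    exact ⟨rfl, by omega⟩

theorem sides_spec {O : Box → ℝ} (d : ℕ) (r : Box) :
    Spec O buildProgram fSides (.tuple [flag d, encodeBox r])
      fun v t => v = .pair (.coord (r.lo d)) (.coord (r.hi d)) ∧ t ≤ 40 := by
  apply Spec.intro (body := sidesBody) rfl
  by_cases h : Even d
  · rw [flag_even h, Box.lo, if_pos h, Box.hi, if_pos h]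
    dsimp [sidesBody, encodeBox]
    exact ⟨rfl, by omega⟩
  · rw [flag_odd h, Box.lo, if_neg h, Box.hi, if_neg h]
    dsimp [sidesBody, encodeBox]
    exact ⟨rfl, by omega⟩

theorem flip_spec {O : Box → ℝ} (d : ℕ) :
    Spec O buildProgram fFlip (flag d) fun v t => v = flag (d + 1) ∧ t ≤ 40 := by
  apply Spec.intro (body := flipBody) rfl
  by_cases h : Even d
  · rw [flag_even h, flag_odd (by simpa [Nat.even_add_one] using h)]
    dsimp [flipBody]
    exact ⟨rfl, by omega⟩
  · rw [flag_odd h, flag_even (by simpa [Nat.even_add_one] using h)]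
    dsimp [flipBody]
    exact ⟨rfl, by omega⟩

theorem pick_spec {O : Box → ℝ} (d : ℕ) (L : List Pt) :
    Spec O buildProgram fPick (.tuple [flag d, encodePts L])
      fun v t => v = encodePts (if Even d then [] else L) ∧ t ≤ 40 := by
  apply Spec.intro (body := pickBody) rfl
  by_cases h : Even d
  · rw [flag_even h, if_pos h]
    dsimp [pickBody, encodePts]
    exact ⟨rfl, by omega⟩
  · rw [flag_odd h, if_neg h]
    dsimp [pickBody]
    exact ⟨rfl, by omega⟩

/-! ## Nodes -/

/-- `v` represents the node `x` whose ancestors have the catalogues `cx` and `cy`; the sizes of its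
search depths are bounded by `B`. -/
def Node.Built (B : ℕ) (x : Node) (cx cy : List (List Entry)) (aux v : Val) : Prop :=
  ∃ vcx vcy vtx vty, v = .pair (.pair (encodeBox x.region) (encodeBox x.strip))
      (.pair (.pair (.pair vcx vtx) (.pair vcy vty)) aux) ∧
    RepList encodeEntry x.catX vcx ∧ RepList encodeEntry x.catY vcy ∧
    x.idxX.Finds (GapHandle encodeEntry (CatalogueNote 0 cx) (fun e => e.1.1) x.catX) ⊥ ⊤ vtx ∧
    x.idxY.Finds (GapHandle encodeEntry (CatalogueNote 1 cy) (fun e => e.1.2) x.catY) ⊥ ⊤ vty ∧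
    (∀ z, 2 ^ x.idxX.searchDepth z ≤ B) ∧ ∀ z, 2 ^ x.idxY.searchDepth z ≤ B

theorem Node.Built.rep {B : ℕ} {x : Node} {cx cy : List (List Entry)} {aux v : Val}
    (h : x.Built B cx cy aux v) : x.Rep v := by
  obtain ⟨vcx, vcy, vtx, vty, rfl, h1, h2, h3, h4, -⟩ := h
  exact ⟨_, _, _, _, _, rfl, h1, h2, h3.rep, h4.rep⟩

def encodeOption : Option Box → Val
  | none => .nil
  | some w => encodeBox w

@[simp] theorem casePair_encodeBox (w : Box) (K K' : Prop) :
    (encodeBox w).casePair K K' = K := rfl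

theorem node_spec {D : Measure Pt} [IsProbabilityMeasure D] {r s : Box} {w : Option Box}
    {Cx Cy : Finset Pt} {pX pY catX catY : List Entry} {cx cy : List (List Entry)} {hX hY aux : Val}
    {B : ℕ} (h1 : IsCatalogue Prod.fst Cx pX catX) (h2 : IsCatalogue Prod.snd Cy pY catY)
    (h3 : HandleTo encodeEntry (CatalogueNote 0 cx) [] catX hX)
    (h4 : HandleTo encodeEntry (CatalogueNote 1 cy) [] catY hY)
    (hBX : 8 * (catX.length + 1) ≤ B) (hBY : 8 * (catY.length + 1) ≤ B) :
    Spec (oracle D) buildProgram fNode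
      (.tuple [encodeBox r, encodeBox s, encodeOption w, hX, hY, aux]) fun v t =>
      ∃ x : Node, x.WellFormed 3 D r s (w.getD s) Cx Cy pX pY ∧ x.catX = catX ∧ x.catY = catY ∧
        x.Built B cx cy aux v ∧ t ≤ 3000 * (catX.length + catY.length) + 7000 := by
  obtain ⟨vX, xX, hXe, -, hrX⟩ := h3.pair
  obtain ⟨vY, xY, hYe, -, hrY⟩ := h4.pair
  have iX (b : Box) := index_spec (D := D) (w := b) (enc := encodeEntry) (d := 0)
    (key := fun e => e.1.1) (n := 11) le_rfl (fun e env Q => wp_selBody_entry e 0 env Q) h1.1 h3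
  have iY (b : Box) := index_spec (D := D) (w := b) (enc := encodeEntry) (d := 1)
    (key := fun e => e.1.2) (n := 11) le_rfl
    (fun e env Q => by rw [wp_selBody_entry, coordAt_one]) h2.1 h4
  rw [flag_even Even.zero] at iX
  rw [flag_odd Nat.not_even_one] at iY
  apply Spec.intro (body := nodeBody) rfl
  rcases w with _ | w
  all_goals
    dsimp [nodeBody, encodeOption]
    refine (iX _).mono ?_
    rintro vtx t₁ ⟨TX, hX1, hX2, hX3, ht₁⟩
    refine (iY _).mono ?_
    rintro vty t₂ ⟨TY, hY1, hY2, hY3, ht₂⟩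
    subst hXe hYe
    dsimp
    rw [coordAt_one] at hY1
    exact ⟨⟨r, s, catX, catY, TX, TY⟩, ⟨rfl, rfl, h1, h2, hX1, hY1⟩, rfl, rfl,
      ⟨_, _, _, _, rfl, hrX, hrY, hX2, hY2, fun z => (hX3 z).trans hBX,
        fun z => (hY3 z).trans hBY⟩, by omega⟩

/-! ## The primary tree -/

/-- `v` represents the tree together with the pointers of fractional cascading; `cx` and `cy` are
the catalogues of the ancestors of its root. -/
def PrimaryTree.Built (S : Finset Pt) (B : ℕ) :
    PrimaryTree → List (List Entry) → List (List Entry) → Val → Prop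
  | .leaf x, cx, cy, v => ∃ vx A, v = .pair .nil vx ∧ x.Built B cx cy (encodePts A) vx ∧
      (A ≠ [] ↔ (inter S x.region.toSet).Nonempty)
  | .split x l r, cx, cy, v => ∃ aux vx vl vr, v = .pair (.pair vl vr) vx ∧ x.Built B cx cy aux vx ∧
      l.Built S B (x.catX :: cx) (x.catY :: cy) vl ∧ r.Built S B (x.catX :: cx) (x.catY :: cy) vr

theorem PrimaryTree.Built.rep {S : Finset Pt} {B : ℕ} {T : PrimaryTree} :
    ∀ {cx cy : List (List Entry)} {v : Val}, T.Built S B cx cy v → T.Rep v := by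
  induction T with
  | leaf x =>
    rintro cx cy v ⟨vx, A, rfl, h, -⟩
    exact ⟨_, rfl, h.rep⟩
  | split x l r ihl ihr =>
    rintro cx cy v ⟨aux, vx, vl, vr, rfl, h, hl, hr⟩
    exact ⟨_, _, _, rfl, h.rep, ihl hl, ihr hr⟩

theorem casePair_encodePts_cons {L : List Pt} (h : L ≠ []) (K K' : Prop) :
    (encodePts L).casePair K K' = K := by
  cases L with
  | nil => exact absurd rfl h
  | cons => rfl

theorem perm_toList {L : List Pt} {C : Finset Pt} (hL : L.Nodup) (h : ∀ p, p ∈ L ↔ p ∈ C) :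
    L.Perm C.toList :=
  (List.perm_ext_iff_of_nodup hL C.nodup_toList).2 fun p => by rw [h, Finset.mem_toList]

theorem isCatalogue_cascadeAt {d : ℕ} {own : List Pt} {C : Finset Pt} {pp parent : List Entry}
    {C' : Finset Pt} (hperm : own.Perm C.toList)
    (ho : own.Pairwise fun p q => coordAt d p ≤ coordAt d q)
    (hp : IsCatalogue (coordAt d) C' pp parent) :
    IsCatalogue (coordAt d) C parent (cascadeAt d own parent) :=
  ⟨cascadeAt_pairwise ho hp.1, (cascadeAt_perm d own parent).trans
    ((hperm.map _).append_right _)⟩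

theorem cascadeAt_length (d : ℕ) (own : List Pt) (parent : List Entry) :
    (cascadeAt d own parent).length = own.length + (everyFourth parent).length := by
  simpa using (cascadeAt_perm d own parent).length_eq

/-- A leaf arises from an empty region or from reaching the maximal depth. Its point list is kept in
the auxiliary field, so that the query can recognise a bad leaf. -/
theorem primary_leaf_spec {D : Measure Pt} [IsProbabilityMeasure D] {S : Finset Pt} {d n : ℕ}
    {r : Box} {w : Option Box} {A B : List Pt} {Cx Cy : Finset Pt} {pX pY catX catY : List Entry}
    {cx cy : List (List Entry)} {hX hY : Val} (hn : S.card = n)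
    (hA : ∀ p, p ∈ A ↔ p ∈ inter S r.toSet) (h1 : IsCatalogue Prod.fst Cx pX catX)
    (h2 : IsCatalogue Prod.snd Cy pY catY)
    (h3 : HandleTo encodeEntry (CatalogueNote 0 cx) [] catX hX)
    (h4 : HandleTo encodeEntry (CatalogueNote 1 cy) [] catY hY)
    (hlX : catX.length ≤ 2 * n) (hlY : catY.length ≤ 2 * n)
    (hleaf : A = [] ∨ n ≤ 2 ^ d) :
    Spec (oracle D) buildProgram fPrimary (.tuple [flag d, encodeBox r, encodePts A, encodePts B,
      .num (2 ^ d), .num n, encodeOption w, hX, hY]) fun v t =>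
      ∃ T : PrimaryTree, T.WellFormed 3 S D d r w Cx Cy pX pY ∧ T.root.catX = catX ∧
        T.root.catY = catY ∧ T.Built S (8 * (2 * n + 1)) cx cy v ∧
        t ≤ 3000 * (catX.length + catY.length) + 7100 := by
  have hne : A ≠ [] ↔ (inter S r.toSet).Nonempty := by
    constructor
    · intro h
      obtain ⟨p, hp⟩ := List.exists_mem_of_ne_nil A h
      exact ⟨p, (hA p).1 hp⟩
    · rintro ⟨p, hp⟩ rfl
      simpa using (hA p).2 hp
  have key : Spec (oracle D) buildProgram fNode
      (.tuple [encodeBox r, encodeBox r, encodeOption w, hX, hY, encodePts A]) fun vx t =>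
      ∃ T : PrimaryTree, T.WellFormed 3 S D d r w Cx Cy pX pY ∧ T.root.catX = catX ∧
        T.root.catY = catY ∧ T.Built S (8 * (2 * n + 1)) cx cy (.pair .nil vx) ∧
        t ≤ 3000 * (catX.length + catY.length) + 7000 := by
    refine (node_spec h1 h2 h3 h4 (B := 8 * (2 * n + 1)) (by omega) (by omega)).mono ?_
    rintro vx t ⟨x, hx, hx1, hx2, hx3, ht⟩
    refine ⟨.leaf x, ⟨?_, hx⟩, hx1, hx2, ⟨vx, A, rfl, hx3, ?_⟩, ht⟩
    · rintro ⟨h5, h6⟩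
      rcases hleaf with h | h
      · exact hne.2 h5 h
      · rw [Nat.lt_clog_iff_pow_lt (by norm_num), hn] at h6
        omega
    · rw [hx.1]; exact hne
  apply Spec.intro (body := primaryBody) rfl
  dsimp [primaryBody]
  by_cases h : A = []
  · subst h
    dsimp [encodePts]
    refine key.mono ?_
    rintro vx t ⟨T, h1, h2, h3, h4, ht⟩
    exact ⟨T, h1, h2, h3, h4, by omega⟩
  · have h5 : n ≤ 2 ^ d := hleaf.resolve_left h
    rw [casePair_encodePts_cons h, if_pos (by exact_mod_cast h5)]
    refine key.mono ?_
    rintro vx t ⟨T, h1, h2, h3, h4, ht⟩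
    exact ⟨T, h1, h2, h3, h4, by omega⟩

theorem coordAt_add_two (d : ℕ) : coordAt (d + 1 + 1) = coordAt d := by
  funext p
  simp [coordAt, Nat.even_add_one]

theorem coordAt_of_even {d : ℕ} (h : Even d) : coordAt d = coordAt 0 := by
  funext p
  simp [coordAt, h]

theorem coordAt_of_odd {d : ℕ} (h : ¬ Even d) : coordAt d = coordAt 1 := by
  funext p
  simp [coordAt, h]

/-- Here `m` is the number of remaining levels. Let `K` be the combined length of both catalogues.
Those of the two children together have at most `A.length + K / 2` entries, so their share of the
potential is at most `2 * A.length + K`. Together with the loss of one level in `3 * (A.length * (m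
+ 1))`, this leaves `K + A.length`, and a constant, to pay for the index trees, filters and merges
of the node. The power of two pays for the nodes. The bounds `2 * n` persist since `n + 2 * n / 4 ≤
2 * n`. -/
theorem primary_spec {D : Measure Pt} [IsProbabilityMeasure D] {S : Finset Pt} {n : ℕ}
    (hn : S.card = n) : ∀ (m d : ℕ) (r : Box) (w : Option Box) (A B : List Pt) (Cx Cy : Finset Pt)
    (pX pY catX catY : List Entry) (cx cy : List (List Entry)) (hX hY : Val),
    d + m = Nat.clog 2 n →
    (∀ p, p ∈ A ↔ p ∈ inter S r.toSet) → A.Nodup →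
    A.Pairwise (fun p q => coordAt d p ≤ coordAt d q) →
    B.Perm A → B.Pairwise (fun p q => coordAt (d + 1) p ≤ coordAt (d + 1) q) →
    IsCatalogue Prod.fst Cx pX catX → IsCatalogue Prod.snd Cy pY catY →
    HandleTo encodeEntry (CatalogueNote 0 cx) [] catX hX →
    HandleTo encodeEntry (CatalogueNote 1 cy) [] catY hY →
    catX.length ≤ 2 * n → catY.length ≤ 2 * n →
    Spec (oracle D) buildProgram fPrimary (.tuple [flag d, encodeBox r, encodePts A, encodePts B,
      .num (2 ^ d), .num n, encodeOption w, hX, hY]) fun v t =>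
      ∃ T : PrimaryTree, T.WellFormed 3 S D d r w Cx Cy pX pY ∧ T.root.catX = catX ∧
        T.root.catY = catY ∧ T.Built S (8 * (2 * n + 1)) cx cy v ∧
        t + 11000 ≤ 11000 *
          (2 * (catX.length + catY.length) + 3 * (A.length * (m + 1)) + 2 ^ (m + 1)) := by
  intro m
  induction m with
  | zero =>
    intro d r w A B Cx Cy pX pY catX catY cx cy hX hY hd hA hnd hsA hBA hsB h1 h2 h3 h4 hlX hlY
    refine (primary_leaf_spec hn hA h1 h2 h3 h4 hlX hlY (.inr ?_)).mono ?_
    · rw [← Nat.clog_le_iff_le_pow (by norm_num)]; omega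
    · rintro v t ⟨T, h1, h2, h3, h4, ht⟩
      exact ⟨T, h1, h2, h3, h4, by omega⟩
  | succ m ih =>
    intro d r w A B Cx Cy pX pY catX catY cx cy hX hY hd hA hnd hsA hBA hsB h1 h2 h3 h4 hlX hlY
    by_cases hA0 : A = []
    · refine (primary_leaf_spec hn hA h1 h2 h3 h4 hlX hlY (.inl hA0)).mono ?_
      rintro v t ⟨T, h1, h2, h3, h4, ht⟩
      have : 2 ≤ 2 ^ (m + 1 + 1) := by rw [pow_succ]; have := Nat.one_le_two_pow (n := m + 1); omega
      exact ⟨T, h1, h2, h3, h4, by omega⟩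
    have hlt : 2 ^ d < n := by
      rw [← Nat.lt_clog_iff_pow_lt (by norm_num)]; omega
    obtain ⟨p₀, hp₀⟩ := List.exists_mem_of_ne_nil A hA0
    have hb₀ := Box.mem_bounds (d := d) (mem_inter.1 ((hA p₀).1 hp₀)).2
    have hlohi := hb₀.1.trans_le hb₀.2
    have h1' : IsCatalogue (coordAt 0) Cx pX catX := h1
    have h2' : IsCatalogue (coordAt 1) Cy pY catY := by rw [coordAt_one]; exact h2
    have hBn : B.Nodup := hBA.symm.nodup hnd
    have hB : ∀ p, p ∈ B ↔ p ∈ inter S r.toSet := fun p => by rw [hBA.mem_iff, hA]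
    have hAn : A.length ≤ n := by
      rw [(perm_toList hnd hA).length_eq, Finset.length_toList, ← hn]
      exact Finset.card_le_card (by classical exact Finset.filter_subset _ _)
    have hdouble : (2 : ℝ) ^ d + 2 ^ d = 2 ^ (d + 1) := by ring
    apply Spec.intro (body := primaryBody) rfl
    dsimp [primaryBody]
    rw [casePair_encodePts_cons hA0, if_neg (by
      rw [not_le]; exact_mod_cast hlt)]
    refine (sides_spec d r).mono ?_
    rintro v t₁ ⟨rfl, ht₁⟩
    refine (flip_spec d).mono ?_
    rintro v t₂ ⟨rfl, ht₂⟩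
    dsimp
    refine (findStrip_spec (D := D) (S := S) d r A [] (r.lo d) (by simpa using hA)
      (by simpa using hsA) (.inl rfl) (by simp)
      (fun p hp => (Box.mem_bounds (mem_inter.1 ((hA p).1 hp)).2).1.le) ?_
      (fun _ => ⟨p₀, hp₀, hb₀.1⟩) (fun _ => hlohi)).mono ?_
    · rw [Box.slab_toSet le_rfl hlohi.le]
      have : r.toSet ∩ {q | r.lo d < (coordAt d q : EReal) ∧ (coordAt d q : EReal) ≤ r.lo d} = ∅ := by
        ext q
        simp only [Set.mem_inter_iff, Set.mem_ofPred_eq, Set.mem_empty_iff_false, iff_false]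
        rintro ⟨-, h7, h8⟩
        exact absurd h7 (not_lt.2 h8)
      rw [this, measureReal_empty]
      positivity
    rintro v t₃ ⟨a, b, rfl, hab, ht₃⟩
    dsimp
    obtain ⟨hba, hbl, hbb⟩ := hab.bounds
    refine (slab_spec d r a b).mono ?_
    rintro v t₄ ⟨rfl, ht₄⟩
    refine (node_spec (D := D) (r := r) (s := r.slab d a b) (w := w) (aux := .nil) h1 h2 h3 h4
      (B := 8 * (2 * n + 1)) (by omega) (by omega)).mono ?_
    rintro vx t₅ ⟨x, hx, rfl, rfl, hxB, ht₅⟩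
    refine (filterGt_spec d a B).mono ?_
    rintro v t₆ ⟨rfl, ht₆⟩
    set G := B.filter fun p => a < (coordAt d p : EReal) with hG
    have hGsub : G.Sublist B := List.filter_sublist
    have hGl : G.length ≤ A.length := hBA.length_eq ▸ hGsub.length_le
    have hGperm : G.Perm
        (inter S ((r.slab d a b).toSet ∪ (r.slab d b (r.hi d)).toSet)).toList := by
      refine perm_toList (hBn.sublist hGsub) fun p => ?_
      rw [hG, List.mem_filter, hB, mem_inter, mem_inter, decide_eq_true_eq, and_assoc,
        Box.slab_toSet hba hbb, Box.slab_toSet (hba.trans hbl.le) le_rfl]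
      refine and_congr_right fun _ => ?_
      simp only [Set.mem_union, Set.mem_inter_iff, Set.mem_ofPred_eq]
      constructor
      · rintro ⟨h5, h6⟩
        rcases le_or_gt (coordAt d p : EReal) b with h7 | h7
        · exact .inl ⟨h5, h6, h7⟩
        · exact .inr ⟨h5, h7, (Box.mem_bounds h5).2⟩
      · rintro (h5 | h5)
        · exact ⟨h5.1, h5.2.1⟩
        · exact ⟨h5.1, hbl.trans h5.2.1⟩
    have hGs := hsB.sublist hGsub
    set ownX := if Even d then [] else G with hownX
    set ownY := if Even (d + 1) then [] else G with hownY
    set CX := if Even d then ∅ else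
      inter S ((r.slab d a b).toSet ∪ (r.slab d b (r.hi d)).toSet) with hCX
    set CY := if Even d then
      inter S ((r.slab d a b).toSet ∪ (r.slab d b (r.hi d)).toSet) else ∅ with hCY
    have hXp : ownX.Perm CX.toList := by
      rw [hownX, hCX]; split_ifs
      · simp
      · exact hGperm
    have hYp : ownY.Perm CY.toList := by
      rw [hownY, hCY]
      simp only [Nat.even_add_one, ite_not]
      split_ifs
      · exact hGperm
      · simp
    have hXs : ownX.Pairwise fun p q => coordAt 0 p ≤ coordAt 0 q := by
      rw [hownX]; split_ifs with he
      · exact .nil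
      · rwa [coordAt_of_even (by simpa [Nat.even_add_one] using he)] at hGs
    have hYs : ownY.Pairwise fun p q => coordAt 1 p ≤ coordAt 1 q := by
      rw [hownY]; split_ifs with he
      · exact .nil
      · rwa [coordAt_of_odd he] at hGs
    have hown : ownX.length + ownY.length ≤ A.length := by
      rw [hownX, hownY]
      simp only [Nat.even_add_one, ite_not]
      split_ifs <;> simpa using hGl
    have cX (own : List Pt) := cascade_spec (O := oracle D) 0 cx h1'.1 _ own [] [] x.catX hX le_rfl
      rfl (by simp) h3
    have cY (own : List Pt) := cascade_spec (O := oracle D) 1 cy h2'.1 _ own [] [] x.catY hY le_rfl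
      rfl (by simp) h4
    rw [flag_even Even.zero] at cX
    rw [flag_odd Nat.not_even_one] at cY
    have fourthX := everyFourth_length x.catX
    have fourthY := everyFourth_length x.catY
    -- the left child
    refine (slab_spec d r (r.lo d) a).mono ?_
    rintro v t₇ ⟨rfl, ht₇⟩
    refine (filterLe_spec d a B).mono ?_
    rintro v t₈ ⟨rfl, ht₈⟩
    refine (filterLe_spec d a A).mono ?_
    rintro v t₉ ⟨rfl, ht₉⟩
    refine (pick_spec d G).mono ?_
    rintro v t₁₀ ⟨rfl, ht₁₀⟩
    refine (cX ownX).mono ?_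
    rintro hX₁ t₁₁ ⟨hhX₁, ht₁₁⟩
    refine (pick_spec (d + 1) G).mono ?_
    rintro v t₁₂ ⟨rfl, ht₁₂⟩
    refine (cY ownY).mono ?_
    rintro hY₁ t₁₃ ⟨hhY₁, ht₁₃⟩
    rw [hdouble]
    refine (ih (d + 1) (r.slab d (r.lo d) a) (some (r.slab d a b))
      (B.filter fun p => (coordAt d p : EReal) ≤ a) (A.filter fun p => (coordAt d p : EReal) ≤ a)
      CX CY x.catX x.catY _ _ _ _ hX₁ hY₁ (by omega) ?_ (hBn.filter _)
      (hsB.sublist List.filter_sublist) (hBA.symm.filter _) ?_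
      (isCatalogue_cascadeAt hXp hXs h1')
      (by have := isCatalogue_cascadeAt hYp hYs h2'; rwa [coordAt_one] at this) hhX₁ hhY₁
      (by rw [cascadeAt_length]; omega) (by rw [cascadeAt_length]; omega)).mono ?_
    · intro p
      rw [List.mem_filter, hB, mem_inter, mem_inter, Box.slab_toSet le_rfl (hbl.le.trans hbb),
        decide_eq_true_eq, and_assoc]
      refine and_congr_right fun _ => ?_
      constructor
      · rintro ⟨h5, h6⟩
        exact ⟨h5, (Box.mem_bounds h5).1, h6⟩
      · rintro ⟨h5, -, h6⟩
        exact ⟨h5, h6⟩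
    · rw [coordAt_add_two]
      exact hsA.sublist List.filter_sublist
    rintro v t₁₄ ⟨Tl, hTl, -, -, hTlB, ht₁₄⟩
    -- the right child
    refine (slab_spec d r b (r.hi d)).mono ?_
    rintro v t₁₅ ⟨rfl, ht₁₅⟩
    refine (filterGt_spec d b B).mono ?_
    rintro v t₁₆ ⟨rfl, ht₁₆⟩
    refine (filterGt_spec d b A).mono ?_
    rintro v t₁₇ ⟨rfl, ht₁₇⟩
    refine (cX []).mono ?_
    rintro hX₂ t₁₈ ⟨hhX₂, ht₁₈⟩
    refine (cY []).mono ?_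
    rintro hY₂ t₁₉ ⟨hhY₂, ht₁₉⟩
    refine (ih (d + 1) (r.slab d b (r.hi d)) none
      (B.filter fun p => b < (coordAt d p : EReal)) (A.filter fun p => b < (coordAt d p : EReal))
      ∅ ∅ x.catX x.catY _ _ _ _ hX₂ hY₂ (by omega) ?_ (hBn.filter _)
      (hsB.sublist List.filter_sublist) (hBA.symm.filter _) ?_
      (isCatalogue_cascadeAt (own := []) (by simp) .nil h1')
      (by
        have := isCatalogue_cascadeAt (own := []) (C := ∅) (by simp) .nil h2'
        rwa [coordAt_one] at this) hhX₂ hhY₂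
      (by rw [cascadeAt_length]; simp; omega) (by rw [cascadeAt_length]; simp; omega)).mono ?_
    · intro p
      rw [List.mem_filter, hB, mem_inter, mem_inter, Box.slab_toSet (hba.trans hbl.le) le_rfl,
        decide_eq_true_eq, and_assoc]
      refine and_congr_right fun _ => ?_
      constructor
      · rintro ⟨h5, h6⟩
        exact ⟨h5, h6, (Box.mem_bounds h5).2⟩
      · rintro ⟨h5, h6, -⟩
        exact ⟨h5, h6⟩
    · rw [coordAt_add_two]
      exact hsA.sublist List.filter_sublist
    rintro v t₂₀ ⟨Tr, hTr, -, -, hTrB, ht₂₀⟩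
    refine ⟨.split x Tl Tr, ⟨⟨⟨p₀, (hA p₀).1 hp₀⟩, ?_⟩, a, b, hab, hx, hTl, hTr⟩, rfl, rfl,
      ⟨_, _, _, _, rfl, hxB, hTlB, hTrB⟩, ?_⟩
    · rw [hn]; omega
    · simp only [cascadeAt_length, List.length_nil, zero_add] at *
      have hBl := hBA.length_eq
      have hsplit : (B.filter fun p => (coordAt d p : EReal) ≤ a).length +
          (B.filter fun p => b < (coordAt d p : EReal)).length ≤ B.length := by
        have h5 := List.length_eq_length_filter_add (l := B) fun p => (coordAt d p : EReal) ≤ a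
        have h6 : (B.filter fun p => b < (coordAt d p : EReal)).length ≤
            (B.filter fun p => !decide ((coordAt d p : EReal) ≤ a)).length := by
          refine (List.monotone_filter_right B fun p hp => ?_).length_le
          simp only [decide_eq_true_eq, Bool.not_eq_true', decide_eq_false_iff_not, not_le] at hp ⊢
          exact hbl.trans hp
        omega
      set al := (B.filter fun p => (coordAt d p : EReal) ≤ a).length
      set ar := (B.filter fun p => b < (coordAt d p : EReal)).length
      have e1 : al * (m + 1) + ar * (m + 1) ≤ A.length * (m + 1) := by
        rw [← add_mul]; exact Nat.mul_le_mul_right _ (by omega)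
      have e2 : A.length * (m + 1 + 1) = A.length * (m + 1) + A.length := by ring
      have e3 : 2 ^ (m + 1 + 1) = 2 * 2 ^ (m + 1) := by ring
      rw [e2, e3]
      omega

/-! ## The construction -/

/-- `out` is the output of the construction that represents `T`. -/
def BiasedRangeTree.Built (S : Finset Pt) (T : BiasedRangeTree) (out : Val) : Prop :=
  ∃ vb vp vi, out = .pair vb (.pair vp vi) ∧ T.backup.Rep vb ∧
    T.primary.Built S (8 * (2 * S.card + 1)) [] [] vp ∧
    ∃ I : STree, I.Finds (GapHandle encodePt (T.backup.Note 1) Prod.snd T.backup.list) ⊥ ⊤ vi ∧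
      ∀ z, 2 ^ I.searchDepth z ≤ 8 * (S.card + 1)

theorem mem_inter_plane {S : Finset Pt} {p : Pt} : p ∈ inter S Box.plane.toSet ↔ p ∈ S := by
  rw [mem_inter]
  simp [Box.plane, Box.toSet, EReal.bot_lt_coe, le_top]

/-- The first sort only provides the order by `x`; its tree is discarded. The second yields the
backup tree and the points ordered by `y`. Both orders are then maintained by filtering, so no
region is sorted again. For the index on the full `y`-list only the worst-case depth matters, not
its bias. -/
theorem build_spec {S : Finset Pt} {D : Measure Pt} [IsProbabilityMeasure D] {pts : List Pt}
    (hnd : pts.Nodup) (hmem : ∀ p, p ∈ pts ↔ p ∈ S) :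
    Spec (oracle D) buildProgram 0 (encodePts pts) fun out t =>
      ∃ T : BiasedRangeTree, T.IsFor 3 S D ∧ T.Built S out ∧
        t ≤ 40000 * (S.card * (Nat.clog 2 S.card + 1) + 2 ^ (Nat.clog 2 S.card + 1) + 1) := by
  have hperm : pts.Perm S.toList := perm_toList hnd hmem
  have hlen : pts.length = S.card := by rw [hperm.length_eq, Finset.length_toList]
  set n := S.card with hn
  set j := Nat.clog 2 n with hj
  have hnj : n ≤ 2 ^ j := Nat.le_pow_clog (by norm_num) n
  have sX := sort_spec (O := oracle D) 0 j pts (by omega)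
  have sY (L : List Pt) (hL : L.length ≤ 2 ^ j) := sort_spec (O := oracle D) 1 j L hL
  rw [flag_even Even.zero] at sX
  rw [flag_odd Nat.not_even_one] at sY
  apply Spec.intro (body := buildBody) rfl
  dsimp [buildBody]
  refine sX.mono ?_
  rintro w t₁ ⟨hs, ht₁⟩
  obtain ⟨T₀, v₀, h₀, rfl, -, -, hh₀, hp₀, hs₀, -⟩ := hs
  dsimp
  rw [coordAt_zero] at hs₀
  obtain ⟨vL, x, rfl, -, hrep⟩ := hh₀.pair
  dsimp
  refine (strip_spec _ _ hrep).mono ?_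
  rintro w t₂ ⟨rfl, ht₂⟩
  set X := T₀.list with hX
  have hXl : X.length = n := by rw [hp₀.length_eq, hlen]
  refine (sY X (by omega)).mono ?_
  rintro w t₃ ⟨⟨T, vT, h, rfl, hTp, hTr, hTh, hp₁, hs₁, hTw⟩, ht₃⟩
  rw [coordAt_one] at hs₁
  have iY := index_spec (D := D) (w := Box.plane) (enc := encodePt) (d := 1)
    (key := Prod.snd) (n := 10) (by norm_num)
    (fun e env Q => by rw [wp_selBody_pt, coordAt_one]) hs₁ hTh
  rw [flag_odd Nat.not_even_one] at iY
  have hTl := hp₁.length_eq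
  refine iY.mono ?_
  rintro vi t₄ ⟨I, -, hI, hIB, ht₄⟩
  dsimp
  obtain ⟨vY, y, rfl, -, hrepY⟩ := hTh.pair
  dsimp
  refine (strip_spec _ _ hrepY).mono ?_
  rintro w t₅ ⟨rfl, ht₅⟩
  refine (len_spec _ _ (isListVal_encodePts X)).mono ?_
  rintro w t₆ ⟨rfl, ht₆⟩
  rw [hXl]
  simp only [Int.cast_one, Int.cast_zero]
  have hXp : X.Perm S.toList := hp₀.trans hperm
  have hXn : X.Nodup := hp₀.symm.nodup hnd
  -- The root has no parent, so both chains and both catalogues start empty.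
  have hp := primary_spec (D := D) (n := n) hn.symm j 0 Box.plane none X T.list ∅ ∅ [] [] [] [] [] []
    (.pair .nil (.pair (.num 0) .nil)) (.pair .nil (.pair (.num 0) .nil)) (by omega)
    (fun p => by rw [hXp.mem_iff, mem_inter_plane, Finset.mem_toList]) hXn
    (by rw [coordAt_zero]; exact hs₀) hp₁ (by rw [zero_add, coordAt_one]; exact hs₁)
    ⟨.nil, by simp [everyFourth]⟩ ⟨.nil, by simp [everyFourth]⟩
    ⟨_, rfl, by simp [CatalogueNote]⟩ ⟨_, rfl, by simp [CatalogueNote]⟩ (by simp) (by simp)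
  rw [flag_even Even.zero, pow_zero] at hp
  refine hp.mono ?_
  rintro vp t₇ ⟨P, hP, -, -, hPB, ht₇⟩
  refine ⟨⟨T, P⟩, ⟨⟨hTp ▸ hXp, hTw rfl hs₀⟩, hP⟩,
    ⟨_, _, _, rfl, hTr, hPB, I, hI, fun z => (hIB z).trans (by omega)⟩, ?_⟩
  have e1 : n * (j + 1) = n * j + n := by ring
  rw [hlen, e1] at ht₁
  rw [hXl, e1] at ht₃ ht₇
  rw [hTl, hXl] at ht₄ ht₅
  rw [hXl] at ht₂ ht₆
  rw [e1]
  simp only [List.length_nil] at ht₇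
  omega

/-! ## Catalogues, height and size -/

theorem IsCatalogue.length_eq {f : Pt → ℝ} {C : Finset Pt} {parent L : List Entry}
    (h : IsCatalogue f C parent L) : L.length = C.card + (everyFourth parent).length := by
  simpa using h.2.length_eq

theorem IsCatalogue.own_perm {f : Pt → ℝ} {C : Finset Pt} {parent L : List Entry}
    (h : IsCatalogue f C parent L) :
    ((L.filter fun e => e.2).map fun e => e.1).Perm C.toList := by
  refine ((h.2.filter _).map _).trans ?_
  rw [List.filter_append, List.filter_eq_self.2 (by simp), List.filter_eq_nil_iff.2 (by simp),
    List.append_nil, List.map_map]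
  exact .of_eq (List.map_id _)

theorem IsStrip.left_subset {S : Finset Pt} {D : Measure Pt} {d : ℕ} {r : Box} {a b : EReal}
    (h : IsStrip S D d r a b) : (r.slab d (r.lo d) a).toSet ⊆ r.toSet := by
  rw [Box.slab_toSet le_rfl (h.bounds.2.1.le.trans h.bounds.2.2)]
  exact Set.inter_subset_left

theorem IsStrip.right_subset {S : Finset Pt} {D : Measure Pt} {d : ℕ} {r : Box} {a b : EReal}
    (h : IsStrip S D d r a b) : (r.slab d b (r.hi d)).toSet ⊆ r.toSet := by
  rw [Box.slab_toSet (h.bounds.1.trans h.bounds.2.1.le) le_rfl]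
  exact Set.inter_subset_left

theorem IsStrip.union_subset {S : Finset Pt} {D : Measure Pt} {d : ℕ} {r : Box} {a b : EReal}
    (h : IsStrip S D d r a b) :
    (r.slab d a b).toSet ∪ (r.slab d b (r.hi d)).toSet ⊆ r.toSet := by
  refine Set.union_subset ?_ h.right_subset
  rw [Box.slab_toSet h.bounds.1 h.bounds.2.2]
  exact Set.inter_subset_left

theorem IsStrip.disjoint {S : Finset Pt} {D : Measure Pt} {d : ℕ} {r : Box} {a b : EReal}
    (h : IsStrip S D d r a b) :
    Disjoint (r.slab d (r.lo d) a).toSet (r.slab d b (r.hi d)).toSet := by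
  obtain ⟨h1, h2, h3⟩ := h.bounds
  rw [Box.slab_toSet le_rfl (h2.le.trans h3), Box.slab_toSet (h1.trans h2.le) le_rfl,
    Set.disjoint_left]
  rintro q ⟨-, -, h4⟩ ⟨-, h5, -⟩
  exact absurd (h5.trans_le (h4.trans h2.le)) (lt_irrefl _)

theorem inter_mono {S : Finset Pt} {A A' : Set Pt} (h : A ⊆ A') : inter S A ⊆ inter S A' :=
  fun _ hp => mem_inter.2 ⟨(mem_inter.1 hp).1, h (mem_inter.1 hp).2⟩

namespace PrimaryTree

variable {c : ℝ} {S : Finset Pt} {D : Measure Pt}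

/-- The number of catalogues of the nodes at level `k` that contain `p`. -/
def multiplicity (T : PrimaryTree) (p : Pt) (k : ℕ) : ℕ :=
  ((T.level k).flatMap fun v => [v.cX, v.cY]).countP fun L => decide (p ∈ L)

theorem WellFormed.root {T : PrimaryTree} {d : ℕ} {r : Box} {w : Option Box} {Cx Cy : Finset Pt}
    {pX pY : List Entry} (h : T.WellFormed c S D d r w Cx Cy pX pY) :
    ∃ s w', T.root.WellFormed c D r s w' Cx Cy pX pY := by
  cases T with
  | leaf v => exact ⟨_, _, h.2⟩
  | split v l r => obtain ⟨-, a, b, -, h, -⟩ := h; exact ⟨_, _, h⟩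

theorem level_zero (T : PrimaryTree) : T.level 0 = [T.root] := by
  cases T <;> rfl

open Classical in
theorem WellFormed.multiplicity_zero {T : PrimaryTree} {d : ℕ} {r : Box} {w : Option Box}
    {Cx Cy : Finset Pt} {pX pY : List Entry} (h : T.WellFormed c S D d r w Cx Cy pX pY) (p : Pt) :
    T.multiplicity p 0 = (if p ∈ Cx then 1 else 0) + if p ∈ Cy then 1 else 0 := by
  obtain ⟨s, w', h⟩ := h.root
  have hX : p ∈ T.root.cX ↔ p ∈ Cx := by
    rw [Node.cX, h.2.2.1.own_perm.mem_iff, Finset.mem_toList]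
  have hY : p ∈ T.root.cY ↔ p ∈ Cy := by
    rw [Node.cY, h.2.2.2.1.own_perm.mem_iff, Finset.mem_toList]
  simp [multiplicity, level_zero, List.countP_cons, hX, hY, add_comm]

-- Of the four catalogues of two siblings only one is non-empty, and it lies within the parent's
-- region. Deeper down, the two child regions are disjoint subsets of that region. Level 0 of the
-- subtree is excluded because its own catalogues are unrestricted points outside the region.
open Classical in
theorem WellFormed.multiplicity_succ_le {T : PrimaryTree} (p : Pt) : ∀ (k : ℕ) {d : ℕ} {r : Box}
    {w : Option Box} {Cx Cy : Finset Pt} {pX pY : List Entry},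
    T.WellFormed c S D d r w Cx Cy pX pY →
    T.multiplicity p (k + 1) ≤ if p ∈ r.toSet then 1 else 0 := by
  induction T with
  | leaf v => intro k d r w Cx Cy pX pY h; simp [multiplicity, level]
  | split v l u ihl ihu =>
    rintro k d r w Cx Cy pX pY ⟨-, a, b, hab, -, hl, hu⟩
    have hsum : (split v l u).multiplicity p (k + 1) = l.multiplicity p k + u.multiplicity p k := by
      simp [multiplicity, level]
    rw [hsum]
    cases k with
    | zero =>
      rw [hl.multiplicity_zero, hu.multiplicity_zero]
      by_cases hp : p ∈ r.toSet
      · rw [if_pos hp]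
        by_cases he : Even d
        · simp only [he, if_true]
          split_ifs <;> simp_all
        · simp only [he, if_false]
          split_ifs <;> simp_all
      · have hp' : p ∉ inter S ((r.slab d a b).toSet ∪ (r.slab d b (r.hi d)).toSet) :=
          fun h => hp (hab.union_subset (mem_inter.1 h).2)
        split_ifs <;> simp_all
    | succ k =>
      have h1 := ihl k hl
      have h2 := ihu k hu
      have h3 : p ∈ _ → _ := fun h => hab.left_subset h
      have h4 : p ∈ _ → _ := fun h => hab.right_subset h
      have h5 := @Set.disjoint_left.1 hab.disjoint p
      split_ifs at * <;> first | omega | tauto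

theorem WellFormed.multiplicity_le {T : PrimaryTree} {d : ℕ} {r : Box} {w : Option Box}
    {pX pY : List Entry} (h : T.WellFormed c S D d r w ∅ ∅ pX pY) (p : Pt) (k : ℕ) :
    T.multiplicity p k ≤ 2 := by
  cases k with
  | zero => rw [h.multiplicity_zero]; simp
  | succ k =>
    refine (h.multiplicity_succ_le p k).trans ?_
    split_ifs <;> omega

theorem WellFormed.height_le {T : PrimaryTree} : ∀ {d : ℕ} {r : Box}
    {w : Option Box} {Cx Cy : Finset Pt} {pX pY : List Entry},
    T.WellFormed c S D d r w Cx Cy pX pY → T.height ≤ Nat.clog 2 S.card - d := by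
  induction T with
  | leaf v => intros; simp [height]
  | split v l u ihl ihu =>
    rintro d r w Cx Cy pX pY ⟨⟨-, hd⟩, a, b, hab, -, hl, hu⟩
    have h1 := ihl hl
    have h2 := ihu hu
    rw [height]
    omega

end PrimaryTree

/-! ### Sizes of nodes, of the primary tree and of the backup tree -/

theorem STree.IsBiased.keys_length_le {c : ℝ} {f : Entry → ℝ} {L : List Entry}
    {w : EReal → EReal → ℝ} {t : STree} (h : t.IsBiased c {x | ∃ e ∈ L, f e = x} w) :
    t.keys.length ≤ L.length := by
  have hnd : t.keys.Nodup := h.1.imp fun h => h.ne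
  have hsub : t.keys ⊆ L.map f := fun x hx => by simpa using (h.2.1 x).1 hx
  simpa using (List.subperm_of_subset hnd hsub).length_le

theorem Node.WellFormed.size_le {c : ℝ} {D : Measure Pt} {r s w : Box} {Cx Cy : Finset Pt}
    {pX pY : List Entry} {v : Node} (h : v.WellFormed c D r s w Cx Cy pX pY) :
    v.size ≤ 1 + 2 * (v.catX.length + v.catY.length) := by
  obtain ⟨-, -, -, -, h1, h2⟩ := h
  have := h1.keys_length_le
  have := h2.keys_length_le
  rw [Node.size]
  omega

/-- A node costs at most 1 plus twice its catalogue entries, since an index has no more keys than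
its list has entries. The children's catalogues hold at most half of these entries as copies, which
leaves exactly this amount of the factor 4, and their own entries are charged to the points of the
region at this level. -/
theorem PrimaryTree.WellFormed.size_le {c : ℝ} {S : Finset Pt} {D : Measure Pt} {T : PrimaryTree} :
    ∀ (h : ℕ) {d : ℕ} {r : Box} {w : Option Box} {Cx Cy : Finset Pt} {pX pY : List Entry},
    Nat.clog 2 S.card ≤ d + h → T.WellFormed c S D d r w Cx Cy pX pY →
    T.size + 1 ≤ 4 * (T.root.catX.length + T.root.catY.length) +
      4 * ((inter S r.toSet).card * h) + 2 ^ (h + 1) := by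
  induction T with
  | leaf v =>
    intro h d r w Cx Cy pX pY _ hv
    have h1 := hv.2.size_le
    have h2 : 2 ≤ 2 ^ (h + 1) := by rw [pow_succ]; have := Nat.one_le_two_pow (n := h); omega
    rw [PrimaryTree.size, PrimaryTree.root]
    omega
  | split v l u ihl ihu =>
    rintro h d r w Cx Cy pX pY hh ⟨⟨-, hd⟩, a, b, hab, hv, hl, hu⟩
    obtain ⟨h, rfl⟩ : ∃ k, h = k + 1 := ⟨h - 1, by omega⟩
    have h1 := hv.size_le
    have h2 := ihl h (by omega) hl
    have h3 := ihu h (by omega) hu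
    obtain ⟨_, _, -, -, hlX, hlY, -⟩ := hl.root
    obtain ⟨_, _, -, -, huX, huY, -⟩ := hu.root
    have h4 := hlX.length_eq
    have h5 := hlY.length_eq
    have h6 := huX.length_eq
    have h7 := huY.length_eq
    have h8 := everyFourth_length v.catX
    have h9 := everyFourth_length v.catY
    have hunion := Finset.card_le_card (inter_mono (S := S) hab.union_subset)
    have hcard : (inter S (r.slab d (r.lo d) a).toSet).card +
        (inter S (r.slab d b (r.hi d)).toSet).card ≤ (inter S r.toSet).card := by
      classical
      rw [← Finset.card_union_of_disjoint]
      · exact Finset.card_le_card (Finset.union_subset (inter_mono hab.left_subset)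
          (inter_mono hab.right_subset))
      · rw [Finset.disjoint_left]
        exact fun p hp hp' => Set.disjoint_left.1 hab.disjoint (mem_inter.1 hp).2
          (mem_inter.1 hp').2
    set N := (inter S r.toSet).card
    set Nl := (inter S (r.slab d (r.lo d) a).toSet).card
    set Nu := (inter S (r.slab d b (r.hi d)).toSet).card
    have e1 : Nl * h + Nu * h ≤ N * h := by
      rw [← add_mul]; exact Nat.mul_le_mul_right _ hcard
    have e2 : N * (h + 1) = N * h + N := by ring
    have e3 : 2 ^ (h + 1 + 1) = 2 * 2 ^ (h + 1) := by ring
    rw [PrimaryTree.size, PrimaryTree.root, e2, e3]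
    simp only [Finset.card_empty] at h6 h7
    by_cases he : Even d
    · simp only [he, if_true, Finset.card_empty] at h4 h5
      omega
    · simp only [he, if_false, Finset.card_empty] at h4 h5
      omega

/-- Halves of sizes differing by at most 1 have at most `2 ^ j` points each when together they have
at most `2 ^ (j + 1)`, so each level costs one list entry per point. -/
theorem RangeTree.WellFormed.size_le {t : RangeTree} : ∀ (j : ℕ), t.points.length ≤ 2 ^ j →
    t.WellFormed → t.points ≠ [] → t.size + 1 ≤ t.points.length * j + 2 * t.points.length := by
  induction t with
  | empty => intro j _ _ h; exact absurd rfl h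
  | leaf p => intro j _ _ _; simp [points, size]
  | node k ys l r ihl ihr =>
    rintro j hj ⟨hl0, hr0, hlr, hrl, -, -, hys, -, hl, hr⟩ -
    have h1 := List.length_pos_iff.2 hl0
    have h2 := List.length_pos_iff.2 hr0
    have h3 := hys.length_eq
    rw [points] at hj ⊢
    rw [List.length_append] at *
    cases j with
    | zero => simp at hj; omega
    | succ j =>
      rw [pow_succ] at hj
      have h4 := ihl j (by omega) hl hl0
      have h5 := ihr j (by omega) hr hr0
      have e : (l.points.length + r.points.length) * (j + 1) =
        l.points.length * j + r.points.length * j + (l.points.length + r.points.length) := by ring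
      rw [size, e]
      omega

theorem BiasedRangeTree.IsFor.size_le {c : ℝ} {S : Finset Pt} {D : Measure Pt}
    {T : BiasedRangeTree} (h : T.IsFor c S D) (hS : S.card ≠ 0) :
    T.size ≤ 5 * (S.card * Nat.clog 2 S.card) + 2 * S.card + 2 ^ (Nat.clog 2 S.card + 1) := by
  obtain ⟨⟨h1, h2⟩, h3⟩ := h
  have hlen := h1.length_eq
  rw [Finset.length_toList] at hlen
  have h4 := h2.size_le (Nat.clog 2 S.card) (hlen ▸ Nat.le_pow_clog (by norm_num) _)
    fun h => hS (by simpa [h] using hlen.symm)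
  have h5 := h3.size_le (Nat.clog 2 S.card) (by omega)
  obtain ⟨_, _, -, -, hX, hY, -⟩ := h3.root
  have h6 := hX.length_eq
  have h7 := hY.length_eq
  simp only [everyFourth, Finset.card_empty, List.length_nil] at h6 h7
  have h8 : inter S Box.plane.toSet = S := by
    ext p; exact mem_inter_plane
  rw [h8] at h5
  rw [hlen] at h4
  rw [size]
  omega

/-! ## The query program -/

abbrev fInBox : ℕ := 1
abbrev fLocate : ℕ := 2
abbrev fSearch : ℕ := 3
abbrev fAdvance : ℕ := 4
abbrev fWalk : ℕ := 5
abbrev fBackup : ℕ := 6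

/-- Whether a point lies in a box; arguments: box, point. -/
def inBoxBody : Expr :=
  .ifCoordLe (.fst (.arg 0 1)) (.fst (.fst (.arg 0 0))) .nil
    (.ifCoordLe (.fst (.arg 0 1)) (.snd (.fst (.arg 0 0)))
      (.ifCoordLe (.snd (.arg 0 1)) (.fst (.snd (.arg 0 0))) .nil
        (.ifCoordLe (.snd (.arg 0 1)) (.snd (.snd (.arg 0 0))) (.pair .nil .nil) .nil)) .nil)

/-- The record of the node at which the walk through the catalogues starts, and a pair as first
component if a bad leaf has been reached; arguments: primary tree, query point. -/
def locateBody : Expr :=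
  .ifPair (.fst (.arg 0 0))
    (.ifPair (.call fInBox (.tuple [.snd (.fst (.snd (.arg 0 0))), .arg 0 1]))
      (.pair .nil (.snd (.fst (.fst (.arg 0 0)))))
      (.ifPair (.call fInBox (.tuple [.fst (.fst (.snd (.fst (.fst (.arg 0 0))))), .arg 0 1]))
        (.call fLocate (.tuple [.fst (.fst (.arg 0 0)), .arg 0 1]))
        (.call fLocate (.tuple [.snd (.fst (.arg 0 0)), .arg 0 1]))))
    (.pair (.snd (.snd (.snd (.arg 0 0)))) (.snd (.arg 0 0)))

/-- The auxiliary field of the leaf found; arguments: search tree, coordinate. -/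
def searchBody : Expr :=
  .ifPair (.fst (.arg 0 0))
    (.ifCoordLe (.arg 0 1) (.fst (.fst (.arg 0 0)))
      (.call fSearch (.tuple [.fst (.snd (.arg 0 0)), .arg 0 1]))
      (.call fSearch (.tuple [.snd (.snd (.arg 0 0)), .arg 0 1])))
    (.snd (.arg 0 0))

/-- Moves a handle forward to the first entry that is not below a coordinate; arguments: flag,
handle, coordinate. -/
def advanceBody : Expr :=
  .ifPair (items (.arg 0 1))
    (.ifCoordLe (.arg 0 2) (.sel (.arg 0 0) (head (.arg 0 1))) (.arg 0 1)
      (.call fAdvance (.tuple [.arg 0 0, next (.arg 0 1), .arg 0 2])))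
    (.arg 0 1)

/-- The number of own entries above a coordinate in a catalogue and in those of the ancestors;
arguments: flag, handle, coordinate. -/
def walkBody : Expr :=
  .ifPair (ptr (.arg 0 1))
    (.arith .add (count (.arg 0 1)) (.call fWalk (.tuple [.arg 0 0,
      .call fAdvance (.tuple [.arg 0 0, ptr (.arg 0 1), .arg 0 2]), .arg 0 2])))
    (count (.arg 0 1))

/-- Range counting in the backup tree; arguments: tree, handle of the query in its list, left end
of the query range. -/
def backupBody : Expr :=
  .ifPair (.arg 0 0)
    (.ifPair (.fst (.arg 0 0))
      (.ifCoordLe (.arg 0 2) (.fst (.snd (.arg 0 0)))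
        (.arith .add (count (.snd (ptr (.arg 0 1)))) (.call fBackup (.tuple
          [.fst (.fst (.arg 0 0)), .fst (ptr (.arg 0 1)), .arg 0 2])))
        (.call fBackup (.tuple [.snd (.fst (.arg 0 0)), .snd (ptr (.arg 0 1)), .arg 0 2])))
      (.ifCoordLe (.arg 0 2) (.fst (.fst (.snd (.arg 0 0)))) (count (.arg 0 1)) (.num 0)))
    (.num 0)

def queryBody : Expr :=
  .letIn (.call fLocate (.tuple [.fst (.snd (.fst (.var 0))), .snd (.var 0)]))
    (.ifPair (.fst (.var 0))
      (.call fBackup (.tuple [.fst (.fst (.var 1)),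
        .call fSearch (.tuple [.snd (.snd (.fst (.var 1))), .snd (.snd (.var 1))]),
        .fst (.snd (.var 1))]))
      (.arith .add
        (.call fWalk (.tuple [.nil, .call fSearch (.tuple
          [.snd (.fst (.fst (.snd (.snd (.var 0))))), .fst (.snd (.var 1))]),
          .fst (.snd (.var 1))]))
        (.call fWalk (.tuple [isOdd, .call fSearch (.tuple
          [.snd (.snd (.fst (.snd (.snd (.var 0))))), .snd (.snd (.var 1))]),
          .snd (.snd (.var 1))]))))

def queryProgram : Program :=
  [queryBody, inBoxBody, locateBody, searchBody, advanceBody, walkBody, backupBody]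

variable {O : Box → ℝ}

theorem inBox_spec (r : Box) (q : Pt) :
    Spec O queryProgram fInBox (.tuple [encodeBox r, encodePt q]) fun v t =>
      (q ∈ r.toSet ∧ v = .pair .nil .nil ∨ q ∉ r.toSet ∧ v = .nil) ∧ t ≤ 60 := by
  apply Spec.intro (body := inBoxBody) rfl
  dsimp [inBoxBody, encodeBox, encodePt, Box.toSet]
  split_ifs with h1 h2 h3 h4
  · exact ⟨.inr ⟨fun h => not_le.2 h.1 h1, rfl⟩, by omega⟩
  · exact ⟨.inr ⟨fun h => not_le.2 h.2.2.1 h3, rfl⟩, by omega⟩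
  · exact ⟨.inl ⟨⟨not_le.1 h1, h2, not_le.1 h3, h4⟩, rfl⟩, by omega⟩
  · exact ⟨.inr ⟨fun h => h4 h.2.2.2, rfl⟩, by omega⟩
  · exact ⟨.inr ⟨fun h => h2 h.2.1, rfl⟩, by omega⟩

/-- Only an interval containing `x` and its stored value are returned. With `GapHandle`, entries at
most the left end are below `x` and entries at least the right end are not, so the handle is the
exact position of `x`. -/
theorem search_spec {H : EReal → EReal → Val → Prop} {x : ℝ} {T : STree} :
    ∀ {a b : EReal} {v : Val}, T.Finds H a b v → a < x → x ≤ b →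
    Spec O queryProgram fSearch (.tuple [v, .coord x]) fun h t =>
      (∃ a' b' : EReal, a' < x ∧ x ≤ b' ∧ H a' b' h) ∧ t ≤ 40 * T.searchDepth x + 20 := by
  induction T with
  | leaf =>
    rintro a b v ⟨h, rfl, hh⟩ ha hb
    apply Spec.intro (body := searchBody) rfl
    dsimp [searchBody]
    exact ⟨⟨a, b, ha, hb, hh⟩, by omega⟩
  | node k l r ihl ihr =>
    rintro a b v ⟨vl, vr, rfl, hl, hr⟩ ha hb
    apply Spec.intro (body := searchBody) rfl
    dsimp [searchBody]
    by_cases hk : (x : EReal) ≤ k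
    · rw [if_pos hk]
      refine (ihl hl ha hk).mono ?_
      rintro h t ⟨hh, ht⟩
      rw [STree.searchDepth, if_pos (by exact_mod_cast hk)]
      exact ⟨hh, by omega⟩
    · rw [if_neg hk]
      refine (ihr hr (not_le.1 hk) hb).mono ?_
      rintro h t ⟨hh, ht⟩
      rw [STree.searchDepth, if_neg (by exact_mod_cast hk)]
      exact ⟨hh, by omega⟩

theorem advance_spec {X : List Entry → List Entry → Val → Prop} {d : ℕ} {x : ℝ} :
    ∀ (k : ℕ) {pre suf : List Entry} {h : Val}, HandleTo encodeEntry X pre suf h →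
    (pre ++ suf).Pairwise (fun e e' => coordAt d e.1 ≤ coordAt d e'.1) →
    (∀ e ∈ pre, coordAt d e.1 < x) → (∀ e ∈ suf.drop k, x ≤ coordAt d e.1) →
    Spec O queryProgram fAdvance (.tuple [flag d, h, .coord x]) fun h' t =>
      (∃ pre' suf', pre' ++ suf' = pre ++ suf ∧ (∀ e ∈ pre', coordAt d e.1 < x) ∧
        (∀ e ∈ suf', x ≤ coordAt d e.1) ∧ HandleTo encodeEntry X pre' suf' h') ∧
      t ≤ 60 * k + 60 := by
  intro k
  induction k with
  | zero =>
    intro pre suf h hh hs hpre hsuf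
    apply Spec.intro (body := advanceBody) rfl
    rcases suf with _ | ⟨e, suf⟩
    · obtain ⟨y, rfl, hy⟩ := id hh
      dsimp [advanceBody]
      exact ⟨⟨pre, [], rfl, hpre, by simp, hh⟩, by omega⟩
    · obtain ⟨y, v, y', rfl, hy, hh'⟩ := id hh
      dsimp [advanceBody]
      rw [wp_selBody_entry]
      dsimp
      rw [if_pos (by exact_mod_cast hsuf e (by simp))]
      exact ⟨⟨pre, _, rfl, hpre, hsuf, hh⟩, by omega⟩
  | succ k ih =>
    intro pre suf h hh hs hpre hsuf
    apply Spec.intro (body := advanceBody) rfl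
    rcases suf with _ | ⟨e, suf⟩
    · obtain ⟨y, rfl, hy⟩ := id hh
      dsimp [advanceBody]
      exact ⟨⟨pre, [], rfl, hpre, by simp, hh⟩, by omega⟩
    · obtain ⟨y, v, y', rfl, hy, hh'⟩ := id hh
      dsimp [advanceBody]
      rw [wp_selBody_entry]
      dsimp
      by_cases he : x ≤ coordAt d e.1
      · rw [if_pos (by exact_mod_cast he)]
        refine ⟨⟨pre, _, rfl, hpre, fun e' he' => ?_, hh⟩, by omega⟩
        rcases List.mem_cons.1 he' with rfl | he'
        · exact he
        · exact he.trans (List.rel_of_pairwise_cons (List.pairwise_append.1 hs).2.1 he')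
      · rw [if_neg (by exact_mod_cast he)]
        refine (ih hh' (by simpa using hs) ?_ (by simpa using hsuf)).mono ?_
        · intro e' he'
          rcases List.mem_append.1 he' with he' | he'
          · exact hpre e' he'
          · rw [List.mem_singleton.1 he']; exact not_le.1 he
        · rintro h' t ⟨⟨pre', suf', h1, h2⟩, ht⟩
          exact ⟨⟨pre', suf', by simpa using h1, h2⟩, by omega⟩

/-- The number of own entries of a catalogue with coordinate at least `x`. -/
def above (d : ℕ) (x : ℝ) (c : List Entry) : ℕ :=
  c.countP fun e => e.2 && decide (x ≤ coordAt d e.1)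

theorem above_append {d : ℕ} {x : ℝ} {pre suf : List Entry} (hpre : ∀ e ∈ pre, coordAt d e.1 < x)
    (hsuf : ∀ e ∈ suf, x ≤ coordAt d e.1) : above d x (pre ++ suf) = suf.countP (·.2) := by
  rw [above, List.countP_append, List.countP_eq_zero.2, zero_add]
  · exact List.countP_congr fun e he => by simp [hsuf e he]
  · intro e he
    simp [hpre e he]

def SortedAt (d : ℕ) (c : List Entry) : Prop :=
  c.Pairwise fun e e' => coordAt d e.1 ≤ coordAt d e'.1

/-- At the exact position the stored count is the number of own entries at or above `x`. Following
the pointer and advancing at most three entries restores exactness in the parent's catalogue, so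
each ancestor costs constant time. -/
theorem walk_spec {d : ℕ} {x : ℝ} : ∀ (chain : List (List Entry)) {pre suf : List Entry} {h : Val},
    (∀ c ∈ chain, SortedAt d c) → HandleTo encodeEntry (CatalogueNote d chain) pre suf h →
    (∀ e ∈ pre, coordAt d e.1 < x) → (∀ e ∈ suf, x ≤ coordAt d e.1) →
    Spec O queryProgram fWalk (.tuple [flag d, h, .coord x]) fun v t =>
      v = .num (above d x (pre ++ suf) + (chain.map (above d x)).sum : ℕ) ∧
      t ≤ 400 * chain.length + 40 := by
  intro chain
  induction chain with
  | nil =>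
    intro pre suf h _ hh hpre hsuf
    obtain ⟨v, y, rfl, hy, -⟩ := hh.pair
    obtain rfl := hy
    apply Spec.intro (body := walkBody) rfl
    dsimp [walkBody]
    rw [above_append hpre hsuf]
    exact ⟨by simp, by omega⟩
  | cons c chain ih =>
    intro pre suf h hc hh hpre hsuf
    obtain ⟨v, y, rfl, hy, -⟩ := hh.pair
    obtain ⟨ph, rfl, pre', suf', rfl, h1, h2, h3⟩ := hy
    apply Spec.intro (body := walkBody) rfl
    obtain ⟨v', y', rfl, -⟩ := h3.pair
    dsimp [walkBody]
    refine (advance_spec 3 h3 (hc _ (by simp)) (h1 x hpre) (h2 x hsuf)).mono ?_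
    rintro h' t ⟨⟨pre'', suf'', h4, h5, h6, h7⟩, ht⟩
    refine (ih (fun c hc' => hc c (by simp [hc'])) h7 h5 h6).mono ?_
    rintro w t' ⟨rfl, ht'⟩
    dsimp
    rw [above_append hpre hsuf, h4]
    refine ⟨by simp, ?_⟩
    omega

theorem RangeTree.WellFormed.list_perm {T : RangeTree} (h : T.WellFormed) :
    T.list.Perm T.points := by
  cases T with
  | empty => exact .refl _
  | leaf p => exact .refl _
  | node k ys l r => exact h.2.2.2.2.2.2.1

theorem RangeTree.Note.count {d : ℕ} {T : RangeTree} {pre suf : List Pt} {x : Val}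
    (h : T.Note d pre suf x) : ∃ z, x = .pair (.num suf.length) z := by
  cases T with
  | empty => exact h
  | leaf p => exact h
  | node k ys l r => obtain ⟨_, _, h, -⟩ := h; exact ⟨_, h⟩

theorem length_eq_countP {y : ℝ} {pre suf L : List Pt} (h : (pre ++ suf).Perm L)
    (hpre : ∀ p ∈ pre, p.2 < y) (hsuf : ∀ p ∈ suf, y ≤ p.2) :
    suf.length = L.countP fun p => decide (y ≤ p.2) := by
  rw [← h.countP_eq, List.countP_append, List.countP_eq_zero.2 (by simpa using hpre), zero_add,
    eq_comm, List.countP_eq_length]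
  simpa using hsuf

/-- If `q.1` is at most the key, the whole right half passes the test on `x`; its contribution is
the stored count at the cascaded position and only the left half is visited. Otherwise the left half
contributes nothing. One node per level is visited and no list is searched again. -/
theorem backup_spec {q : Pt} {T : RangeTree} : ∀ (j : ℕ) {v h : Val} {pre suf : List Pt},
    T.points.length ≤ 2 ^ j → T.WellFormed → T.Rep v → HandleTo encodePt (T.Note 1) pre suf h →
    pre ++ suf = T.list → (∀ p ∈ pre, p.2 < q.2) → (∀ p ∈ suf, q.2 ≤ p.2) →
    Spec O queryProgram fBackup (.tuple [v, h, .coord q.1]) fun w t =>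
      w = .num (T.points.countP (fun p => decide (q.1 ≤ p.1 ∧ q.2 ≤ p.2)) : ℕ) ∧
      t ≤ 100 * j + 60 := by
  induction T with
  | empty =>
    rintro j v h pre suf _ _ rfl _ _ _ _
    apply Spec.intro (body := backupBody) rfl
    dsimp [backupBody, RangeTree.points]
    simp
  | leaf p =>
    rintro j v h pre suf _ _ ⟨aux, rfl⟩ hh hl hpre hsuf
    obtain ⟨v, x, rfl, hx, -⟩ := hh.pair
    obtain ⟨z, rfl⟩ := hx
    apply Spec.intro (body := backupBody) rfl
    dsimp [backupBody, encodePt, RangeTree.points]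
    have e := length_eq_countP (.of_eq hl) hpre hsuf
    by_cases hp : q.1 ≤ p.1
    · rw [if_pos (by exact_mod_cast hp), e]
      exact ⟨by simp [RangeTree.list, List.countP_cons, hp], by omega⟩
    · rw [if_neg (by exact_mod_cast hp)]
      exact ⟨by simp [hp], by omega⟩
  | node k ys l r ihl ihr =>
    rintro j v h pre suf hj ⟨hl0, hr0, hlr, hrl, hlk, hrk, -, -, hl, hr⟩
      ⟨aux, vys, vl, vr, rfl, -, hvl, hvr⟩ hh hlist hpre hsuf
    obtain ⟨v, x, rfl, hx, -⟩ := hh.pair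
    obtain ⟨h₁, h₂, rfl, ⟨pre₁, suf₁, hl₁, hpre₁, hsuf₁, hh₁⟩, pre₂, suf₂, hl₂, hpre₂, hsuf₂, hh₂⟩ := hx
    rw [coordAt_one] at hpre₁ hpre₂
    have h1 := List.length_pos_iff.2 hl0
    have h2 := List.length_pos_iff.2 hr0
    rw [RangeTree.points, List.length_append] at hj
    obtain ⟨j, rfl⟩ : ∃ i, j = i + 1 := by
      cases j with
      | zero => simp at hj; omega
      | succ j => exact ⟨j, rfl⟩
    rw [pow_succ] at hj
    have e₂ := length_eq_countP (hl₂ ▸ hr.list_perm) (hpre₂ _ hpre) fun p hp => hsuf p (hsuf₂ hp)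
    obtain ⟨v₂, x₂, rfl, hx₂, -⟩ := hh₂.pair
    obtain ⟨z₂, rfl⟩ := hx₂.count
    apply Spec.intro (body := backupBody) rfl
    dsimp [backupBody, RangeTree.points]
    by_cases hk : q.1 ≤ k
    · rw [if_pos (by exact_mod_cast hk)]
      refine (ihl j (by omega) hl hvl hh₁ hl₁ (hpre₁ _ hpre) fun p hp => hsuf p (hsuf₁ hp)).mono ?_
      rintro w t ⟨rfl, ht⟩
      dsimp
      refine ⟨?_, by omega⟩
      rw [e₂, List.countP_append, Nat.cast_add, add_comm]
      congr 3
      refine List.countP_congr fun p hp => ?_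
      simp [hk.trans (hrk p hp)]
    · rw [if_neg (by exact_mod_cast hk)]
      refine (ihr j (by omega) hr hvr hh₂ hl₂ (hpre₂ _ hpre) fun p hp => hsuf p (hsuf₂ hp)).mono ?_
      rintro w t ⟨rfl, ht⟩
      refine ⟨?_, by omega⟩
      rw [List.countP_append, List.countP_eq_zero (l := l.points) |>.2, zero_add]
      intro p hp
      simp only [decide_eq_true_eq, not_and]
      intro h3
      exact absurd (h3.trans (hlk p hp)) hk

/-! ## Correctness of the query -/

theorem countP_toList {C : Finset Pt} (f : Pt → Prop) [DecidablePred f] :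
    C.toList.countP (fun p => decide (f p)) = (C.filter f).card := by
  rw [List.countP_eq_length_filter, ← Finset.length_toList]
  refine (perm_toList (C.nodup_toList.filter _) fun p => ?_).length_eq
  simp

theorem IsCatalogue.above_eq {d : ℕ} {C : Finset Pt} {parent L : List Entry} (x : ℝ)
    (h : IsCatalogue (coordAt d) C parent L) :
    above d x L = (C.filter fun p => x ≤ coordAt d p).card := by
  rw [above, h.2.countP_eq, List.countP_append, List.countP_map, List.countP_map,
    ← countP_toList]
  have : ((everyFourth parent).countP ((fun e : Entry => e.2 && decide (x ≤ coordAt d e.1)) ∘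
      fun e => (e.1, false))) = 0 := List.countP_eq_zero.2 (by simp)
  rw [this, add_zero]
  exact List.countP_congr fun p _ => by simp

/-! ### Splitting the range count along the descent -/

/-- The number of points of `S ∩ A` in the query range. -/
def rangeIn (S : Finset Pt) (A : Set Pt) (q : Pt) : ℕ :=
  ((inter S A).filter fun p => q.1 ≤ p.1 ∧ q.2 ≤ p.2).card

theorem rangeIn_congr {S : Finset Pt} {A A' : Set Pt} {q : Pt}
    (h : ∀ p ∈ S, q.1 ≤ p.1 → q.2 ≤ p.2 → (p ∈ A ↔ p ∈ A')) : rangeIn S A q = rangeIn S A' q := by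
  rw [rangeIn, rangeIn]
  congr 1
  ext p
  simp only [Finset.mem_filter, mem_inter]
  constructor
  · rintro ⟨⟨h1, h2⟩, h3⟩
    exact ⟨⟨h1, (h p h1 h3.1 h3.2).1 h2⟩, h3⟩
  · rintro ⟨⟨h1, h2⟩, h3⟩
    exact ⟨⟨h1, (h p h1 h3.1 h3.2).2 h2⟩, h3⟩

theorem rangeIn_union {S : Finset Pt} {A A' : Set Pt} {q : Pt} (h : Disjoint A A') :
    rangeIn S (A ∪ A') q = rangeIn S A q + rangeIn S A' q := by
  classical
  rw [rangeIn, rangeIn, rangeIn, ← Finset.card_union_of_disjoint]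
  · congr 1
    ext p
    simp only [Finset.mem_filter, mem_inter, Finset.mem_union, Set.mem_union]
    tauto
  · rw [Finset.disjoint_left]
    intro p hp hp'
    exact Set.disjoint_left.1 h (mem_inter.1 (Finset.mem_filter.1 hp).1).2
      (mem_inter.1 (Finset.mem_filter.1 hp').1).2

theorem coordAt_le_of_le {d : ℕ} {q p : Pt} (h1 : q.1 ≤ p.1) (h2 : q.2 ≤ p.2) :
    coordAt d q ≤ coordAt d p := by
  rw [coordAt, coordAt]; split_ifs <;> assumption

/-- The points of a region that are not before its strip. -/
abbrev upper (d : ℕ) (r : Box) (a b : EReal) : Set Pt :=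
  (r.slab d a b).toSet ∪ (r.slab d b (r.hi d)).toSet

theorem IsStrip.mem_upper {S : Finset Pt} {D : Measure Pt} {d : ℕ} {r : Box} {a b : EReal}
    (h : IsStrip S D d r a b) {p : Pt} :
    p ∈ upper d r a b ↔ p ∈ r.toSet ∧ a < (coordAt d p : EReal) := by
  obtain ⟨h1, h2, h3⟩ := h.bounds
  rw [upper, Box.slab_toSet h1 h3, Box.slab_toSet (h1.trans h2.le) le_rfl]
  constructor
  · rintro (h | h)
    · exact ⟨h.1, h.2.1⟩
    · exact ⟨h.1, h2.trans h.2.1⟩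
  · rintro ⟨h4, h5⟩
    rcases le_or_gt (coordAt d p : EReal) b with h6 | h6
    · exact .inl ⟨h4, h5, h6⟩
    · exact .inr ⟨h4, h6, (Box.mem_bounds h4).2⟩

theorem IsStrip.mem_left {S : Finset Pt} {D : Measure Pt} {d : ℕ} {r : Box} {a b : EReal}
    (h : IsStrip S D d r a b) {p : Pt} :
    p ∈ (r.slab d (r.lo d) a).toSet ↔ p ∈ r.toSet ∧ (coordAt d p : EReal) ≤ a := by
  rw [Box.slab_toSet le_rfl (h.bounds.2.1.le.trans h.bounds.2.2)]
  exact ⟨fun h => ⟨h.1, h.2.2⟩, fun h => ⟨h.1, (Box.mem_bounds h.1).1, h.2⟩⟩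

theorem IsStrip.mem_right {S : Finset Pt} {D : Measure Pt} {d : ℕ} {r : Box} {a b : EReal}
    (h : IsStrip S D d r a b) {p : Pt} :
    p ∈ (r.slab d b (r.hi d)).toSet ↔ p ∈ r.toSet ∧ b < (coordAt d p : EReal) := by
  rw [Box.slab_toSet (h.bounds.1.trans h.bounds.2.1.le) le_rfl]
  exact ⟨fun h => ⟨h.1, h.2.1⟩, fun h => ⟨h.1, h.2, (Box.mem_bounds h.1).2⟩⟩

theorem IsStrip.mem_strip {S : Finset Pt} {D : Measure Pt} {d : ℕ} {r : Box} {a b : EReal}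
    (h : IsStrip S D d r a b) {p : Pt} : p ∈ (r.slab d a b).toSet ↔
      p ∈ r.toSet ∧ a < (coordAt d p : EReal) ∧ (coordAt d p : EReal) ≤ b := by
  rw [Box.slab_toSet h.bounds.1 h.bounds.2.2]
  rfl

/-- The catalogues of a left child count the points of the query range that are not before the
strip of its parent, if the query point is not after it. -/
theorem IsStrip.above_left {S : Finset Pt} {D : Measure Pt} {d : ℕ} {r : Box} {a b : EReal}
    (h : IsStrip S D d r a b) {pX pY cX cY : List Entry} {q : Pt}
    (hX : IsCatalogue Prod.fst (if Even d then ∅ else inter S (upper d r a b)) pX cX)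
    (hY : IsCatalogue Prod.snd (if Even d then inter S (upper d r a b) else ∅) pY cY)
    (hq : (coordAt d q : EReal) ≤ b) :
    above 0 q.1 cX + above 1 q.2 cY = rangeIn S (upper d r a b) q := by
  rw [← coordAt_zero] at hX
  rw [← coordAt_one] at hY
  rw [hX.above_eq, hY.above_eq, rangeIn, coordAt_zero, coordAt_one]
  have key : ∀ p ∈ inter S (upper d r a b), coordAt d q ≤ coordAt d p := by
    intro p hp
    obtain ⟨h1, h2⟩ := mem_inter.1 hp
    obtain ⟨h3, h4⟩ := h.mem_upper.1 h2
    -- The point is beyond `a`, and no point of `S` in the region lies strictly between the two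
    -- lines, so its coordinate is at least `b`, hence at least that of `q`. This settles the axis
    -- along which the catalogue is not sorted.
    have h5 := (h.2.2.2.1 p (mem_inter.2 ⟨h1, h3⟩)).resolve_left (not_le.2 h4)
    exact_mod_cast hq.trans h5
  by_cases he : Even d
  · simp only [he, if_true, Finset.filter_empty, Finset.card_empty, zero_add]
    congr 1
    refine Finset.filter_congr fun p hp => ?_
    have := key p hp
    simp only [coordAt, he, if_true] at this
    tauto
  · simp only [he, if_false, Finset.filter_empty, Finset.card_empty, add_zero]
    congr 1
    refine Finset.filter_congr fun p hp => ?_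
    have := key p hp
    simp only [coordAt, he, if_false] at this
    tauto

/-- The number of own entries in a chain of catalogues that a query point counts. -/
def chainCount (q : Pt) (cx cy : List (List Entry)) : ℕ :=
  (cx.map (above 0 q.1)).sum + (cy.map (above 1 q.2)).sum

theorem chainCount_cons (q : Pt) (x y : List Entry) (cx cy : List (List Entry)) :
    chainCount q (x :: cx) (y :: cy) = above 0 q.1 x + above 1 q.2 y + chainCount q cx cy := by
  simp only [chainCount, List.map_cons, List.sum_cons]
  omega

/-- The result `w` of the descent for `q` with `N` points to be counted. -/
def Located (S : Finset Pt) (B N k : ℕ) (q : Pt) (T : PrimaryTree) (w : Val) : Prop :=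
  ((T.locate q).IsBad S ∧ ∃ x y z, w = .pair (.pair x y) z) ∨
  (¬ (T.locate q).IsBad S ∧ ∃ (vu aux : Val) (cx cy : List (List Entry)), w = .pair .nil vu ∧
    (T.locate q).start.Built B cx cy aux vu ∧
    (∀ c ∈ (T.locate q).start.catX :: cx, SortedAt 0 c) ∧
    (∀ c ∈ (T.locate q).start.catY :: cy, SortedAt 1 c) ∧
    cx.length ≤ k ∧ cy.length ≤ k ∧
    chainCount q ((T.locate q).start.catX :: cx) ((T.locate q).start.catY :: cy) = N)

theorem PrimaryTree.Built.start {S : Finset Pt} {B : ℕ} {T : PrimaryTree}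
    {cx cy : List (List Entry)} {v : Val} (h : T.Built S B cx cy v) :
    ∃ m vx aux, v = .pair m vx ∧ T.root.Built B cx cy aux vx := by
  cases T with
  | leaf x => obtain ⟨vx, A, rfl, h, -⟩ := h; exact ⟨_, _, _, rfl, h⟩
  | split x l r => obtain ⟨aux, vx, vl, vr, rfl, h, -⟩ := h; exact ⟨_, _, _, rfl, h⟩

/-- The invariant of the descent is the chain's count plus the points of the query range in the
current region. `k` bounds the length of the chain above the subtree, so the final chain has at most
depth plus 1 ancestors. -/
theorem locate_spec {O : Box → ℝ} {c : ℝ} {S : Finset Pt} {D : Measure Pt} {B : ℕ} {q : Pt}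
    {T : PrimaryTree} : ∀ {d : ℕ} {r : Box} {w : Option Box} {Cx Cy : Finset Pt}
    {pX pY : List Entry} {cx cy : List (List Entry)} {v : Val} (k : ℕ),
    T.WellFormed c S D d r w Cx Cy pX pY → T.Built S B cx cy v → q ∈ r.toSet →
    (∀ c ∈ T.root.catX :: cx, SortedAt 0 c) → (∀ c ∈ T.root.catY :: cy, SortedAt 1 c) →
    cx.length ≤ k → cy.length ≤ k →
    Spec O queryProgram fLocate (.tuple [v, encodePt q]) fun w t =>
      Located S B (chainCount q (T.root.catX :: cx) (T.root.catY :: cy) + rangeIn S r.toSet q)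
        (k + T.depth q + 1) q T w ∧ t ≤ 300 * T.depth q + 200 := by
  induction T with
  | leaf x =>
    rintro d r w Cx Cy pX pY cx cy v k ⟨-, hx⟩ ⟨vx, A, rfl, hB, hA⟩ hq hsX hsY hkX hkY
    apply Spec.intro (body := locateBody) rfl
    obtain ⟨vcx, vcy, vtx, vty, rfl, -⟩ := id hB
    dsimp [locateBody]
    refine ⟨?_, by omega⟩
    have hreg := hx.1
    by_cases h : A = []
    · have h1 : ¬ (inter S x.region.toSet).Nonempty := fun h' => hA.2 h' h
      refine .inr ⟨h1, _, _, cx, cy, by rw [h]; rfl, hB, hsX, hsY, by omega, by omega, ?_⟩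
      rw [hreg, Finset.not_nonempty_iff_eq_empty] at h1
      simp [rangeIn, h1, PrimaryTree.locate, PrimaryTree.start, PrimaryTree.root]
    · obtain ⟨p, A, rfl⟩ := List.exists_cons_of_ne_nil h
      exact .inl ⟨hA.1 h, _, _, _, rfl⟩
  | split x l u ihl ihu =>
    rintro d r w Cx Cy pX pY cx cy v k ⟨-, a, b, hab, hx, hl, hu⟩
      ⟨aux, vx, vl, vr, rfl, hB, hlB, huB⟩ hq hsX hsY hkX hkY
    obtain ⟨sl, wl, hlw⟩ := hl.root
    obtain ⟨su, wu, huw⟩ := hu.root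
    have hstrip := hx.2.1
    have hlreg := hlw.1
    have hlX := hlw.2.2.1
    have hlY := hlw.2.2.2.1
    have huX := huw.2.2.1
    have huY := huw.2.2.2.1
    have slX : SortedAt 0 l.root.catX := by rw [SortedAt, coordAt_zero]; exact hlX.1
    have slY : SortedAt 1 l.root.catY := by rw [SortedAt, coordAt_one]; exact hlY.1
    have suX : SortedAt 0 u.root.catX := by rw [SortedAt, coordAt_zero]; exact huX.1
    have suY : SortedAt 1 u.root.catY := by rw [SortedAt, coordAt_one]; exact huY.1
    obtain ⟨ml, vxl, auxl, rfl, hlN⟩ := hlB.start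
    obtain ⟨_, _, _, _, hvx, -⟩ := hB
    obtain ⟨_, _, _, _, hvxl, -⟩ := id hlN
    subst hvx
    apply Spec.intro (body := locateBody) rfl
    dsimp [locateBody]
    refine (inBox_spec _ q).mono ?_
    rintro w t₁ ⟨⟨hqs, rfl⟩ | ⟨hqs, rfl⟩, ht₁⟩
    · dsimp
      have hloc : (PrimaryTree.split x l u).locate q = .split x l u := by
        rw [PrimaryTree.locate, if_pos hqs]
      have hdep : (PrimaryTree.split x l u).depth q = 0 := by
        rw [PrimaryTree.depth, if_pos hqs]
      rw [Located, hloc, hdep]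
      refine ⟨.inr ⟨id, vxl, auxl, _, _, rfl, hlN, ?_, ?_, ?_, ?_, ?_⟩, by omega⟩
      · intro c hc
        rcases List.mem_cons.1 hc with rfl | hc
        · exact slX
        · exact hsX c hc
      · intro c hc
        rcases List.mem_cons.1 hc with rfl | hc
        · exact slY
        · exact hsY c hc
      · simp; omega
      · simp; omega
      · rw [hstrip, hab.mem_strip] at hqs
        rw [chainCount_cons]
        rw [show above 0 q.1 (PrimaryTree.split x l u).start.catX +
          above 1 q.2 (PrimaryTree.split x l u).start.catY = rangeIn S (upper d r a b) q from
          hab.above_left hlX hlY hqs.2.2, add_comm]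
        congr 1
        -- Points before the strip have coordinate at most `a`, which is below that of `q`, so they
        -- are not in the range.
        refine rangeIn_congr fun p _ h1 h2 => ?_
        rw [hab.mem_upper]
        refine ⟨fun h => h.1, fun h => ⟨h, hqs.2.1.trans_le ?_⟩⟩
        exact_mod_cast coordAt_le_of_le h1 h2
    · subst hvxl
      dsimp
      refine (inBox_spec _ q).mono ?_
      rintro w t₂ ⟨⟨hql, rfl⟩ | ⟨hql, rfl⟩, ht₂⟩
      · dsimp
        have hloc : (PrimaryTree.split x l u).locate q = l.locate q := by
          rw [PrimaryTree.locate, if_neg hqs, if_pos hql]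
        have hdep : (PrimaryTree.split x l u).depth q = 1 + l.depth q := by
          rw [PrimaryTree.depth, if_neg hqs, if_pos hql]
        rw [hlreg] at hql
        refine (ihl (k + 1) hl hlB hql ?_ ?_ (by simpa using hkX) (by simpa using hkY)).mono ?_
        · intro c hc
          rcases List.mem_cons.1 hc with rfl | hc
          · exact slX
          · exact hsX c hc
        · intro c hc
          rcases List.mem_cons.1 hc with rfl | hc
          · exact slY
          · exact hsY c hc
        rintro w t₃ ⟨hw, ht₃⟩
        rw [hab.mem_left] at hql
        refine ⟨?_, by omega⟩
        -- The new catalogues take over the points not before the strip; the remaining ones are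
        -- those in the region of the left child.
        have e : chainCount q (l.root.catX :: x.catX :: cx) (l.root.catY :: x.catY :: cy) +
            rangeIn S (r.slab d (r.lo d) a).toSet q =
            chainCount q (x.catX :: cx) (x.catY :: cy) + rangeIn S r.toSet q := by
          rw [chainCount_cons, hab.above_left hlX hlY (hql.2.trans hab.1.le),
            rangeIn_congr (A := r.toSet) (A' := upper d r a b ∪ (r.slab d (r.lo d) a).toSet),
            rangeIn_union (A' := (r.slab d (r.lo d) a).toSet)]
          · omega
          · rw [Set.disjoint_left]
            intro p h1 h2
            exact absurd (hab.mem_upper.1 h1).2 (not_lt.2 (hab.mem_left.1 h2).2)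
          · intro p _ _ _
            rw [Set.mem_union, hab.mem_upper, hab.mem_left, ← and_or_left]
            exact ⟨fun h => ⟨h, lt_or_ge _ _⟩, fun h => h.1⟩
        rw [e] at hw
        rw [Located, hloc, hdep]
        rwa [Located, show k + 1 + l.depth q + 1 = k + (1 + l.depth q) + 1 by omega] at hw
      · dsimp
        have hloc : (PrimaryTree.split x l u).locate q = u.locate q := by
          rw [PrimaryTree.locate, if_neg hqs, if_neg hql]
        have hdep : (PrimaryTree.split x l u).depth q = 1 + u.depth q := by
          rw [PrimaryTree.depth, if_neg hqs, if_neg hql]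
        rw [hlreg, hab.mem_left] at hql
        rw [hstrip, hab.mem_strip] at hqs
        -- Being in neither the strip nor the left region leaves only the side beyond `b`; points of
        -- the range are then beyond `b` as well.
        have hqb : b < (coordAt d q : EReal) := by
          by_contra h
          exact hqs ⟨hq, not_le.1 fun h' => hql ⟨hq, h'⟩, not_lt.1 h⟩
        refine (ihu (k + 1) hu huB (hab.mem_right.2 ⟨hq, hqb⟩) ?_ ?_ (by simpa using hkX)
          (by simpa using hkY)).mono ?_
        · intro c hc
          rcases List.mem_cons.1 hc with rfl | hc
          · exact suX
          · exact hsX c hc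
        · intro c hc
          rcases List.mem_cons.1 hc with rfl | hc
          · exact suY
          · exact hsY c hc
        rintro w t₃ ⟨hw, ht₃⟩
        refine ⟨?_, by omega⟩
        have e : chainCount q (u.root.catX :: x.catX :: cx) (u.root.catY :: x.catY :: cy) +
            rangeIn S (r.slab d b (r.hi d)).toSet q =
            chainCount q (x.catX :: cx) (x.catY :: cy) + rangeIn S r.toSet q := by
          rw [← coordAt_zero] at huX
          rw [← coordAt_one] at huY
          rw [chainCount_cons, huX.above_eq, huY.above_eq]
          simp only [Finset.filter_empty, Finset.card_empty, zero_add]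
          congr 1
          refine rangeIn_congr fun p _ h1 h2 => ?_
          rw [hab.mem_right]
          refine ⟨fun h => h.1, fun h => ⟨h, hqb.trans_le ?_⟩⟩
          exact_mod_cast coordAt_le_of_le h1 h2
        rw [e] at hw
        rw [Located, hloc, hdep]
        rwa [Located, show k + 1 + u.depth q + 1 = k + (1 + u.depth q) + 1 by omega] at hw

theorem PrimaryTree.depth_le_height (q : Pt) (T : PrimaryTree) : T.depth q ≤ T.height := by
  induction T with
  | leaf v => simp [depth, height]
  | split v l r ihl ihr =>
    rw [depth, height]
    split_ifs <;> omega

theorem rangeIn_plane (S : Finset Pt) (q : Pt) : rangeIn S Box.plane.toSet q = rangeCount S q := by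
  rw [rangeIn, rangeCount]
  have h : inter S Box.plane.toSet = S := by
    ext p; exact mem_inter_plane
  rw [h]

theorem le_clog_of_pow_le {s n : ℕ} (h : 2 ^ s ≤ 8 * (2 * n + 1)) : s ≤ Nat.clog 2 n + 5 := by
  have h1 : n ≤ 2 ^ Nat.clog 2 n := Nat.le_pow_clog (by norm_num) n
  have h2 := Nat.one_le_two_pow (n := Nat.clog 2 n)
  refine (Nat.pow_le_pow_iff_right (a := 2) (by norm_num)).1 (h.trans ?_)
  rw [pow_add]
  omega

/-- Away from bad leaves, the cost is the descent, the two index searches, and two walks whose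
length is bounded by the depth. For the unconditional bound, all search depths are at most `Nat.clog
2 S.card + 5`, and a bad leaf adds one search and one descent in the backup tree. The oracle is
arbitrary, since the query never uses it. -/
theorem query_spec {O : Box → ℝ} {c : ℝ} {S : Finset Pt} {D : Measure Pt} {T : BiasedRangeTree}
    {out : Val} (hT : T.IsFor c S D) (hB : T.Built S out) (q : Pt) :
    Spec O queryProgram 0 (.pair out (encodePt q)) fun w t =>
      w = .num (rangeCount S q : ℝ) ∧
      (¬ (T.primary.locate q).IsBad S →
        t ≤ 3000 * (1 + T.primary.depth q + T.primary.indexCost q)) ∧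
      t ≤ 20000 * (Nat.clog 2 S.card + 1) := by
  obtain ⟨⟨hp, hw⟩, hP⟩ := hT
  obtain ⟨vb, vp, vi, rfl, hvb, hvp, I, hI, hIB⟩ := hB
  have hplane : q ∈ Box.plane.toSet := by simp [Box.plane, Box.toSet, EReal.bot_lt_coe, le_top]
  have hlen : T.backup.points.length = S.card := by rw [hp.length_eq, Finset.length_toList]
  obtain ⟨_, _, -, -, hX, hY, -⟩ := hP.root
  have hX0 : T.primary.root.catX = [] :=
    List.eq_nil_of_length_eq_zero (by rw [hX.length_eq]; simp [everyFourth])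
  have hY0 : T.primary.root.catY = [] :=
    List.eq_nil_of_length_eq_zero (by rw [hY.length_eq]; simp [everyFourth])
  have hdepth := (T.primary.depth_le_height q).trans hP.height_le
  apply Spec.intro (body := queryBody) rfl
  dsimp [queryBody]
  refine (locate_spec 0 hP hvp hplane ?_ ?_ (by simp) (by simp)).mono ?_
  · rw [hX0]
    intro c hc
    rw [List.mem_singleton.1 hc]
    exact .nil
  · rw [hY0]
    intro c hc
    rw [List.mem_singleton.1 hc]
    exact .nil
  rintro w t₁ ⟨⟨hbad, x, y, z, rfl⟩ | ⟨hbad, vu, aux, cx, cy, rfl, hu, hsX, hsY, hcx, hcy, hN⟩, ht₁⟩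
  · dsimp [encodePt]
    refine (search_spec (x := q.2) hI (EReal.bot_lt_coe _) le_top).mono ?_
    rintro h t₂ ⟨⟨a, b, ha, hb, pre, suf, hl, hpre, hsuf, hh⟩, ht₂⟩
    refine (backup_spec (q := q) (Nat.clog 2 S.card) (hlen ▸ Nat.le_pow_clog (by norm_num) _) hw hvb
      hh hl (fun p hp => by exact_mod_cast (hpre p hp).trans_lt ha)
      (fun p hp => by exact_mod_cast hb.trans (hsuf p hp))).mono ?_
    rintro w t₃ ⟨rfl, ht₃⟩
    refine ⟨?_, fun h => absurd hbad h, ?_⟩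
    · rw [hp.countP_eq, countP_toList, rangeCount]
    · have := le_clog_of_pow_le ((hIB q.2).trans (by omega : _ ≤ 8 * (2 * S.card + 1)))
      omega
  · obtain ⟨vcx, vcy, vtx, vty, rfl, -, -, hfX, hfY, hBX, hBY⟩ := hu
    dsimp [encodePt]
    refine (search_spec (x := q.1) hfX (EReal.bot_lt_coe _) le_top).mono ?_
    rintro h t₂ ⟨⟨a, b, ha, hb, pre, suf, hl, hpre, hsuf, hh⟩, ht₂⟩
    have wX := walk_spec (O := O) (x := q.1) cx (fun c hc => hsX c (by simp [hc])) hh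
      (fun e he => by rw [coordAt_zero]; exact_mod_cast (hpre e he).trans_lt ha)
      (fun e he => by rw [coordAt_zero]; exact_mod_cast hb.trans (hsuf e he))
    rw [flag_even Even.zero] at wX
    refine wX.mono ?_
    rintro w t₃ ⟨rfl, ht₃⟩
    dsimp
    refine (search_spec (x := q.2) hfY (EReal.bot_lt_coe _) le_top).mono ?_
    rintro h' t₄ ⟨⟨a', b', ha', hb', pre', suf', hl', hpre', hsuf', hh'⟩, ht₄⟩
    have wY := walk_spec (O := O) (x := q.2) cy (fun c hc => hsY c (by simp [hc])) hh'
      (fun e he => by rw [coordAt_one]; exact_mod_cast (hpre' e he).trans_lt ha')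
      (fun e he => by rw [coordAt_one]; exact_mod_cast hb'.trans (hsuf' e he))
    rw [flag_odd Nat.not_even_one] at wY
    refine wY.mono ?_
    rintro w t₅ ⟨rfl, ht₅⟩
    dsimp
    refine ⟨?_, fun _ => ?_, ?_⟩
    · rw [hl, hl', ← Nat.cast_add]
      congr 2
      rw [← rangeIn_plane]
      rw [hX0, hY0] at hN
      simp only [chainCount, List.map_cons, List.sum_cons, List.map_nil, List.sum_nil, above,
        List.countP_nil, zero_add, add_zero] at hN ⊢
      exact hN
    · rw [PrimaryTree.indexCost]
      omega
    · have h1 := le_clog_of_pow_le (hBX q.1)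
      have h2 := le_clog_of_pow_le (hBY q.2)
      omega

/-- For `n ≥ 2` the logarithm is at least 1, so rounding up at most doubles it; this also absorbs
lower-order terms in the final bounds. -/
theorem clog_le_two_mul_logb {n : ℕ} (hn : 2 ≤ n) :
    1 ≤ Real.logb 2 n ∧ (Nat.clog 2 n : ℝ) ≤ 2 * Real.logb 2 n ∧ 2 ^ (Nat.clog 2 n + 1) ≤ 4 * n := by
  have h1 : 1 ≤ Real.logb 2 n := by
    rw [Real.le_logb_iff_rpow_le (by norm_num) (by positivity), Real.rpow_one]
    exact_mod_cast hn
  refine ⟨h1, ?_, ?_⟩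
  · have h2 := Nat.ceil_lt_add_one (zero_le_one.trans h1)
    have h3 : ⌈Real.logb 2 n⌉₊ = Nat.clog 2 n := by exact_mod_cast Real.natCeil_logb_natCast 2 n
    rw [h3] at h2
    linarith
  · have h2 := Nat.pow_pred_clog_lt_self (b := 2) (by norm_num) (by omega : 1 < n)
    have h3 : 0 < Nat.clog 2 n := Nat.clog_pos (by norm_num) hn
    obtain ⟨k, hk⟩ : ∃ k, Nat.clog 2 n = k + 1 := ⟨_, (Nat.succ_pred_eq_of_pos h3).symm⟩
    rw [hk] at h2 ⊢
    simp only [Nat.pred_succ] at h2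
    have e : 2 ^ (k + 1 + 1) = 4 * 2 ^ k := by ring
    omega

end BRT

end

theorem mainTheorem5 :
    ∃ (c C : ℝ) (build query : BRT.Program),
      ∀ (S : Finset BRT.Pt) (D : MeasureTheory.Measure BRT.Pt)
        [MeasureTheory.IsProbabilityMeasure D],
        -- size, height and catalogues of every biased range tree for `(S, D)`
        (∀ T : BRT.BiasedRangeTree, T.IsFor c S D →
          (∀ (p : BRT.Pt) (k : ℕ),
            ((T.primary.level k).flatMap (fun v => [v.cX, v.cY])).countP
              (fun L => decide (p ∈ L)) ≤ 2) ∧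
          (2 ≤ S.card →
            (T.primary.height : ℝ) ≤ C * Real.logb 2 S.card ∧
            (T.size : ℝ) ≤ C * (S.card * Real.logb 2 S.card))) ∧
        -- construction from an arbitrary enumeration of `S`
        (∀ pts : List BRT.Pt, pts.Nodup → (∀ p, p ∈ pts ↔ p ∈ S) →
          ∃ (T : BRT.BiasedRangeTree) (out : BRT.Val) (time space : ℕ),
            T.IsFor c S D ∧ T.Rep out ∧
            BRT.Runs (BRT.oracle D) build (BRT.encodePts pts) out time space ∧
            (2 ≤ S.card →
              (time : ℝ) ≤ C * (S.card * Real.logb 2 S.card) ∧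
              (space : ℝ) ≤ C * (S.card * Real.logb 2 S.card)) ∧
            -- queries on the constructed structure
            (∀ q : BRT.Pt, ∃ t s : ℕ,
              BRT.Runs BRT.noOracle query (.pair out (BRT.encodePt q))
                (.num (BRT.rangeCount S q : ℝ)) t s ∧
              (¬ (T.primary.locate q).IsBad S →
                (t : ℝ) ≤ C * (1 + T.primary.depth q + T.primary.indexCost q)) ∧
              (2 ≤ S.card → (t : ℝ) ≤ C * Real.logb 2 S.card))) := by
  -- The slack 3 comes from the bisection; the other constant is chosen generously.
  refine ⟨3, 1000000, BRT.buildProgram, BRT.queryProgram, fun S D _ => ⟨fun T hT => ⟨?_, ?_⟩, ?_⟩⟩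
  · exact fun p k => hT.2.multiplicity_le p k
  · intro hn
    obtain ⟨h1, h2, h3⟩ := BRT.clog_le_two_mul_logb hn
    have h4 : (T.primary.height : ℝ) ≤ (Nat.clog 2 S.card : ℕ) := by
      exact_mod_cast hT.2.height_le
    have h5 := hT.size_le (by omega)
    have h6 : (T.size : ℝ) ≤ 5 * (S.card * Nat.clog 2 S.card) + 6 * S.card := by
      exact_mod_cast h5.trans (by omega)
    have h7 : (0 : ℝ) ≤ S.card := Nat.cast_nonneg _
    have h8 := mul_le_mul_of_nonneg_left h1 h7
    have h9 := mul_le_mul_of_nonneg_left h2 h7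
    exact ⟨by linarith, by linarith⟩
  · intro pts hnd hmem
    obtain ⟨out, t, s, hrun, hs, T, hT, hB, ht⟩ := (BRT.build_spec (D := D) hnd hmem).runs
    refine ⟨T, out, t + 2, s, hT, ?_, hrun, fun hn => ?_, fun q => ?_⟩
    · obtain ⟨vb, vp, vi, rfl, hvb, hvp, -⟩ := hB
      exact ⟨_, _, _, rfl, hvb, hvp.rep⟩
    · obtain ⟨h1, h2, h3⟩ := BRT.clog_le_two_mul_logb hn
      -- The power of two is at most `4 * S.card`; the remaining constants fit into another `2 *
      -- S.card`.
      have h4 : ((t + 2 : ℕ) : ℝ) ≤ 40000 * (S.card * (Nat.clog 2 S.card + 1) + 6 * S.card) := by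
        exact_mod_cast (Nat.add_le_add_right ht 2).trans (by omega)
      have h5 : (s : ℝ) ≤ ((t + 2 : ℕ) : ℝ) := by exact_mod_cast hs
      have h7 : (0 : ℝ) ≤ S.card := Nat.cast_nonneg _
      have h8 := mul_le_mul_of_nonneg_left h1 h7
      have h9 := mul_le_mul_of_nonneg_left h2 h7
      have h10 : ((t + 2 : ℕ) : ℝ) ≤ 1000000 * (S.card * Real.logb 2 S.card) := by linarith
      exact ⟨h10, h5.trans h10⟩
    · obtain ⟨w, t', s', hrun', -, rfl, h1, h2⟩ :=
        (BRT.query_spec (O := BRT.noOracle) hT hB q).runs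
      refine ⟨t' + 2, s', hrun', fun hb => ?_, fun hn => ?_⟩
      · have h3 := h1 hb
        have h4 : t' + 2 ≤ 1000000 * (1 + T.primary.depth q + T.primary.indexCost q) := by omega
        exact_mod_cast h4
      · obtain ⟨h3, h4, -⟩ := BRT.clog_le_two_mul_logb hn
        have h5 : ((t' + 2 : ℕ) : ℝ) ≤ 20000 * (Nat.clog 2 S.card + 1) + 2 := by
          exact_mod_cast Nat.add_le_add_right h2 2
        linarith
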